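/- Let $E$ be a smooth real vector bundle of rank $n$ over a smooth manifold $M$, let $\alpha:TM\to E$ be a morphism of vector bundles, and let $\nabla$ be a smooth connection on $E$. Suppose that the frame bundle of $E$, together with $\nabla$, is reduced to a subgroup $G_0\subseteq \mathrm{GL}(n,\mathbb{R})$ (a structural group of $E$ and $\nabla$) with Lie algebra $\mathfrak{g}_0$, and let $G\subseteq\mathrm{GL}(n,\mathbb{C})$ be the complexification of $G_0$, that is, the group generated by $G_0$ and $\exp(\mathfrak{g}_0\oplus i\,\mathfrak{g}_0)$. Let $P$ be the bundle of complex frames of $E^{\mathbb{C}}$ obtained from the reduction by extending its structural group to $G$. Let $F$ be a complex submanifold of the Grassmannian $\mathrm{Gr}_q(\mathbb{C}^n)$ of $q$-dimensional complex subspaces of $\mathbb{C}^n$ on which $G$ acts transitively, and let $\pi:Z=P\times_G F\to M$ be the associated bundle; thus a point $p\in Z$ is a complex subspace $p=u(V)$ of $E^{\mathbb{C}}_{\pi(p)}$, with $u\in P_{\pi(p)}$ and $V\in F$. For $p\in Z$ let $\alpha^{-1}(p)\subseteq T^{\mathbb{C}}_{\pi(p)}M$ be the preimage of $p$ under the complexification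 of $\alpha$, and suppose that $\dim\alpha^{-1}(p)$ does not depend on $p\in Z$. Let $\mathcal{C}_0\subseteq T^{\mathbb{C}}Z$ be the complex distribution that is horizontal with respect to $\nabla$ and satisfies $d\pi\bigl((\mathcal{C}_0)_p\bigr)=\alpha^{-1}(p)$ for all $p\in Z$, and let $\mathcal{C}=\mathcal{C}_0\oplus(\ker d\pi)^{0,1}$, where the fibres of $\pi$ carry the complex structure of $F$. Let $T=d^{\nabla}\alpha$, that is, $T(X,Y)=\nabla_X(\alpha Y)-\nabla_Y(\alpha X)-\alpha[X,Y]$, be the torsion of $\nabla$ with respect to $\alpha$, and let $R$ be the curvature of $\nabla$, both extended complex linearly. Then the following assertions are equivalent: (i) $\mathcal{C}$ is integrable, that is, the Lie bracket of any two smooth local sections of $\mathcal{C}$ is a section of $\mathcal{C}$; (ii) $T(X,Y)\in p$ and $R(X,Y)(p)\subseteq p$ for all $p\in Z$ and all $X,Y\in\alpha^{-1}(p)$. -/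

import Mathlib

open Bundle Set Filter Topology Module
open scoped Manifold ContDiff TensorProduct Matrix MatrixGroups

noncomputable section

namespace IntRes

/-! ### Complexified vector spaces -/

section Complexified

variable {V W U : Type*} [AddCommGroup V] [Module ℝ V] [AddCommGroup W] [Module ℝ W]
  [AddCommGroup U] [Module ℝ U]

/-- The vector `v + i w` of the complexification `ℂ ⊗ V`. -/
def cplx (v w : V) : ℂ ⊗[ℝ] V := (1 : ℂ) ⊗ₜ[ℝ] v + Complex.I ⊗ₜ[ℝ] w

/-- The real part of a vector of `ℂ ⊗ V`. -/
def rePart : ℂ ⊗[ℝ] V →ₗ[ℝ] V := (TensorProduct.lid ℝ V).toLinearMap ∘ₗ Complex.reLm.rTensor V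

/-- The imaginary part of a vector of `ℂ ⊗ V`. -/
def imPart : ℂ ⊗[ℝ] V →ₗ[ℝ] V := (TensorProduct.lid ℝ V).toLinearMap ∘ₗ Complex.imLm.rTensor V

/-- Every vector of `ℂ ⊗ V` is `v + i w` for its real part `v` and its imaginary part `w`. -/
theorem cplx_rePart_imPart (c : ℂ ⊗[ℝ] V) : cplx (rePart c) (imPart c) = c := by
  induction c with
  | zero => simp [cplx]
  | add x y hx hy =>
    rw [map_add, map_add]
    conv_rhs => rw [← hx, ← hy]
    simp only [cplx, TensorProduct.tmul_add]
    abel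
  | tmul z v =>
    simp only [cplx, rePart, imPart, LinearMap.comp_apply, LinearMap.rTensor_tmul,
      LinearEquiv.coe_coe, TensorProduct.lid_tmul, Complex.reLm_coe, Complex.imLm_coe,
      ← TensorProduct.smul_tmul, ← TensorProduct.add_tmul]
    congr 1
    simp

theorem rePart_cplx (v w : V) : rePart (cplx v w) = v := by
  simp [cplx, rePart]

theorem imPart_cplx (v w : V) : imPart (cplx v w) = w := by
  simp [cplx, imPart]

/-- The complex bilinear extension `B(v + i v', w + i w') =
B(v, w) - B(v', w') + i (B(v, w') + B(v', w))` of a real bilinear map `B`. -/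
def cplxBilin (B : V → W → U) (c : ℂ ⊗[ℝ] V) (d : ℂ ⊗[ℝ] W) : ℂ ⊗[ℝ] U :=
  cplx (B (rePart c) (rePart d) - B (imPart c) (imPart d))
    (B (rePart c) (imPart d) + B (imPart c) (rePart d))

end Complexified

/-! ### The structural group and its complexification -/

section Groups

variable {n : ℕ}

/-- The Lie algebra of a Lie subgroup of `GL(n, ℝ)`: the generators of its one-parameter
subgroups. -/
def lieAlg (G : Subgroup (GL (Fin n) ℝ)) : Set (Matrix (Fin n) (Fin n) ℝ) :=
  {A | ∀ t : ℝ, ∃ g ∈ G, (g : Matrix (Fin n) (Fin n) ℝ) = NormedSpace.exp (t • A)}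

/-- The inclusion of `GL(n, ℝ)` into `GL(n, ℂ)`. -/
def glC : GL (Fin n) ℝ →* GL (Fin n) ℂ := Matrix.GeneralLinearGroup.map (algebraMap ℝ ℂ)

/-- The complexification of `G ⊆ GL(n, ℝ)`, with Lie algebra `𝔤`: the subgroup of `GL(n, ℂ)`
generated by `G` and by the exponentials of the elements of `𝔤 ⊕ i 𝔤`. -/
def complexification (G : Subgroup (GL (Fin n) ℝ)) : Subgroup (GL (Fin n) ℂ) :=
  Subgroup.closure (glC '' (G : Set (GL (Fin n) ℝ)) ∪
    {g | ∃ A ∈ lieAlg G, ∃ B ∈ lieAlg G, (g : Matrix (Fin n) (Fin n) ℂ) =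
      NormedSpace.exp (A.map ((↑) : ℝ → ℂ) + Complex.I • B.map ((↑) : ℝ → ℂ))})

theorem glC_mem {G : Subgroup (GL (Fin n) ℝ)} {g : GL (Fin n) ℝ} (hg : g ∈ G) :
    glC g ∈ complexification G :=
  Subgroup.subset_closure (Or.inl ⟨g, hg, rfl⟩)

/-- The image of a complex subspace of `ℂⁿ` under an element of `GL(n, ℂ)`. -/
def glMap (g : GL (Fin n) ℂ) (V : Submodule ℂ (Fin n → ℂ)) : Submodule ℂ (Fin n → ℂ) :=
  V.map (Matrix.mulVecLin (g : Matrix (Fin n) (Fin n) ℂ))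

end Groups

/-! ### Homogeneous complex submanifolds of the Grassmannian -/

section Grassmann

variable {n : ℕ} {EF : Type*} [NormedAddCommGroup EF] [NormedSpace ℂ EF]
  {F : Type*} [TopologicalSpace F] [ChartedSpace EF F]

/-- A map `s` from a complex manifold `F` to the Grassmannian of `q`-dimensional complex subspaces
of `ℂⁿ` is a holomorphic immersion: near each point `f₀`, the subspaces `s f` have a basis
`v₁(f), …, v_q(f)` which depends holomorphically on `f`, and the differential of `s` at `f₀`, which
takes `ξ` to the element `v_j(f₀) ↦ dv_j(ξ) mod s(f₀)` of `Hom(s(f₀), ℂⁿ/s(f₀))`, is injective. -/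
def IsHolomorphicImmersion (q : ℕ) (s : F → Submodule ℂ (Fin n → ℂ)) : Prop :=
  (∀ f, finrank ℂ (s f) = q) ∧
  ∀ f₀ : F, ∃ v : Fin q → F → (Fin n → ℂ),
    (∀ j, ContMDiffAt 𝓘(ℂ, EF) 𝓘(ℂ, Fin n → ℂ) ω (v j) f₀) ∧
    (∀ᶠ f in 𝓝 f₀, s f = Submodule.span ℂ (range fun j => v j f)) ∧
    ∀ ξ : TangentSpace 𝓘(ℂ, EF) f₀,
      (∀ j, (mfderiv 𝓘(ℂ, EF) 𝓘(ℂ, Fin n → ℂ) (v j) f₀ ξ : Fin n → ℂ) ∈ s f₀) → ξ = 0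

variable (F) in
/-- A complex submanifold `F` of the Grassmannian `Gr_q(ℂⁿ)` on which the complexification of
`G ⊆ GL(n, ℝ)` acts transitively. The manifold `F` is given with its inclusion `toSub`, an injective
holomorphic immersion. The action of `G` on `F` is required to be continuous; this is automatic if
`F` carries the topology induced from the Grassmannian. -/
structure HomogeneousSubmanifold (G : Subgroup (GL (Fin n) ℝ)) (q : ℕ) where
  /-- The point of the Grassmannian. -/
  toSub : F → Submodule ℂ (Fin n → ℂ)
  injective : Function.Injective toSub
  immersion : IsHolomorphicImmersion (EF := EF) q toSub
  stable : ∀ g ∈ complexification G, ∀ f, ∃ f', toSub f' = glMap g (toSub f)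
  transitive : ∀ f f', ∃ g ∈ complexification G, toSub f' = glMap g (toSub f)
  continuous_action : ∃ act : G × F → F, Continuous act ∧
    ∀ g f, toSub (act (g, f)) = glMap (glC g) (toSub f)

end Grassmann

/-! ### Reductions of the frame bundle -/

section Frames

variable {n : ℕ} {EM : Type*} [NormedAddCommGroup EM] [NormedSpace ℝ EM]
  {M : Type*} [TopologicalSpace M] [ChartedSpace EM M]
  {E : M → Type*} [∀ x, AddCommGroup (E x)] [∀ x, Module ℝ (E x)]

/-- The complex frame of `E_x^ℂ` given by a real frame of `E_x`. -/
def cFrame {x : M} (u : (Fin n → ℝ) ≃ₗ[ℝ] E x) : (Fin n → ℂ) ≃ₗ[ℂ] ℂ ⊗[ℝ] E x :=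
  (TensorProduct.piScalarRight ℝ ℂ ℂ (Fin n)).symm ≪≫ₗ u.baseChange ℝ ℂ (Fin n → ℝ) (E x)

variable [TopologicalSpace (TotalSpace (Fin n → ℝ) E)]

/-- `u` restricts to a smooth section over the open set `O` of the bundle of those frames of `E`
that belong to the sets `fr x`. -/
structure IsLocalSection (fr : ∀ x, Set ((Fin n → ℝ) ≃ₗ[ℝ] E x)) (O : Set M)
    (u : ∀ x, (Fin n → ℝ) ≃ₗ[ℝ] E x)
    [∀ x, TopologicalSpace (E x)] [FiberBundle (Fin n → ℝ) E] : Prop where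
  isOpen : IsOpen O
  mem : ∀ x ∈ O, u x ∈ fr x
  smooth : ∀ j, ContMDiffOn 𝓘(ℝ, EM) (𝓘(ℝ, EM).prod 𝓘(ℝ, Fin n → ℝ)) ∞
    (fun x => TotalSpace.mk' (Fin n → ℝ) x (u x (Pi.single j 1))) O

variable (E) in
/-- A reduction of the frame bundle of `E` to the group `G`, which is then a structural group
of `E`. -/
structure FrameReduction (G : Subgroup (GL (Fin n) ℝ))
    [∀ x, TopologicalSpace (E x)] [FiberBundle (Fin n → ℝ) E] where
  /-- The frames over each point. -/
  frames : ∀ x, Set ((Fin n → ℝ) ≃ₗ[ℝ] E x)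
  torsor : ∀ x, ∀ u ∈ frames x, ∀ u' : (Fin n → ℝ) ≃ₗ[ℝ] E x,
    u' ∈ frames x ↔ ∃ g ∈ G, ∀ c, u' c = u ((g : Matrix (Fin n) (Fin n) ℝ) *ᵥ c)
  exists_section : ∀ x, ∃ O u, x ∈ O ∧ IsLocalSection (EM := EM) frames O u

namespace FrameReduction

variable {G : Subgroup (GL (Fin n) ℝ)} [∀ x, TopologicalSpace (E x)]
  [FiberBundle (Fin n → ℝ) E] (P : FrameReduction (EM := EM) E G)

/-- The bundle `P` of complex frames of `E^ℂ`, obtained from the reduction by extending the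
structural group to its complexification. -/
def complexFrames (x : M) : Set ((Fin n → ℂ) ≃ₗ[ℂ] ℂ ⊗[ℝ] E x) :=
  {w | ∃ u ∈ P.frames x, ∃ g ∈ complexification G,
    ∀ c, w c = cFrame u ((g : Matrix (Fin n) (Fin n) ℂ) *ᵥ c)}

/-- The connection `∇` is reducible to `P`, so that `G` is a structural group of `∇`, too: with
respect to the local sections of `P`, its connection forms have values in the Lie algebra of
`G`. -/
def IsPreservedBy [∀ x, IsTopologicalAddGroup (E x)] [∀ x, ContinuousSMul ℝ (E x)]
    (cov : CovariantDerivative 𝓘(ℝ, EM) (Fin n → ℝ) E) : Prop :=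
  ∀ O u, IsLocalSection (EM := EM) P.frames O u → ∀ x ∈ O, ∀ v : TangentSpace 𝓘(ℝ, EM) x,
    ∃ A ∈ lieAlg G, ∀ j, cov (fun y => u y (Pi.single j 1)) x v = u x (A *ᵥ Pi.single j 1)

end FrameReduction

end Frames

/-! ### The bundle `Z = P ×_G F` -/

section Bundle

set_option linter.unusedSectionVars false

variable {n q : ℕ} {EM : Type*} [NormedAddCommGroup EM] [NormedSpace ℝ EM]
  {M : Type*} [TopologicalSpace M] [ChartedSpace EM M]
  {E : M → Type*} [∀ x, AddCommGroup (E x)] [∀ x, Module ℝ (E x)]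
  [TopologicalSpace (TotalSpace (Fin n → ℝ) E)] [∀ x, TopologicalSpace (E x)]
  [FiberBundle (Fin n → ℝ) E]
  {EF : Type*} [NormedAddCommGroup EF] [NormedSpace ℂ EF]
  {F : Type*} [TopologicalSpace F] [ChartedSpace EF F]
  {G : Subgroup (GL (Fin n) ℝ)}

theorem cFrame_ofReal {x : M} (u : (Fin n → ℝ) ≃ₗ[ℝ] E x) (a : Fin n → ℝ) :
    cFrame u (fun i => (a i : ℂ)) = (1 : ℂ) ⊗ₜ[ℝ] u a := by
  have h : (TensorProduct.piScalarRight ℝ ℂ ℂ (Fin n)).symm (fun i => (a i : ℂ))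
      = (1 : ℂ) ⊗ₜ[ℝ] a := by
    rw [LinearEquiv.symm_apply_eq]
    ext i
    simp
  simp [cFrame, h]

theorem cFrame_mul {x : M} {u u' : (Fin n → ℝ) ≃ₗ[ℝ] E x} {h : GL (Fin n) ℝ}
    (hu : ∀ c, u' c = u ((h : Matrix (Fin n) (Fin n) ℝ) *ᵥ c)) (c : Fin n → ℂ) :
    cFrame u' c = cFrame u ((glC h : Matrix (Fin n) (Fin n) ℂ) *ᵥ c) := by
  have key : (cFrame u').toLinearMap = (cFrame u).toLinearMap ∘ₗ
      Matrix.mulVecLin (glC h : Matrix (Fin n) (Fin n) ℂ) := by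
    refine LinearMap.pi_ext' fun j => LinearMap.ext_ring ?_
    have e1 : (Pi.single j (1 : ℂ) : Fin n → ℂ)
        = fun i => (((Pi.single j (1 : ℝ) : Fin n → ℝ) i : ℝ) : ℂ) := by
      ext i
      by_cases hij : i = j
      · subst hij; simp
      · simp [hij]
    have e2 : (glC h : Matrix (Fin n) (Fin n) ℂ) *ᵥ (Pi.single j (1 : ℂ))
        = fun i => ((((h : Matrix (Fin n) (Fin n) ℝ) *ᵥ Pi.single j 1) i : ℝ) : ℂ) := by
      ext i
      simp [glC]
    simp only [LinearMap.comp_apply, LinearMap.single_apply, LinearEquiv.coe_coe,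
      Matrix.mulVecLin_apply]
    rw [e2, e1, cFrame_ofReal, cFrame_ofReal, hu]
  exact LinearMap.congr_fun key c

theorem map_cFrame_mul {x : M} {u u' : (Fin n → ℝ) ≃ₗ[ℝ] E x} {h : GL (Fin n) ℝ}
    (hu : ∀ c, u' c = u ((h : Matrix (Fin n) (Fin n) ℝ) *ᵥ c)) (V : Submodule ℂ (Fin n → ℂ)) :
    V.map (cFrame u').toLinearMap = (glMap (glC h) V).map (cFrame u).toLinearMap := by
  rw [glMap, ← Submodule.map_comp]
  congr 1
  exact LinearMap.ext fun c => cFrame_mul hu c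

/-- The fibre over `x` of the associated bundle `P ×_G F`: the complex subspaces `w(V)` of `E_x^ℂ`
with `w` in `P_x` and `V` in `F`. -/
def AssocFibre (P : FrameReduction (EM := EM) E G) (S : HomogeneousSubmanifold (EF := EF) F G q)
    (x : M) : Type _ :=
  {p : Submodule ℂ (ℂ ⊗[ℝ] E x) //
    ∃ w ∈ P.complexFrames x, ∃ f, p = (S.toSub f).map w.toLinearMap}

variable (P : FrameReduction (EM := EM) E G) (S : HomogeneousSubmanifold (EF := EF) F G q)

/-- The total space of the bundle `P ×_G F`; its points are pairs of a point `x` of `M` and a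
complex subspace of `E_x^ℂ`. -/
abbrev AssocBundle : Type _ := TotalSpace F (AssocFibre P S)

/-- The complex subspace of `E_x^ℂ` that a point of `P ×_G F` over `x` is. -/
def AssocBundle.sub {P : FrameReduction (EM := EM) E G}
    {S : HomogeneousSubmanifold (EF := EF) F G q} (z : AssocBundle P S) :
    Submodule ℂ (ℂ ⊗[ℝ] E z.proj) := z.snd.1

variable {P} in
theorem cFrame_mem {x : M} {u : (Fin n → ℝ) ≃ₗ[ℝ] E x} (hu : u ∈ P.frames x) :
    cFrame u ∈ P.complexFrames x :=
  ⟨u, hu, 1, one_mem _, fun c => by simp⟩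

variable {P} in
/-- The point `[u, f]` of `P ×_G F`, as a point of its fibre. -/
def fibrePoint {x : M} {u : (Fin n → ℝ) ≃ₗ[ℝ] E x} (hu : u ∈ P.frames x) (f : F) :
    AssocFibre P S x :=
  ⟨(S.toSub f).map (cFrame u).toLinearMap, cFrame u, cFrame_mem hu, f, rfl⟩

variable {P S} in
theorem exists_fibrePoint {x : M} {u : (Fin n → ℝ) ≃ₗ[ℝ] E x} (hu : u ∈ P.frames x)
    (p : AssocFibre P S x) : ∃ f, p = fibrePoint S hu f := by
  obtain ⟨p, w, ⟨u', hu', g, hg, hw⟩, f, rfl⟩ := p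
  obtain ⟨h, hh, hc⟩ := (P.torsor x u hu u').1 hu'
  obtain ⟨f₁, hf₁⟩ := S.stable g hg f
  obtain ⟨f₂, hf₂⟩ := S.stable (glC h) (glC_mem hh) f₁
  refine ⟨f₂, Subtype.ext ?_⟩
  change (S.toSub f).map w.toLinearMap = (S.toSub f₂).map (cFrame u).toLinearMap
  rw [hf₂, ← map_cFrame_mul hc, hf₁, glMap, ← Submodule.map_comp]
  congr 1
  exact LinearMap.ext hw

theorem fibrePoint_injective {x : M} {u : (Fin n → ℝ) ≃ₗ[ℝ] E x} (hu : u ∈ P.frames x) :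
    Function.Injective (fibrePoint S hu) := by
  intro f f' h
  apply S.injective
  exact Submodule.map_injective_of_injective (cFrame u).injective (congrArg Subtype.val h)

variable {P S} in
/-- The component `f` of a point `[u, f]` of the fibre, for a given frame `u`. -/
def fibreCoord {x : M} {u : (Fin n → ℝ) ≃ₗ[ℝ] E x} (hu : u ∈ P.frames x)
    (p : AssocFibre P S x) : F := Classical.choose (exists_fibrePoint hu p)

variable {P S} in
theorem fibrePoint_fibreCoord {x : M} {u : (Fin n → ℝ) ≃ₗ[ℝ] E x} (hu : u ∈ P.frames x)
    (p : AssocFibre P S x) : fibrePoint S hu (fibreCoord hu p) = p :=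
  (Classical.choose_spec (exists_fibrePoint hu p)).symm

variable {P S} in
theorem fibreCoord_fibrePoint {x : M} {u : (Fin n → ℝ) ≃ₗ[ℝ] E x} (hu : u ∈ P.frames x)
    (f : F) : fibreCoord hu (fibrePoint S hu f) = f :=
  fibrePoint_injective P S hu (fibrePoint_fibreCoord hu _)

variable {P} in
theorem frames_nonempty (x : M) : ∃ u, u ∈ P.frames x := by
  obtain ⟨O, u, hx, hu⟩ := P.exists_section x
  exact ⟨u x, hu.mem x hx⟩

open Classical in
/-- The frame `u x` if it belongs to `P`, else some frame that does. -/
def someFrame (u : ∀ x, (Fin n → ℝ) ≃ₗ[ℝ] E x) (x : M) : (Fin n → ℝ) ≃ₗ[ℝ] E x :=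
  if u x ∈ P.frames x then u x else Classical.choose (frames_nonempty (P := P) x)

theorem someFrame_mem (u : ∀ x, (Fin n → ℝ) ≃ₗ[ℝ] E x) (x : M) :
    someFrame P u x ∈ P.frames x := by
  unfold someFrame
  split_ifs with h
  · exact h
  · exact Classical.choose_spec (frames_nonempty (P := P) x)

variable {P} in
theorem someFrame_eq {u : ∀ x, (Fin n → ℝ) ≃ₗ[ℝ] E x} {x : M} (h : u x ∈ P.frames x) :
    someFrame P u x = u x := if_pos h

/-- The section `x ↦ [u_x, f]` of `P ×_G F` defined by a local section `u` of `P` (outside the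
domain of `u` its values have no meaning). -/
def sectionOf (u : ∀ x, (Fin n → ℝ) ≃ₗ[ℝ] E x) (f : F) (x : M) : AssocBundle P S :=
  ⟨x, fibrePoint S (someFrame_mem P u x) f⟩

/-- The local trivialization `[u_x, f] ↦ (x, f)` of `P ×_G F` defined by a local section `u` of
`P`. -/
def localTriv {O : Set M} {u : ∀ x, (Fin n → ℝ) ≃ₗ[ℝ] E x}
    (hu : IsLocalSection (EM := EM) P.frames O u) :
    Pretrivialization F (π F (AssocFibre P S)) where
  toFun z := (z.proj, fibreCoord (someFrame_mem P u z.proj) z.snd)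
  invFun y := sectionOf P S u y.2 y.1
  source := π F (AssocFibre P S) ⁻¹' O
  target := O ×ˢ univ
  map_source' z hz := ⟨hz, trivial⟩
  map_target' y hy := hy.1
  left_inv' z _ := by
    obtain ⟨x, p⟩ := z
    simp only [sectionOf, fibrePoint_fibreCoord]
  right_inv' y _ := by
    obtain ⟨x, f⟩ := y
    simp only [sectionOf, fibreCoord_fibrePoint]
  open_target := hu.isOpen.prod isOpen_univ
  baseSet := O
  open_baseSet := hu.isOpen
  source_eq := rfl
  target_eq := rfl
  proj_toFun _ _ := rfl

/-! The change of trivialization is continuous. -/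

/-- The matrix `h` such that `u' = u h`, for two frames `u` and `u'`. -/
def transMat {x : M} (u u' : (Fin n → ℝ) ≃ₗ[ℝ] E x) : Matrix (Fin n) (Fin n) ℝ :=
  LinearMap.toMatrix' (u'.trans u.symm).toLinearMap

theorem transMat_mulVec {x : M} (u u' : (Fin n → ℝ) ≃ₗ[ℝ] E x) (c : Fin n → ℝ) :
    u' c = u (transMat u u' *ᵥ c) := by
  rw [transMat, LinearMap.toMatrix'_mulVec]
  simp

theorem transMat_eq {x : M} {u u' : (Fin n → ℝ) ≃ₗ[ℝ] E x} {A : Matrix (Fin n) (Fin n) ℝ}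
    (h : ∀ c, u' c = u (A *ᵥ c)) : transMat u u' = A := by
  have : (u'.trans u.symm).toLinearMap = Matrix.toLin' A := by
    refine LinearMap.ext fun c => ?_
    simp [h]
  rw [transMat, this, LinearMap.toMatrix'_toLin']

theorem continuousAt_matrix_mul {X : Type*} [TopologicalSpace X] {x₀ : X}
    {A B : X → Matrix (Fin n) (Fin n) ℝ} (hA : ContinuousAt A x₀) (hB : ContinuousAt B x₀) :
    ContinuousAt (fun x => A x * B x) x₀ := by
  refine continuousAt_pi.2 fun i => continuousAt_pi.2 fun j => ?_
  simp only [Matrix.mul_apply]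
  exact tendsto_finsetSum _ fun k _ => (continuousAt_pi.1 (continuousAt_pi.1 hA i) k).mul
    (continuousAt_pi.1 (continuousAt_pi.1 hB k) j)

theorem continuousAt_inv_mul {X : Type*} [TopologicalSpace X] {x₀ : X}
    {A B : X → Matrix (Fin n) (Fin n) ℝ} (hA : ContinuousAt A x₀) (hB : ContinuousAt B x₀)
    (h : (A x₀).det ≠ 0) :
    ContinuousAt (fun x => (A x).det⁻¹ • ((A x).adjugate * B x)) x₀ := by
  have h1 : Continuous (Matrix.adjugate : Matrix (Fin n) (Fin n) ℝ → _) :=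
    continuous_id.matrix_adjugate
  have h2 : Continuous fun C : Matrix (Fin n) (Fin n) ℝ => C.det := continuous_id.matrix_det
  have h3 : ContinuousAt (fun x => (A x).adjugate) x₀ :=
    ContinuousAt.comp (g := Matrix.adjugate) h1.continuousAt hA
  exact ContinuousAt.smul (ContinuousAt.inv₀ (h2.continuousAt.comp hA) h)
    (continuousAt_matrix_mul h3 hB)

theorem continuousOn_transMat [VectorBundle ℝ (Fin n → ℝ) E] {O O' : Set M}
    {u u' : ∀ x, (Fin n → ℝ) ≃ₗ[ℝ] E x}
    (hu : IsLocalSection (EM := EM) P.frames O u)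
    (hu' : IsLocalSection (EM := EM) P.frames O' u') :
    ContinuousOn (fun x => transMat (u x) (u' x)) (O ∩ O') := by
  intro x₀ hx₀
  refine ContinuousAt.continuousWithinAt ?_
  let e := trivializationAt (Fin n → ℝ) E x₀
  have hmem : ∀ᶠ x in 𝓝 x₀, x ∈ e.baseSet :=
    e.open_baseSet.mem_nhds (FiberBundle.mem_baseSet_trivializationAt _ _ _)
  let A : (∀ x, (Fin n → ℝ) ≃ₗ[ℝ] E x) → M → Matrix (Fin n) (Fin n) ℝ := fun u x =>
    LinearMap.toMatrix' ((e.linearMapAt ℝ x) ∘ₗ (u x).toLinearMap)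
  have hcont : ∀ (O : Set M) (u : ∀ x, (Fin n → ℝ) ≃ₗ[ℝ] E x),
      IsLocalSection (EM := EM) P.frames O u → x₀ ∈ O → ContinuousAt (A u) x₀ := by
    intro O u hu hx
    refine continuousAt_pi.2 fun i => continuousAt_pi.2 fun j => ?_
    have h1 := ((hu.smooth j).continuousOn.continuousAt (hu.isOpen.mem_nhds hx))
    have h2 := (FiberBundle.continuousAt_totalSpace _ _).1 h1
    have h3 := (continuous_apply i).continuousAt.comp h2.2
    refine h3.congr ?_
    filter_upwards [hmem] with x hxe
    simp only [A, LinearMap.toMatrix'_apply, LinearMap.comp_apply, LinearEquiv.coe_coe,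
      Function.comp_apply, e.coe_linearMapAt_of_mem hxe]
    rfl
  have hdet : ∀ (u : ∀ x, (Fin n → ℝ) ≃ₗ[ℝ] E x) (x), x ∈ e.baseSet → (A u x).det ≠ 0 := by
    intro u x hx
    have : (A u x) =
        LinearMap.toMatrix' ((u x).trans (e.linearEquivAt ℝ x hx)).toLinearMap := by
      refine congrArg LinearMap.toMatrix' (LinearMap.ext fun c => ?_)
      simp [e.coe_linearMapAt_of_mem hx]
    rw [this, LinearMap.det_toMatrix']
    exact (LinearEquiv.isUnit_det' _).ne_zero
  have hA := hcont O u hu hx₀.1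
  have hA' := hcont O' u' hu' hx₀.2
  have hx₀e := hmem.self_of_nhds
  have hinv := continuousAt_inv_mul hA hA' (hdet u x₀ hx₀e)
  refine hinv.congr ?_
  filter_upwards [hmem] with x hx
  have hmul : A u' x = A u x * transMat (u x) (u' x) := by
    simp only [A, transMat, ← LinearMap.toMatrix'_comp]
    refine congrArg _ (LinearMap.ext fun c => ?_)
    simp
  rw [hmul, ← Matrix.mul_assoc, Matrix.adjugate_mul, Matrix.smul_mul, Matrix.one_mul, smul_smul,
    inv_mul_cancel₀ (hdet u x hx), one_smul]

theorem continuousOn_trivChange [VectorBundle ℝ (Fin n → ℝ) E] {O O' : Set M}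
    {u u' : ∀ x, (Fin n → ℝ) ≃ₗ[ℝ] E x}
    (hu : IsLocalSection (EM := EM) P.frames O u)
    (hu' : IsLocalSection (EM := EM) P.frames O' u') :
    ContinuousOn (localTriv P S hu ∘ (localTriv P S hu').toPartialEquiv.symm)
      ((localTriv P S hu').target ∩
        (localTriv P S hu').toPartialEquiv.symm ⁻¹' (localTriv P S hu).source) := by
  obtain ⟨act, hact, hact'⟩ := S.continuous_action
  have hsub : ((localTriv P S hu').target ∩
        (localTriv P S hu').toPartialEquiv.symm ⁻¹' (localTriv P S hu).source)
        ⊆ (O ∩ O') ×ˢ (univ : Set F) := fun y hy => ⟨⟨hy.2, hy.1.1⟩, trivial⟩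
  refine ContinuousOn.mono ?_ hsub
  rw [continuousOn_iff_continuous_domRestrict]
  have hex : ∀ y : ((O ∩ O') ×ˢ (univ : Set F) : Set (M × F)), ∃ g ∈ G,
      (g : Matrix (Fin n) (Fin n) ℝ) = transMat (u y.1.1) (u' y.1.1) := by
    intro y
    obtain ⟨g, hg, h⟩ := (P.torsor _ _ (hu.mem _ y.2.1.1) _).1 (hu'.mem _ y.2.1.2)
    exact ⟨g, hg, (transMat_eq h).symm⟩
  choose γ hγ hγ' using hex
  have hγinv : ∀ y, ((γ y)⁻¹ : GL (Fin n) ℝ).1 = transMat (u' y.1.1) (u y.1.1) := by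
    intro y
    refine (transMat_eq fun c => ?_).symm
    rw [transMat_mulVec (u y.1.1) (u' y.1.1), ← hγ' y, Matrix.mulVec_mulVec]
    simp
  have hfst : Continuous fun y : ((O ∩ O') ×ˢ (univ : Set F) : Set (M × F)) => y.1.1 :=
    continuous_fst.comp continuous_subtype_val
  have hγc : Continuous γ := by
    refine Units.continuous_iff.2 ⟨?_, ?_⟩
    · refine ((continuousOn_transMat P hu hu').comp_continuous hfst fun y => y.2.1).congr ?_
      intro y
      exact (hγ' y).symm
    · refine ((continuousOn_transMat P hu' hu).comp_continuous hfst
        fun y => ⟨y.2.1.2, y.2.1.1⟩).congr ?_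
      intro y
      exact (hγinv y).symm
  have hfin : Continuous fun y : ((O ∩ O') ×ˢ (univ : Set F) : Set (M × F)) =>
      (y.1.1, act (⟨γ y, hγ y⟩, y.1.2)) :=
    hfst.prodMk (hact.comp ((hγc.subtype_mk _).prodMk
      (continuous_snd.comp continuous_subtype_val)))
  refine hfin.congr ?_
  rintro ⟨⟨x, f⟩, ⟨hx, hx'⟩, hf⟩
  refine Prod.ext rfl ?_
  change _ = fibreCoord (someFrame_mem P u x) (fibrePoint S (someFrame_mem P u' x) f)
  refine fibrePoint_injective P S (someFrame_mem P u x) ?_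
  rw [fibrePoint_fibreCoord]
  refine Subtype.ext ?_
  change (S.toSub _).map (cFrame (someFrame P u x)).toLinearMap
    = (S.toSub f).map (cFrame (someFrame P u' x)).toLinearMap
  rw [hact', someFrame_eq (hu.mem x hx), someFrame_eq (hu'.mem x hx')]
  refine (map_cFrame_mul (fun c => ?_) _).symm
  rw [hγ']
  exact transMat_mulVec _ _ c

variable {P} in
/-- A local section of `P` near `x`. -/
theorem exists_localSection (x : M) : ∃ Ou : Set M × (∀ x, (Fin n → ℝ) ≃ₗ[ℝ] E x),
    x ∈ Ou.1 ∧ IsLocalSection (EM := EM) P.frames Ou.1 Ou.2 := by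
  obtain ⟨O, u, h⟩ := P.exists_section x
  exact ⟨⟨O, u⟩, h⟩

/-- The local trivialization of `P ×_G F` defined by some local section of `P` near `x`. -/
def localTrivAt (x : M) : Pretrivialization F (π F (AssocFibre P S)) :=
  localTriv P S (Classical.choose_spec (exists_localSection (P := P) x)).2

theorem mem_baseSet_localTrivAt (x : M) : x ∈ (localTrivAt P S x).baseSet :=
  (Classical.choose_spec (exists_localSection (P := P) x)).1

instance (x : M) : TopologicalSpace (AssocFibre P S x) :=
  TopologicalSpace.induced (localTrivAt P S x ∘ TotalSpace.mk x) inferInstance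

variable [VectorBundle ℝ (Fin n → ℝ) E]

/-- The local trivializations defined by the local sections of `P` make `P ×_G F` into a fibre
bundle. -/
def assocPrebundle : FiberPrebundle F (AssocFibre P S) where
  pretrivializationAtlas := {e | ∃ (O : Set M) (u : ∀ x, (Fin n → ℝ) ≃ₗ[ℝ] E x)
    (hu : IsLocalSection (EM := EM) P.frames O u), e = localTriv P S hu}
  pretrivializationAt := localTrivAt P S
  mem_base_pretrivializationAt := mem_baseSet_localTrivAt P S
  pretrivialization_mem_atlas _ := ⟨_, _, _, rfl⟩
  continuous_trivChange := by
    rintro e ⟨O, u, hu, rfl⟩ e' ⟨O', u', hu', rfl⟩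
    exact continuousOn_trivChange P S hu hu'
  totalSpaceMk_isInducing _ := ⟨rfl⟩

instance : TopologicalSpace (AssocBundle P S) := (assocPrebundle P S).totalSpaceTopology

instance : FiberBundle F (AssocFibre P S) := (assocPrebundle P S).toFiberBundle

/-- The smooth structure of `P ×_G F`: its charts are the local trivializations, followed by the
products of the charts of `M` and of `F`. -/
instance : ChartedSpace (ModelProd EM EF) (AssocBundle P S) :=
  ChartedSpace.comp (ModelProd EM EF) (M × F) (AssocBundle P S)

variable (EM EF) in
/-- The model with corners of `P ×_G F` as a real manifold. -/
abbrev assocModel : ModelWithCorners ℝ (EM × EF) (ModelProd EM EF) :=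
  𝓘(ℝ, EM).prod 𝓘(ℝ, EF)

variable {P} in
/-- The map `f ↦ [u, f]`, which identifies `F` with the fibre of `P ×_G F` over `x`. -/
def fibreInclusion {x : M} {u : (Fin n → ℝ) ≃ₗ[ℝ] E x} (hu : u ∈ P.frames x) (f : F) :
    AssocBundle P S := ⟨x, fibrePoint S hu f⟩

variable {P S}

/-- The horizontal space at `z` of the connection induced by `∇` on `P ×_G F`: it consists of the
vectors `d[u, f](v)`, for the local sections `u` of `P` such that `∇_v u = 0` (that is, `du(v)` is
horizontal) and `[u, f]` passes through `z`. -/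
def horizontal [∀ x, IsTopologicalAddGroup (E x)] [∀ x, ContinuousSMul ℝ (E x)]
    (cov : CovariantDerivative 𝓘(ℝ, EM) (Fin n → ℝ) E) (z : AssocBundle P S) :
    Submodule ℝ (TangentSpace (assocModel EM EF) z) :=
  Submodule.span ℝ {w | ∃ (O : Set M) (u : ∀ x, (Fin n → ℝ) ≃ₗ[ℝ] E x) (f : F)
    (v : TangentSpace 𝓘(ℝ, EM) z.proj), IsLocalSection (EM := EM) P.frames O u ∧ z.proj ∈ O ∧
    (∀ j, cov (fun y => u y (Pi.single j 1)) z.proj v = 0) ∧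
    tangentMap 𝓘(ℝ, EM) (assocModel EM EF) (sectionOf P S u f) ⟨z.proj, v⟩ = ⟨z, w⟩}

/-- The space `(ker dπ)^{0,1}` at `z`. The fibre of `P ×_G F` has the complex structure of `F`, and
its vectors of type `(0,1)`, the eigenvectors of the complex structure `J` for `-i`, are
`w + i J w` with `w` vertical. -/
def verticalZeroOne (z : AssocBundle P S) :
    Submodule ℂ (ℂ ⊗[ℝ] TangentSpace (assocModel EM EF) z) :=
  Submodule.span ℂ {c | ∃ (u : (Fin n → ℝ) ≃ₗ[ℝ] E z.proj) (hu : u ∈ P.frames z.proj) (f : F)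
    (ξ : EF) (w w' : TangentSpace (assocModel EM EF) z),
    tangentMap 𝓘(ℝ, EF) (assocModel EM EF) (fibreInclusion S hu) ⟨f, ξ⟩ = ⟨z, w⟩ ∧
    tangentMap 𝓘(ℝ, EF) (assocModel EM EF) (fibreInclusion S hu) ⟨f, Complex.I • ξ⟩ = ⟨z, w'⟩ ∧
    c = cplx w w'}

/-- The space `α⁻¹(p)` of complex tangent vectors of `M`, for a point `p` of `P ×_G F`. -/
def alphaInv (α : ∀ x, TangentSpace 𝓘(ℝ, EM) x →L[ℝ] E x) (p : AssocBundle P S) :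
    Submodule ℂ (ℂ ⊗[ℝ] TangentSpace 𝓘(ℝ, EM) p.proj) :=
  p.sub.comap ((α p.proj).toLinearMap.baseChange ℂ)

/-- The differential of the projection `π : P ×_G F → M`, on complex tangent vectors. -/
def dProj (z : AssocBundle P S) : ℂ ⊗[ℝ] TangentSpace (assocModel EM EF) z →ₗ[ℂ]
    ℂ ⊗[ℝ] TangentSpace 𝓘(ℝ, EM) z.proj :=
  (mfderiv (assocModel EM EF) 𝓘(ℝ, EM) (fun z : AssocBundle P S => z.proj) z).toLinearMap.baseChange
    ℂ

/-- The complex distribution `𝒞 = 𝒞₀ ⊕ (ker dπ)^{0,1}` on `P ×_G F`, where `𝒞₀` is the horizontal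
distribution with `dπ(𝒞₀) = α⁻¹(p)` at each point `p`. -/
def twistorDistribution [∀ x, IsTopologicalAddGroup (E x)] [∀ x, ContinuousSMul ℝ (E x)]
    (α : ∀ x, TangentSpace 𝓘(ℝ, EM) x →L[ℝ] E x)
    (cov : CovariantDerivative 𝓘(ℝ, EM) (Fin n → ℝ) E) (p : AssocBundle P S) :
    Submodule ℂ (ℂ ⊗[ℝ] TangentSpace (assocModel EM EF) p) :=
  ((horizontal cov p).baseChange ℂ ⊓ (alphaInv α p).comap (dProj p)) ⊔ verticalZeroOne p

end Bundle

/-! ### Integrability of complex distributions -/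

/-- The vector field `X` on the manifold `N` is smooth on the open set `O`: near each point, its
components in the chart at that point are smooth functions. -/
def IsSmoothVectorFieldOn {EN HN : Type*} [NormedAddCommGroup EN] [NormedSpace ℝ EN]
    [TopologicalSpace HN] (I : ModelWithCorners ℝ EN HN) {N : Type*} [TopologicalSpace N]
    [ChartedSpace HN N] (X : ∀ z : N, TangentSpace I z) (O : Set N) : Prop :=
  ∀ z₀ ∈ O, ContMDiffAt I 𝓘(ℝ, EN) ∞
    (fun z => (mfderiv I 𝓘(ℝ, EN) (extChartAt I z₀) z (X z) : EN)) z₀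

theorem isSmoothVectorFieldOn_iff {EN HN : Type*} [NormedAddCommGroup EN] [NormedSpace ℝ EN]
    [TopologicalSpace HN] (I : ModelWithCorners ℝ EN HN) {N : Type*} [TopologicalSpace N]
    [ChartedSpace HN N] [IsManifold I ∞ N] (X : ∀ z : N, TangentSpace I z) {O : Set N}
    (hO : IsOpen O) : IsSmoothVectorFieldOn I X O ↔
      ContMDiffOn I I.tangent ∞ (fun z => (⟨z, X z⟩ : TangentBundle I N)) O := by
  have key : ∀ z₀, ContMDiffAt I I.tangent ∞ (fun z => (⟨z, X z⟩ : TangentBundle I N)) z₀ ↔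
      ContMDiffAt I 𝓘(ℝ, EN) ∞
        (fun z => (mfderiv I 𝓘(ℝ, EN) (extChartAt I z₀) z (X z) : EN)) z₀ := by
    intro z₀
    refine (Bundle.contMDiffAt_section z₀).trans (Filter.EventuallyEq.contMDiffAt_iff ?_)
    filter_upwards [(chartAt HN z₀).open_source.mem_nhds (mem_chart_source HN z₀)] with z hz
    have h1 := congrArg (fun L => L (X z))
      (TangentBundle.continuousLinearMapAt_trivializationAt (I := I) hz)
    refine Eq.trans ?_ h1
    have h2 : z ∈ (trivializationAt EN (TangentSpace I) z₀).baseSet := by simpa using hz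
    exact (congrFun (Bundle.Trivialization.coe_linearMapAt_of_mem
      (R := ℝ) (trivializationAt EN (TangentSpace I) z₀) h2) (X z)).symm
  constructor
  · intro h z hz
    exact ((key z).2 (h z hz)).contMDiffWithinAt
  · intro h z hz
    exact (key z).1 (h.contMDiffAt (hO.mem_nhds hz))

/-- A complex distribution `D` on the manifold `N` is integrable: the Lie bracket of any two smooth
(local) sections `X₁ + i X₂` and `Y₁ + i Y₂` of `D` is a section of `D`. -/
def IsIntegrable {EN HN : Type*} [NormedAddCommGroup EN] [NormedSpace ℝ EN] [TopologicalSpace HN]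
    (I : ModelWithCorners ℝ EN HN) {N : Type*} [TopologicalSpace N] [ChartedSpace HN N]
    (D : ∀ z : N, Submodule ℂ (ℂ ⊗[ℝ] TangentSpace I z)) : Prop :=
  ∀ (O : Set N) (X₁ X₂ Y₁ Y₂ : ∀ z : N, TangentSpace I z), IsOpen O →
    IsSmoothVectorFieldOn I X₁ O → IsSmoothVectorFieldOn I X₂ O →
    IsSmoothVectorFieldOn I Y₁ O → IsSmoothVectorFieldOn I Y₂ O →
    (∀ z ∈ O, cplx (X₁ z) (X₂ z) ∈ D z) → (∀ z ∈ O, cplx (Y₁ z) (Y₂ z) ∈ D z) →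
    ∀ z ∈ O,
      cplx (VectorField.mlieBracket I X₁ Y₁ z - VectorField.mlieBracket I X₂ Y₂ z)
        (VectorField.mlieBracket I X₁ Y₂ z + VectorField.mlieBracket I X₂ Y₁ z) ∈ D z

/-! ### Torsion and curvature -/

section Torsion

variable {n : ℕ} {EM : Type*} [NormedAddCommGroup EM] [NormedSpace ℝ EM]
  {M : Type*} [TopologicalSpace M] [ChartedSpace EM M] [IsManifold 𝓘(ℝ, EM) ∞ M]
  {E : M → Type*} [∀ x, AddCommGroup (E x)] [∀ x, Module ℝ (E x)]
  [TopologicalSpace (TotalSpace (Fin n → ℝ) E)] [∀ x, TopologicalSpace (E x)]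
  [FiberBundle (Fin n → ℝ) E] [∀ x, IsTopologicalAddGroup (E x)] [∀ x, ContinuousSMul ℝ (E x)]

/-- The torsion `T = d^∇ α`, that is, `T(X, Y) = ∇_X (α Y) - ∇_Y (α X) - α [X, Y]`, as a function of
tangent vectors `v` and `w` at `x`: these are extended to vector fields `X` and `Y` smooth
near `x`. -/
def torsion (α : ∀ x, TangentSpace 𝓘(ℝ, EM) x →L[ℝ] E x)
    (cov : CovariantDerivative 𝓘(ℝ, EM) (Fin n → ℝ) E) (x : M) (v w : TangentSpace 𝓘(ℝ, EM) x) :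
    E x :=
  let X : ∀ y : M, TangentSpace 𝓘(ℝ, EM) y := FiberBundle.extend EM v
  let Y : ∀ y : M, TangentSpace 𝓘(ℝ, EM) y := FiberBundle.extend EM w
  cov (fun y => α y (Y y)) x v - cov (fun y => α y (X y)) x w
    - α x (VectorField.mlieBracket 𝓘(ℝ, EM) X Y x)

/-- The curvature `R(X, Y) s = ∇_X ∇_Y s - ∇_Y ∇_X s - ∇_[X, Y] s`, as a function of tangent vectors
`v` and `w` at `x` and of a vector `e` of `E_x`: these are extended to vector fields `X` and `Y` and
to a section `s`, smooth near `x`. -/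
def curvature (cov : CovariantDerivative 𝓘(ℝ, EM) (Fin n → ℝ) E) (x : M)
    (v w : TangentSpace 𝓘(ℝ, EM) x) (e : E x) : E x :=
  let X : ∀ y : M, TangentSpace 𝓘(ℝ, EM) y := FiberBundle.extend EM v
  let Y : ∀ y : M, TangentSpace 𝓘(ℝ, EM) y := FiberBundle.extend EM w
  let s : ∀ y : M, E y := FiberBundle.extend (Fin n → ℝ) e
  cov (fun y => cov s y (Y y)) x v - cov (fun y => cov s y (X y)) x w
    - cov s x (VectorField.mlieBracket 𝓘(ℝ, EM) X Y x)

/-- The torsion of complex tangent vectors, with values in `E^ℂ`. -/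
def torsionC (α : ∀ x, TangentSpace 𝓘(ℝ, EM) x →L[ℝ] E x)
    (cov : CovariantDerivative 𝓘(ℝ, EM) (Fin n → ℝ) E) (x : M)
    (X Y : ℂ ⊗[ℝ] TangentSpace 𝓘(ℝ, EM) x) : ℂ ⊗[ℝ] E x :=
  cplxBilin (torsion α cov x) X Y

/-- The curvature of complex tangent vectors, as an operator on `E_x^ℂ`: the extension of
`(X, Y, e) ↦ R(X, Y) e` which is complex linear in each argument. -/
def curvatureC (cov : CovariantDerivative 𝓘(ℝ, EM) (Fin n → ℝ) E) (x : M)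
    (X Y : ℂ ⊗[ℝ] TangentSpace 𝓘(ℝ, EM) x) (e : ℂ ⊗[ℝ] E x) : ℂ ⊗[ℝ] E x :=
  cplxBilin (fun v w => curvature cov x v w (rePart e)) X Y
    + Complex.I • cplxBilin (fun v w => curvature cov x v w (imPart e)) X Y

end Torsion

end IntRes

end

noncomputable section

namespace IntRes

/-! ### Flat calculus of a connection and a family of projections -/

section Flat

variable {B V : Type*} [NormedAddCommGroup B] [NormedSpace ℝ B]
  [NormedAddCommGroup V] [NormedSpace ℂ V] [NormedSpace ℝ V] [IsScalarTower ℝ ℂ V]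

/-! Over the domain of a local section `u` of the reduction, a point `z` of the bundle is a subspace
of `ℂⁿ`, encoded by its orthogonal projection `p`; this makes `p` a smooth function on the total
space with values in the endomorphisms of `ℂⁿ`. In the frame `u`, `α` becomes a `ℂⁿ`-valued form `a`
and `∇` becomes `d + θ`. Both are pulled back to the total space and everything is computed there.

The vertical part of a tangent vector `w` is `s(w) = dp(w) p + (1 - p) θ(w) p`. It is zero on
horizontal vectors, injective on vertical ones, and complex linear on the tangent spaces of the
fibres, because `F` is holomorphically immersed in the Grassmannian. Extended complex linearly, `s`
therefore kills the horizontal vectors and the vertical vectors of type `(0,1)`, and a complex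
vector `X` belongs to the distribution if and only if `a(X)` lies in the range of `p` and `s(X) = 0`
(`mem_twistorDistribution_iff`). The second condition says that `∇_X` maps sections of the
tautological bundle, the range of `p`, into that range (`flatCov_mem`).

Let `X` and `Y` be sections of the distribution. Then `a(X)` and `a(Y)` are sections of the range of
`p`, hence so is `∇_X a(Y) - ∇_Y a(X) = T(X, Y) + a([X, Y])`: modulo `p`, the form `a` on the
bracket is minus the torsion (`flatTorsion_bracket`). In the same way, with `σ = p c` for a constant
vector `c`, the vector `∇_X ∇_Y σ - ∇_Y ∇_X σ = ∇_{[X, Y]} σ + R(X, Y) σ` lies in the range of `p`.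
Since `(1 - p) ∇_v σ = s(v) c`, this gives `s([X, Y]) = -(1 - p) R(X, Y) p`
(`flatCurvature_bracket`). So at each point the bracket belongs to the distribution exactly if the
values of `X` and `Y` there satisfy the torsion and the curvature condition
(`mlieBracket_mem_twistorDistribution_iff`). Torsion and curvature of the pulled back data depend
only on the projections of the vectors to `M`.

This proves that (ii) implies (i). For the converse, every vector of `α⁻¹(p)` has to be the
projection of the value of some local section of the distribution
(`exists_section_twistorDistribution`). The constant dimension of `α⁻¹(p)` allows it to be extended
to a smooth family of vectors of these spaces, and this family is lifted horizontally. Horizontal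
lifts exist because the connection forms have values in the Lie algebra of `G`
(`exists_horizontal_lift`).

The remaining work is regularity. The transition functions of the bundle are smooth because a
continuous map into an immersed `F` is smooth as soon as the corresponding projections are
(`IsHolomorphicImmersion.contMDiffAt_of_orthProj`). -/

/-- The covariant derivative `∇_X σ = dσ(X) + θ(X) σ` of a vector-valued function. -/
def flatCov (θ : B → B →L[ℝ] V →L[ℂ] V) (σ : B → V) (y X : B) : V :=
  fderiv ℝ σ y X + θ y X (σ y)

/-- The torsion `da + θ ∧ a` of the `V`-valued form `a`. -/
def flatTorsion (a : B → B →L[ℝ] V) (θ : B → B →L[ℝ] V →L[ℂ] V) (y X Y : B) : V :=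
  fderiv ℝ a y X Y - fderiv ℝ a y Y X + θ y X (a y Y) - θ y Y (a y X)

/-- The curvature `dθ + θ ∧ θ` of the connection form `θ`. -/
def flatCurvature (θ : B → B →L[ℝ] V →L[ℂ] V) (y X Y : B) : V →L[ℂ] V :=
  fderiv ℝ θ y X Y - fderiv ℝ θ y Y X + θ y X * θ y Y - θ y Y * θ y X

/-- The form that measures whether the covariant derivatives of the sections of the range of the
projections `p` stay in the range of `p`. -/
def flatSecond (p : B → V →L[ℂ] V) (θ : B → B →L[ℝ] V →L[ℂ] V) (y X : B) : V →L[ℂ] V :=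
  fderiv ℝ p y X * p y + (1 - p y) * θ y X * p y

/-- The complex vector `X₁ + i X₂` satisfies `a(X) ∈ range p` and `∇_X` preserves the sections of
the range of `p`. -/
def FlatMem (a : B → B →L[ℝ] V) (p : B → V →L[ℂ] V) (θ : B → B →L[ℝ] V →L[ℂ] V)
    (y X₁ X₂ : B) : Prop :=
  p y (a y X₁ + Complex.I • a y X₂) = a y X₁ + Complex.I • a y X₂ ∧
    flatSecond p θ y X₁ + Complex.I • flatSecond p θ y X₂ = 0

variable {a : B → B →L[ℝ] V} {p : B → V →L[ℂ] V} {θ : B → B →L[ℝ] V →L[ℂ] V} {y₀ : B}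

/-- By the Leibniz rule, the derivatives of the fields enter only as `a(dY(X)) - a(dX(Y))`, which is
`a` of the bracket. -/
theorem flatCov_torsion {X Y : B → B} (ha : DifferentiableAt ℝ a y₀)
    (hX : DifferentiableAt ℝ X y₀) (hY : DifferentiableAt ℝ Y y₀) :
    flatCov θ (fun y => a y (Y y)) y₀ (X y₀) - flatCov θ (fun y => a y (X y)) y₀ (Y y₀)
      = flatTorsion a θ y₀ (X y₀) (Y y₀) + a y₀ (VectorField.lieBracket ℝ X Y y₀) := by
  simp only [flatCov, flatTorsion, VectorField.lieBracket, fderiv_clm_apply ha hX,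
    fderiv_clm_apply ha hY, add_apply, ContinuousLinearMap.comp_apply,
    ContinuousLinearMap.flip_apply, map_sub]
  abel

/-- The second derivatives of `σ` cancel by symmetry, and the mixed terms `θ(X) dσ(Y)` cancel in
pairs. What remains is of order zero in `σ`, apart from the derivative along the bracket. -/
theorem flatCov_curvature {X Y : B → B} {σ : B → V} (hθ : DifferentiableAt ℝ θ y₀)
    (hX : DifferentiableAt ℝ X y₀) (hY : DifferentiableAt ℝ Y y₀) (hσ : ContDiffAt ℝ 2 σ y₀) :
    flatCov θ (fun y => flatCov θ σ y (Y y)) y₀ (X y₀)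
      - flatCov θ (fun y => flatCov θ σ y (X y)) y₀ (Y y₀)
      = flatCov θ σ y₀ (VectorField.lieBracket ℝ X Y y₀)
        + flatCurvature θ y₀ (X y₀) (Y y₀) (σ y₀) := by
  have hσ1 : DifferentiableAt ℝ σ y₀ := hσ.differentiableAt (by norm_num)
  have hσ2 : DifferentiableAt ℝ (fderiv ℝ σ) y₀ :=
    (hσ.fderiv_right (m := 1) (by norm_num)).differentiableAt (by norm_num)
  have hsymm : IsSymmSndFDerivAt ℝ σ y₀ := hσ.isSymmSndFDerivAt (by simp)
  have key : ∀ {W : B → B}, DifferentiableAt ℝ W y₀ → ∀ v,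
      fderiv ℝ (fun y => flatCov θ σ y (W y)) y₀ v =
        fderiv ℝ (fderiv ℝ σ) y₀ v (W y₀) + fderiv ℝ σ y₀ (fderiv ℝ W y₀ v)
          + (fderiv ℝ θ y₀ v (W y₀) (σ y₀) + θ y₀ (fderiv ℝ W y₀ v) (σ y₀)
            + θ y₀ (W y₀) (fderiv ℝ σ y₀ v)) := by
    intro W hW v
    have h1 : HasFDerivAt (fun y => fderiv ℝ σ y (W y)) _ y₀ :=
      hσ2.hasFDerivAt.clm_apply hW.hasFDerivAt
    have h2 : HasFDerivAt (fun y => θ y (W y)) _ y₀ := hθ.hasFDerivAt.clm_apply hW.hasFDerivAt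
    let ev : (V →L[ℂ] V) →L[ℝ] V →L[ℝ] V := ContinuousLinearMap.restrictScalarsL ℂ V V ℝ ℝ
    have h3 : HasFDerivAt (fun y => ev (θ y (W y)) (σ y)) _ y₀ :=
      (ev.hasFDerivAt.comp y₀ h2).clm_apply hσ1.hasFDerivAt
    have h4 := (h1.add h3).fderiv
    have h5 : (fun y => flatCov θ σ y (W y)) =
      (fun y => fderiv ℝ σ y (W y)) + fun y => ev (θ y (W y)) (σ y) := rfl
    rw [h5, h4]
    simp [ev]
    abel
  have hs := hsymm.eq (X y₀) (Y y₀)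
  unfold flatCov at key ⊢
  rw [key hX, key hY]
  simp only [VectorField.lieBracket, flatCurvature, map_sub, map_add, hs,
    add_apply, sub_apply, mul_apply_eq_comp]
  abel

/-- Differentiating `p p = p` gives `dp p + p dp = dp`. Thus `dp p` has values in the kernel of `p`.
-/
theorem fderiv_mul_self_of_idempotent (hp : DifferentiableAt ℝ p y₀)
    (hpp : ∀ᶠ y in 𝓝 y₀, p y * p y = p y) (X : B) :
    fderiv ℝ p y₀ X * p y₀ = (1 - p y₀) * fderiv ℝ p y₀ X := by
  ext c
  let ev : (V →L[ℂ] V) →L[ℝ] V →L[ℝ] V := ContinuousLinearMap.restrictScalarsL ℂ V V ℝ ℝ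
  let evc : (V →L[ℂ] V) →L[ℝ] V := (ContinuousLinearMap.apply ℂ V c).restrictScalars ℝ
  have h1 : HasFDerivAt (fun y => evc (p y)) _ y₀ := evc.hasFDerivAt.comp y₀ hp.hasFDerivAt
  have h2 : HasFDerivAt (fun y => ev (p y) (evc (p y))) _ y₀ :=
    (ev.hasFDerivAt.comp y₀ hp.hasFDerivAt).clm_apply h1
  have h3 : fderiv ℝ (fun y => ev (p y) (evc (p y))) y₀ = fderiv ℝ (fun y => evc (p y)) y₀ :=
    Filter.EventuallyEq.fderiv_eq (hpp.mono fun y hy => congrArg (fun L : V →L[ℂ] V => L c) hy)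
  have h4 := congrArg (fun L => L X) h3
  simp only [h1.fderiv, h2.fderiv] at h4
  simp only [mul_apply_eq_comp, sub_apply, one_apply_eq_self]
  exact eq_sub_iff_add_eq'.2 h4

theorem flatCov_add_I_smul {f g : B → V} (hf : DifferentiableAt ℝ f y₀)
    (hg : DifferentiableAt ℝ g y₀) (v : B) :
    flatCov θ (fun y => f y + Complex.I • g y) y₀ v
      = flatCov θ f y₀ v + Complex.I • flatCov θ g y₀ v := by
  have := (hf.hasFDerivAt.add (hg.hasFDerivAt.const_smul Complex.I)).fderiv
  unfold flatCov
  rw [show (fun y => f y + Complex.I • g y) = f + Complex.I • g from rfl, this]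
  simp only [add_apply, smul_apply, map_add, map_smul, Pi.add_apply, Pi.smul_apply, smul_add]
  abel

/-- If `∇_X` preserves the sections of the range of `p`, then it maps such sections to the range
of `p`. -/
theorem flatCov_mem (hp : DifferentiableAt ℝ p y₀)
    (hpp : ∀ᶠ y in 𝓝 y₀, p y * p y = p y) {σ : B → V} (hσ : DifferentiableAt ℝ σ y₀)
    (hpσ : ∀ᶠ y in 𝓝 y₀, p y (σ y) = σ y) {X₁ X₂ : B}
    (hX : flatSecond p θ y₀ X₁ + Complex.I • flatSecond p θ y₀ X₂ = 0) :
    (1 - p y₀) (flatCov θ σ y₀ X₁ + Complex.I • flatCov θ σ y₀ X₂) = 0 := by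
  have hσ0 := hpσ.self_of_nhds
  let ev : (V →L[ℂ] V) →L[ℝ] V →L[ℝ] V := ContinuousLinearMap.restrictScalarsL ℂ V V ℝ ℝ
  have h1 : HasFDerivAt (fun y => ev (p y) (σ y)) _ y₀ :=
      (ev.hasFDerivAt.comp y₀ hp.hasFDerivAt).clm_apply hσ.hasFDerivAt
  have h2 : fderiv ℝ (fun y => ev (p y) (σ y)) y₀ = fderiv ℝ σ y₀ :=
    Filter.EventuallyEq.fderiv_eq hpσ
  -- Differentiating `p σ = σ` gives `(1 - p) dσ(X) = dp(X) σ`. Hence `(1 - p) ∇_X σ` is of order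
  -- zero in `σ`, and its coefficient is `flatSecond`.
  have h3 : ∀ X, (1 - p y₀) (flatCov θ σ y₀ X) = flatSecond p θ y₀ X (σ y₀) := by
    intro X
    have h4 : fderiv ℝ σ y₀ X = p y₀ (fderiv ℝ σ y₀ X) + fderiv ℝ p y₀ X (σ y₀) := by
      conv_lhs => rw [← h2, h1.fderiv]
      simp [ev]
    simp only [flatCov, flatSecond, add_apply, mul_apply_eq_comp,
      hσ0, map_add]
    congr 1
    simp only [sub_apply, one_apply_eq_self]
    exact sub_eq_iff_eq_add'.2 h4
  rw [map_add, map_smul, h3, h3]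
  exact congrArg (fun L : V →L[ℂ] V => L (σ y₀)) hX

variable (a p θ)

/-- The complex bilinear extension of the torsion. -/
def flatTorsionC (y X₁ X₂ Y₁ Y₂ : B) : V :=
  flatTorsion a θ y X₁ Y₁ - flatTorsion a θ y X₂ Y₂
    + Complex.I • (flatTorsion a θ y X₁ Y₂ + flatTorsion a θ y X₂ Y₁)

/-- The complex bilinear extension of the curvature. -/
def flatCurvatureC (y X₁ X₂ Y₁ Y₂ : B) : V →L[ℂ] V :=
  flatCurvature θ y X₁ Y₁ - flatCurvature θ y X₂ Y₂
    + Complex.I • (flatCurvature θ y X₁ Y₂ + flatCurvature θ y X₂ Y₁)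

variable {a p θ}

/-! ### Brackets of sections of the distribution in the flat model -/

section Bracket

variable {X₁ X₂ Y₁ Y₂ : B → B}

/-- By `flatCov_mem`, `∇_X a(Y)` and `∇_Y a(X)` lie in the range of `p`. By `flatCov_torsion`, the
vector to which `1 - p` is applied here is their difference, expanded into real and imaginary parts.
-/
theorem flatTorsion_bracket (hp : DifferentiableAt ℝ p y₀)
    (hpp : ∀ᶠ y in 𝓝 y₀, p y * p y = p y) (ha : DifferentiableAt ℝ a y₀)
    (hX₁ : DifferentiableAt ℝ X₁ y₀) (hX₂ : DifferentiableAt ℝ X₂ y₀)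
    (hY₁ : DifferentiableAt ℝ Y₁ y₀) (hY₂ : DifferentiableAt ℝ Y₂ y₀)
    (hX : ∀ᶠ y in 𝓝 y₀, FlatMem a p θ y (X₁ y) (X₂ y))
    (hY : ∀ᶠ y in 𝓝 y₀, FlatMem a p θ y (Y₁ y) (Y₂ y)) :
    (1 - p y₀) (flatTorsionC a θ y₀ (X₁ y₀) (X₂ y₀) (Y₁ y₀) (Y₂ y₀)
      + (a y₀ (VectorField.lieBracket ℝ X₁ Y₁ y₀ - VectorField.lieBracket ℝ X₂ Y₂ y₀)
      + Complex.I • a y₀ (VectorField.lieBracket ℝ X₁ Y₂ y₀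
        + VectorField.lieBracket ℝ X₂ Y₁ y₀))) = 0 := by
  have hsec : ∀ {Z₁ Z₂ : B → B}, DifferentiableAt ℝ Z₁ y₀ → DifferentiableAt ℝ Z₂ y₀ →
      DifferentiableAt ℝ (fun y => a y (Z₁ y) + Complex.I • a y (Z₂ y)) y₀ ∧
      ∀ v, flatCov θ (fun y => a y (Z₁ y) + Complex.I • a y (Z₂ y)) y₀ v
        = flatCov θ (fun y => a y (Z₁ y)) y₀ v
          + Complex.I • flatCov θ (fun y => a y (Z₂ y)) y₀ v := by
    intro Z₁ Z₂ h₁ h₂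
    have e₁ := ha.clm_apply h₁
    have e₂ := ha.clm_apply h₂
    exact ⟨e₁.add (e₂.const_smul Complex.I), flatCov_add_I_smul e₁ e₂⟩
  have e1 := flatCov_mem hp hpp (hsec hY₁ hY₂).1 (hY.mono fun y h => h.1) hX.self_of_nhds.2
  have e2 := flatCov_mem hp hpp (hsec hX₁ hX₂).1 (hX.mono fun y h => h.1) hY.self_of_nhds.2
  rw [← sub_eq_zero.2 (e1.trans e2.symm), ← map_sub]
  congr 1
  rw [(hsec hY₁ hY₂).2, (hsec hY₁ hY₂).2, (hsec hX₁ hX₂).2, (hsec hX₁ hX₂).2]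
  have t11 := flatCov_torsion (θ := θ) ha hX₁ hY₁
  have t12 := flatCov_torsion (θ := θ) ha hX₁ hY₂
  have t21 := flatCov_torsion (θ := θ) ha hX₂ hY₁
  have t22 := flatCov_torsion (θ := θ) ha hX₂ hY₂
  rw [eq_comm, ← eq_sub_iff_add_eq'] at t11 t12 t21 t22
  simp only [map_sub, map_add, t11, t12, t21, t22, flatTorsionC, smul_add, smul_sub, smul_smul,
    Complex.I_mul_I, neg_smul, one_smul]
  abel

/-- The argument for the torsion is repeated one order higher: `a(Y)` is replaced by `∇_Y σ` with `σ
= p c`, which is again a section of the range of `p`, and `flatCov_torsion` by `flatCov_curvature`.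
-/
theorem flatCurvature_bracket (hp : ContDiffAt ℝ 2 p y₀)
    (hpp : ∀ᶠ y in 𝓝 y₀, p y * p y = p y) (hθ : DifferentiableAt ℝ θ y₀)
    (hX₁ : DifferentiableAt ℝ X₁ y₀) (hX₂ : DifferentiableAt ℝ X₂ y₀)
    (hY₁ : DifferentiableAt ℝ Y₁ y₀) (hY₂ : DifferentiableAt ℝ Y₂ y₀)
    (hX : ∀ᶠ y in 𝓝 y₀, FlatMem a p θ y (X₁ y) (X₂ y))
    (hY : ∀ᶠ y in 𝓝 y₀, FlatMem a p θ y (Y₁ y) (Y₂ y)) :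
    (1 - p y₀) * flatCurvatureC θ y₀ (X₁ y₀) (X₂ y₀) (Y₁ y₀) (Y₂ y₀) * p y₀
      + (flatSecond p θ y₀ (VectorField.lieBracket ℝ X₁ Y₁ y₀ - VectorField.lieBracket ℝ X₂ Y₂ y₀)
      + Complex.I • flatSecond p θ y₀ (VectorField.lieBracket ℝ X₁ Y₂ y₀
        + VectorField.lieBracket ℝ X₂ Y₁ y₀)) = 0 := by
  have hp1 : ∀ᶠ y in 𝓝 y₀, DifferentiableAt ℝ p y := by
    filter_upwards [hp.eventually (by norm_num)] with y hy using hy.differentiableAt (by norm_num)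
  have hp0 := hp1.self_of_nhds
  ext c
  let ev : (V →L[ℂ] V) →L[ℝ] V := (ContinuousLinearMap.apply ℂ V c).restrictScalars ℝ
  let σ : B → V := fun y => p y c
  have hσ : ContDiffAt ℝ 2 σ y₀ := ev.contDiff.contDiffAt.comp y₀ hp
  have hdσ : ∀ᶠ y in 𝓝 y₀, ∀ v, fderiv ℝ σ y v = fderiv ℝ p y v c := by
    filter_upwards [hp1] with y hy v
    have : HasFDerivAt (fun y => ev (p y)) _ y := ev.hasFDerivAt.comp y hy.hasFDerivAt
    change fderiv ℝ (fun y => ev (p y)) y v = _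
    rw [this.fderiv]
    rfl
  -- The derivative term is `(1 - p) dp(v) c`, which equals `dp(v) p c` because `p` is idempotent
  -- near the point. So `flatSecond` is read off from the derivatives of the sections `p c`.
  have hcov : ∀ᶠ y in 𝓝 y₀, ∀ v, (1 - p y) (flatCov θ σ y v) = flatSecond p θ y v c := by
    filter_upwards [hdσ, hp1, hpp.eventually_nhds] with y h1 h2 h3 v
    rw [flatSecond, fderiv_mul_self_of_idempotent h2 h3, flatCov, h1]
    simp [σ]
    abel
  have hmem : ∀ {Z₁ Z₂ : B → B}, (∀ᶠ y in 𝓝 y₀, FlatMem a p θ y (Z₁ y) (Z₂ y)) →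
      ∀ᶠ y in 𝓝 y₀, p y (flatCov θ σ y (Z₁ y) + Complex.I • flatCov θ σ y (Z₂ y))
        = flatCov θ σ y (Z₁ y) + Complex.I • flatCov θ σ y (Z₂ y) := by
    intro Z₁ Z₂ h
    filter_upwards [h, hcov] with y h1 h2
    have h3 := congrArg (fun L : V →L[ℂ] V => L c) h1.2
    simp only [add_apply, smul_apply, ← h2,
      ← map_smul, ← map_add] at h3
    rw [sub_apply, zero_apply, sub_eq_zero] at h3
    exact h3.symm
  have hdiff : ∀ {Z : B → B}, DifferentiableAt ℝ Z y₀ →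
      DifferentiableAt ℝ (fun y => flatCov θ σ y (Z y)) y₀ := by
    intro Z hZ
    have hσ1 : DifferentiableAt ℝ σ y₀ := hσ.differentiableAt (by norm_num)
    have hσ2 : DifferentiableAt ℝ (fderiv ℝ σ) y₀ :=
      (hσ.fderiv_right (m := 1) (by norm_num)).differentiableAt (by norm_num)
    let ev : (V →L[ℂ] V) →L[ℝ] V →L[ℝ] V := ContinuousLinearMap.restrictScalarsL ℂ V V ℝ ℝ
    exact (hσ2.clm_apply hZ).add
      ((ev.differentiableAt.comp y₀ (hθ.clm_apply hZ)).clm_apply hσ1)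
  have hsec : ∀ {Z₁ Z₂ : B → B}, DifferentiableAt ℝ Z₁ y₀ → DifferentiableAt ℝ Z₂ y₀ →
      DifferentiableAt ℝ (fun y => flatCov θ σ y (Z₁ y) + Complex.I • flatCov θ σ y (Z₂ y)) y₀ ∧
      ∀ v, flatCov θ (fun y => flatCov θ σ y (Z₁ y) + Complex.I • flatCov θ σ y (Z₂ y)) y₀ v
        = flatCov θ (fun y => flatCov θ σ y (Z₁ y)) y₀ v
          + Complex.I • flatCov θ (fun y => flatCov θ σ y (Z₂ y)) y₀ v := by
    intro Z₁ Z₂ h₁ h₂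
    have e₁ := hdiff h₁
    have e₂ := hdiff h₂
    exact ⟨e₁.add (e₂.const_smul Complex.I), flatCov_add_I_smul e₁ e₂⟩
  have e1 := flatCov_mem hp0 hpp (hsec hY₁ hY₂).1 (hmem hY) hX.self_of_nhds.2
  have e2 := flatCov_mem hp0 hpp (hsec hX₁ hX₂).1 (hmem hX) hY.self_of_nhds.2
  have hlast := hcov.self_of_nhds
  simp only [add_apply, smul_apply,
    mul_apply_eq_comp, ← hlast, ← map_smul, ← map_add]
  rw [zero_apply, ← sub_eq_zero.2 (e1.trans e2.symm), ← map_sub]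
  congr 1
  rw [(hsec hY₁ hY₂).2, (hsec hY₁ hY₂).2, (hsec hX₁ hX₂).2, (hsec hX₁ hX₂).2]
  have t11 := flatCov_curvature hθ hX₁ hY₁ hσ
  have t12 := flatCov_curvature hθ hX₁ hY₂ hσ
  have t21 := flatCov_curvature hθ hX₂ hY₁ hσ
  have t22 := flatCov_curvature hθ hX₂ hY₂ hσ
  rw [← sub_eq_iff_eq_add'] at t11 t12 t21 t22
  have hadd : ∀ v w, flatCov θ σ y₀ (v + w) = flatCov θ σ y₀ v + flatCov θ σ y₀ w := by
    intro v w
    simp only [flatCov, map_add, add_apply]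
    abel
  have hsub : ∀ v w, flatCov θ σ y₀ (v - w) = flatCov θ σ y₀ v - flatCov θ σ y₀ w := by
    intro v w
    simp only [flatCov, map_sub, sub_apply]
    abel
  change flatCurvatureC θ y₀ (X₁ y₀) (X₂ y₀) (Y₁ y₀) (Y₂ y₀) (σ y₀) + _ = _
  simp only [flatCurvatureC, add_apply, sub_apply,
    smul_apply, hadd, hsub, ← t11, ← t12, ← t21, ← t22, smul_add, smul_sub,
    smul_smul, Complex.I_mul_I, neg_smul, one_smul]
  abel

end Bracket

end Flat

end IntRes
end

noncomputable section

namespace IntRes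

/-! ### Smooth solutions of linear equations -/

section Solutions

variable {B V W : Type*} [NormedAddCommGroup B] [NormedSpace ℝ B]
  [NormedAddCommGroup V] [NormedSpace ℝ V] [FiniteDimensional ℝ V]
  [NormedAddCommGroup W] [NormedSpace ℝ W] [FiniteDimensional ℝ W]

theorem exists_isOpen_contDiffOn_ringInverse {U : Set B} (hU : IsOpen U) {A : B → V →L[ℝ] V}
    (hA : ContDiffOn ℝ ∞ A U) {y₀ : B} (hy₀ : y₀ ∈ U) (h1 : A y₀ = 1) :
    ∃ U' ⊆ U, IsOpen U' ∧ y₀ ∈ U' ∧ (∀ y ∈ U', IsUnit (A y)) ∧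
      ContDiffOn ℝ ∞ (fun y => Ring.inverse (A y)) U' := by
  have : CompleteSpace V := FiniteDimensional.complete ℝ V
  refine ⟨U ∩ A ⁻¹' {a | IsUnit a}, inter_subset_left,
    hA.continuousOn.isOpen_inter_preimage hU Units.isOpen, ⟨hy₀, ?_⟩, fun y hy => hy.2, ?_⟩
  · simp [h1]
  · intro y hy
    obtain ⟨a, ha⟩ := hy.2
    have h2 : ContDiffAt ℝ ∞ Ring.inverse (A y) := ha ▸ contDiffAt_ringInverse ℝ a
    exact (h2.comp y (hA.contDiffAt (hU.mem_nhds hy.1))).contDiffWithinAt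

/-- A vector of the kernel of a smooth family of linear maps of constant rank extends to a smooth
family of vectors of the kernels. -/
theorem exists_contDiffOn_mem_ker {U : Set B} (hU : IsOpen U) {L : B → V →L[ℝ] W}
    (hL : ContDiffOn ℝ ∞ L U) {y₀ : B} (hy₀ : y₀ ∈ U)
    (hrank : ∀ y ∈ U, finrank ℝ (L y).ker = finrank ℝ (L y₀).ker) {v₀ : V} (hv₀ : L y₀ v₀ = 0) :
    ∃ U' ⊆ U, IsOpen U' ∧ y₀ ∈ U' ∧ ∃ v : B → V, ContDiffOn ℝ ∞ v U' ∧ v y₀ = v₀ ∧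
      ∀ y ∈ U', L y (v y) = 0 := by
  obtain ⟨r, hr⟩ := (L y₀).toLinearMap.rangeRestrict.exists_rightInverse_of_surjective
    (LinearMap.range_rangeRestrict _)
  -- `T` extends a right inverse of `L y₀`, defined on its range, to all of `W`. It is a generalized
  -- inverse: `L y₀ T L y₀ = L y₀`.
  obtain ⟨T, hT⟩ := LinearMap.exists_extend r
  have hLT : ∀ v, L y₀ (T (L y₀ v)) = L y₀ v := by
    intro v
    have h1 : T (L y₀ v) = r ((L y₀).toLinearMap.rangeRestrict v) :=
      LinearMap.congr_fun hT ((L y₀).toLinearMap.rangeRestrict v)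
    have h2 := congrArg Subtype.val (LinearMap.congr_fun hr ((L y₀).toLinearMap.rangeRestrict v))
    rw [h1]
    exact h2
  let T' : W →L[ℝ] V := LinearMap.toContinuousLinearMap T
  -- On the kernel of `L y` this is `1 - T L y₀`, which maps into the kernel of `L y₀`. Near `y₀` it
  -- is invertible, so equality of dimensions makes it an isomorphism between the two kernels, and
  -- its inverse carries `v₀` into the kernel of `L y`.
  let A : B → V →L[ℝ] V := fun y => 1 + T' ∘L (L y - L y₀)
  have hA : ContDiffOn ℝ ∞ A U :=
    contDiffOn_const.add (contDiffOn_const.clm_comp (hL.sub contDiffOn_const))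
  obtain ⟨U', hU'U, hU', hyU', hunit, hinv⟩ :=
    exists_isOpen_contDiffOn_ringInverse hU hA hy₀ (by simp [A])
  refine ⟨U', hU'U, hU', hyU', fun y => Ring.inverse (A y) v₀,
    hinv.clm_apply contDiffOn_const, by simp [A], fun y hy => ?_⟩
  have hinj : Function.Injective (A y) := by
    obtain ⟨a, ha⟩ := hunit y hy
    refine Function.LeftInverse.injective (g := (a⁻¹).1) fun v => ?_
    rw [← ha, ← mul_apply_eq_comp, Units.inv_mul]
    rfl
  have hmaps : ∀ v ∈ (L y).ker, (A y).toLinearMap v ∈ (L y₀).ker := by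
    intro v hv
    have hv' : L y v = 0 := hv
    have : A y v = v - T (L y₀ v) := by
      simp [A, T', hv', sub_eq_add_neg]
    change L y₀ (A y v) = 0
    rw [this, map_sub, hLT, sub_self]
  have hsurj : Function.Surjective ((A y).toLinearMap.restrict hmaps) := by
    refine (LinearMap.injective_iff_surjective_of_finrank_eq_finrank (hrank y (hU'U hy))).1 ?_
    intro v w hvw
    exact Subtype.ext (hinj (congrArg Subtype.val hvw))
  obtain ⟨⟨v, hv⟩, hv'⟩ := hsurj ⟨v₀, hv₀⟩
  have h3 : A y v = v₀ := congrArg Subtype.val hv'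
  have h4 : Ring.inverse (A y) v₀ = v := by
    rw [← h3, ← mul_apply_eq_comp, Ring.inverse_mul_cancel _ (hunit y hy)]
    rfl
  have hv0 : L y v = 0 := hv
  simpa only [h4] using hv0

/-- A solvable smooth family of injective linear equations has a smooth solution. -/
theorem exists_contDiffOn_solution {U : Set B} (hU : IsOpen U) {L : B → V →L[ℝ] W} {b : B → W}
    (hL : ContDiffOn ℝ ∞ L U) (hb : ContDiffOn ℝ ∞ b U) {y₀ : B} (hy₀ : y₀ ∈ U)
    (hinj : Function.Injective (L y₀)) (hsol : ∀ y ∈ U, ∃ v, L y v = b y) :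
    ∃ U' ⊆ U, IsOpen U' ∧ y₀ ∈ U' ∧ ∃ v : B → V, ContDiffOn ℝ ∞ v U' ∧
      ∀ y ∈ U', L y (v y) = b y := by
  -- Near `y₀` the square system `T L y v = T b y` has only one solution, and this depends smoothly
  -- on `y`. Since the original equation is solvable, its solution must be this one.
  obtain ⟨T, hT⟩ := (L y₀).toLinearMap.exists_leftInverse_of_injective
    (LinearMap.ker_eq_bot.2 hinj)
  let T' : W →L[ℝ] V := LinearMap.toContinuousLinearMap T
  let A : B → V →L[ℝ] V := fun y => T' ∘L L y
  obtain ⟨U', hU'U, hU', hyU', hunit, hinv⟩ :=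
    exists_isOpen_contDiffOn_ringInverse hU (A := A) (contDiffOn_const.clm_comp hL) hy₀
      (by ext v; exact LinearMap.congr_fun hT v)
  refine ⟨U', hU'U, hU', hyU', fun y => Ring.inverse (A y) (T' (b y)),
    hinv.clm_apply (T'.contDiff.comp_contDiffOn (hb.mono hU'U)), fun y hy => ?_⟩
  obtain ⟨v, hv⟩ := hsol y (hU'U hy)
  have h4 : Ring.inverse (A y) (T' (b y)) = v := by
    rw [← hv]
    change Ring.inverse (A y) (A y v) = v
    rw [← mul_apply_eq_comp, Ring.inverse_mul_cancel _ (hunit y hy)]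
    rfl
  simpa only [h4] using hv

end Solutions

section Composition

variable {B E₁ E₂ E₃ : Type*} [NormedAddCommGroup B] [NormedSpace ℝ B]
  [NormedAddCommGroup E₁] [NormedSpace ℂ E₁] [NormedSpace ℝ E₁] [IsScalarTower ℝ ℂ E₁]
  [NormedAddCommGroup E₂] [NormedSpace ℂ E₂] [NormedSpace ℝ E₂] [IsScalarTower ℝ ℂ E₂]
  [NormedAddCommGroup E₃] [NormedSpace ℂ E₃] [NormedSpace ℝ E₃] [IsScalarTower ℝ ℂ E₃]
  {f : B → E₂ →L[ℂ] E₃} {g : B → E₁ →L[ℂ] E₂} {x : B}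

/-- The operators are complex linear but are differentiated over `ℝ`, so composition is used as a
bounded real bilinear map. -/
theorem ContDiffAt.clm_comp_complex {k : ℕ∞ω} (hf : ContDiffAt ℝ k f x)
    (hg : ContDiffAt ℝ k g x) : ContDiffAt ℝ k (fun x => f x ∘L g x) x :=
  ((ContinuousLinearMap.compL ℂ E₁ E₂ E₃).bilinearRestrictScalars
    ℝ).isBoundedBilinearMap.contDiff.contDiffAt.comp x (hf.prodMk hg)

end Composition

/-! ### The orthogonal projections onto the points of the Grassmannian -/

section Projections

variable {n q : ℕ}

/-- The endomorphisms of `ℂⁿ`. -/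
abbrev EndC (n : ℕ) : Type := (Fin n → ℂ) →L[ℂ] (Fin n → ℂ)

/-- The orthogonal projection of `ℂⁿ` onto the subspace `S`. -/
def orthProj (S : Submodule ℂ (Fin n → ℂ)) : EndC n :=
  (EuclideanSpace.equiv (Fin n) ℂ).toContinuousLinearMap ∘L
    (S.map (EuclideanSpace.equiv (Fin n) ℂ).symm.toLinearEquiv.toLinearMap).starProjection ∘L
    (EuclideanSpace.equiv (Fin n) ℂ).symm.toContinuousLinearMap

theorem orthProj_apply_eq_iff {S : Submodule ℂ (Fin n → ℂ)} {v : Fin n → ℂ} :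
    orthProj S v = v ↔ v ∈ S := by
  have h : orthProj S v = v ↔
      (S.map (EuclideanSpace.equiv (Fin n) ℂ).symm.toLinearEquiv.toLinearMap).starProjection
        ((EuclideanSpace.equiv (Fin n) ℂ).symm v) = (EuclideanSpace.equiv (Fin n) ℂ).symm v := by
    rw [ContinuousLinearEquiv.eq_symm_apply]
    rfl
  rw [h, Submodule.starProjection_eq_self_iff]
  constructor
  · rintro ⟨w, hw, hwv⟩
    exact (EuclideanSpace.equiv (Fin n) ℂ).symm.injective hwv ▸ hw
  · exact fun hv => ⟨v, hv, rfl⟩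

theorem orthProj_apply_mem (S : Submodule ℂ (Fin n → ℂ)) (v : Fin n → ℂ) : orthProj S v ∈ S := by
  obtain ⟨w, hw, hwv⟩ := Submodule.starProjection_apply_mem
    (S.map (EuclideanSpace.equiv (Fin n) ℂ).symm.toLinearEquiv.toLinearMap)
    ((EuclideanSpace.equiv (Fin n) ℂ).symm v)
  have : orthProj S v = w := congrArg (EuclideanSpace.equiv (Fin n) ℂ) hwv.symm
  rwa [this]

theorem orthProj_mul_self (S : Submodule ℂ (Fin n → ℂ)) :
    orthProj S * orthProj S = orthProj S := by
  ext1 v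
  exact orthProj_apply_eq_iff.2 (orthProj_apply_mem S v)

/-- The linear map `ℂ^q → ℂⁿ` with the given columns. -/
def ofColumns : (Fin q → Fin n → ℂ) →ₗ[ℝ]
    (EuclideanSpace ℂ (Fin q) →L[ℂ] EuclideanSpace ℂ (Fin n)) where
  toFun v := ∑ j, (EuclideanSpace.proj j).smulRight ((EuclideanSpace.equiv (Fin n) ℂ).symm (v j))
  map_add' v w := by
    rw [← Finset.sum_add_distrib]
    refine Finset.sum_congr rfl fun j _ => ?_
    ext1 x
    simp
  map_smul' r v := by
    rw [RingHom.id_apply, Finset.smul_sum]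
    refine Finset.sum_congr rfl fun j _ => ?_
    ext x i
    simp
    ring

theorem ofColumns_apply (v : Fin q → Fin n → ℂ) (x : EuclideanSpace ℂ (Fin q)) :
    ofColumns v x = (EuclideanSpace.equiv (Fin n) ℂ).symm (∑ j, x j • v j) := by
  simp [ofColumns]

/-- If `A` has independent columns `v`, the orthogonal projection onto their span is `A (A* A)⁻¹
A*`. The Gram operator `A* A` is invertible because `⟨A* A x, x⟩ = ⟨A x, A x⟩`. -/
theorem contDiffAt_orthProj_span {v : Fin q → Fin n → ℂ} (hv : LinearIndependent ℂ v) :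
    ContDiffAt ℝ ∞ (fun v : Fin q → Fin n → ℂ => orthProj (Submodule.span ℂ (range v))) v := by
  -- The adjoint is conjugate linear, so the projection depends smoothly but not holomorphically on
  -- the columns.
  let adj : (EuclideanSpace ℂ (Fin q) →L[ℂ] EuclideanSpace ℂ (Fin n)) →L[ℝ]
      (EuclideanSpace ℂ (Fin n) →L[ℂ] EuclideanSpace ℂ (Fin q)) :=
    AddMonoidHom.toRealLinearMap
      ((ContinuousLinearMap.adjoint (𝕜 := ℂ) (E := EuclideanSpace ℂ (Fin q))
        (F := EuclideanSpace ℂ (Fin n))) : _ →+ _) (LinearIsometryEquiv.continuous _)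
  let A : (Fin q → Fin n → ℂ) →L[ℝ] (EuclideanSpace ℂ (Fin q) →L[ℂ] EuclideanSpace ℂ (Fin n)) :=
    LinearMap.toContinuousLinearMap ofColumns
  let gram : (Fin q → Fin n → ℂ) → (EuclideanSpace ℂ (Fin q) →L[ℂ] EuclideanSpace ℂ (Fin q)) :=
    fun v => adj (A v) ∘L A v
  have hgram : ContDiff ℝ ∞ gram :=
    contDiff_iff_contDiffAt.2 fun _ => ContDiffAt.clm_comp_complex
      (adj.contDiff.comp A.contDiff).contDiffAt A.contDiff.contDiffAt
  have hunit : IsUnit (gram v) := by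
    have hinj : Function.Injective (gram v) := by
      rw [injective_iff_map_eq_zero]
      intro x hx
      have h1 : inner ℂ (A v x) (A v x) = 0 := by
        rw [← ContinuousLinearMap.adjoint_inner_left]
        change inner ℂ (gram v x) x = 0
        rw [hx, inner_zero_left]
      have h2 := inner_self_eq_zero.1 h1
      have h3 : ∑ j, x j • v j = 0 := by
        have : ofColumns v x = 0 := h2
        rw [ofColumns_apply] at this
        exact (EuclideanSpace.equiv (Fin n) ℂ).symm.injective (this.trans (map_zero _).symm)
      ext j
      exact Fintype.linearIndependent_iff.1 hv _ h3 j
    refine ⟨ContinuousLinearEquiv.toUnit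
      (LinearEquiv.ofInjectiveEndo (gram v).toLinearMap hinj).toContinuousLinearEquiv, ?_⟩
    ext1 x
    rfl
  have hinv : ContDiffAt ℝ ∞ (fun v => Ring.inverse (gram v)) v := by
    obtain ⟨a, ha⟩ := hunit
    have h2 : ContDiffAt ℝ ∞ Ring.inverse (gram v) :=
      ha ▸ (contDiffAt_ringInverse ℂ a).restrict_scalars ℝ
    exact h2.comp v hgram.contDiffAt
  have hcomp1 : ContDiffAt ℝ ∞ (fun v => A v ∘L Ring.inverse (gram v)) v :=
    ContDiffAt.clm_comp_complex
      A.contDiff.contDiffAt hinv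
  have hcomp2 : ContDiffAt ℝ ∞ (fun v => (A v ∘L Ring.inverse (gram v)) ∘L adj (A v)) v :=
    ContDiffAt.clm_comp_complex
      hcomp1 (adj.contDiff.comp A.contDiff).contDiffAt
  let e := EuclideanSpace.equiv (Fin n) ℂ
  have hcomp3 : ContDiffAt ℝ ∞
      (fun v => ((A v ∘L Ring.inverse (gram v)) ∘L adj (A v)) ∘L e.symm.toContinuousLinearMap) v :=
    ContDiffAt.clm_comp_complex
      hcomp2 contDiffAt_const
  have hcomp4 : ContDiffAt ℝ ∞ (fun v => e.toContinuousLinearMap ∘L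
      (((A v ∘L Ring.inverse (gram v)) ∘L adj (A v)) ∘L e.symm.toContinuousLinearMap)) v :=
    ContDiffAt.clm_comp_complex
      contDiffAt_const hcomp3
  refine hcomp4.congr_of_eventuallyEq ?_
  have hev : ∀ᶠ w in 𝓝 v, IsUnit (gram w) :=
    hgram.continuous.continuousAt.eventually (Units.isOpen.mem_nhds hunit)
  filter_upwards [hev] with w hw
  -- The value lies in the range of `A w`, and the remainder is orthogonal to this range because `A*
  -- (x - A (A* A)⁻¹ A* x) = 0`.
  have hstar : ((Submodule.span ℂ (range w)).map e.symm.toLinearEquiv.toLinearMap).starProjection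
      = (A w ∘L Ring.inverse (gram w)) ∘L adj (A w) := by
    ext1 x
    refine Submodule.eq_starProjection_of_mem_of_inner_eq_zero ?_ ?_
    · refine Submodule.mem_map.2 ⟨_, ?_, (ofColumns_apply w _).symm⟩
      exact Submodule.sum_mem _ fun j _ => Submodule.smul_mem _ _
        (Submodule.subset_span (mem_range_self j))
    · have hgen : ∀ y, inner ℂ (x - ((A w ∘L Ring.inverse (gram w)) ∘L adj (A w)) x)
          (A w y) = 0 := by
        intro y
        rw [← ContinuousLinearMap.adjoint_inner_left]
        have : adj (A w) (x - ((A w ∘L Ring.inverse (gram w)) ∘L adj (A w)) x) = 0 := by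
          rw [map_sub, sub_eq_zero]
          change _ = (gram w * Ring.inverse (gram w)) (adj (A w) x)
          rw [Ring.mul_inverse_cancel _ hw]
          rfl
        change inner ℂ (adj (A w) _) y = 0
        rw [this, inner_zero_left]
      intro y hy
      obtain ⟨z, hz, rfl⟩ := Submodule.mem_map.1 hy
      obtain ⟨c, rfl⟩ := (Submodule.mem_span_range_iff_exists_fun ℂ).1 hz
      have := hgen ((EuclideanSpace.equiv (Fin q) ℂ).symm c)
      rw [show A w ((EuclideanSpace.equiv (Fin q) ℂ).symm c) = ofColumns w _ from rfl,
        ofColumns_apply] at this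
      exact this
  rw [orthProj, ← hstar]

end Projections

end IntRes
end

noncomputable section

namespace IntRes

/-! ### Derivatives of bilinear expressions on manifolds -/

section Manifold

variable {EN HN : Type*} [NormedAddCommGroup EN] [NormedSpace ℝ EN] [TopologicalSpace HN]
  {I : ModelWithCorners ℝ EN HN} {N : Type*} [TopologicalSpace N] [ChartedSpace HN N]

theorem _root_.Filter.EventuallyEq.mvfderiv_eq {𝕜 : Type*} [NontriviallyNormedField 𝕜]
    {EN HN : Type*} [NormedAddCommGroup EN] [NormedSpace 𝕜 EN] [TopologicalSpace HN]
    {I : ModelWithCorners 𝕜 EN HN} {N : Type*} [TopologicalSpace N] [ChartedSpace HN N]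
    {V : Type*} [NormedAddCommGroup V] [NormedSpace 𝕜 V] {f g : N → V} {z : N}
    (h : f =ᶠ[𝓝 z] g) : mvfderiv I f z = mvfderiv I g z := by
  have h1 : mfderiv I 𝓘(𝕜, V) f z = mfderiv I 𝓘(𝕜, V) g z := h.mfderiv_eq
  ext1 w
  exact congrArg (fun L : EN →L[𝕜] V => L w) h1

theorem _root_.HasMFDerivAt.mvfderiv_apply {𝕜 : Type*} [NontriviallyNormedField 𝕜]
    {EN HN : Type*} [NormedAddCommGroup EN] [NormedSpace 𝕜 EN] [TopologicalSpace HN]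
    {I : ModelWithCorners 𝕜 EN HN} {N : Type*} [TopologicalSpace N] [ChartedSpace HN N]
    {V : Type*} [NormedAddCommGroup V] [NormedSpace 𝕜 V] {f : N → V} {z : N}
    {L : EN →L[𝕜] V} (h : HasMFDerivAt I 𝓘(𝕜, V) f z L) (w : TangentSpace I z) :
    mvfderiv I f z w = L w :=
  congrArg (fun L : EN →L[𝕜] V => L w) h.mfderiv

theorem mfderiv_bilin {X Y W : Type*} [NormedAddCommGroup X] [NormedSpace ℝ X]
    [NormedAddCommGroup Y] [NormedSpace ℝ Y] [NormedAddCommGroup W] [NormedSpace ℝ W]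
    (β : X →L[ℝ] Y →L[ℝ] W) {f : N → X} {g : N → Y} {z : N}
    (hf : MDifferentiableAt I 𝓘(ℝ, X) f z) (hg : MDifferentiableAt I 𝓘(ℝ, Y) g z)
    (w : TangentSpace I z) :
    mvfderiv I (fun z => β (f z) (g z)) z w
      = β (mvfderiv I f z w) (g z) + β (f z) (mvfderiv I g z w) := by
  have h1 := (β.isBoundedBilinearMap.hasFDerivAt (f z, g z)).hasMFDerivAt
  have hfg : HasMFDerivAt I 𝓘(ℝ, X × Y) (fun z => (f z, g z)) z _ :=
    ⟨hf.hasMFDerivAt.1.prodMk hg.hasMFDerivAt.1, hf.hasMFDerivAt.2.prodMk hg.hasMFDerivAt.2⟩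
  exact ((HasMFDerivAt.comp z h1 hfg).mvfderiv_apply w).trans (add_comm _ _)

variable {V : Type*} [NormedAddCommGroup V] [NormedSpace ℂ V] [NormedSpace ℝ V]
  [IsScalarTower ℝ ℂ V]

theorem mfderiv_mul {f g : N → V →L[ℂ] V} {z : N}
    (hf : MDifferentiableAt I 𝓘(ℝ, V →L[ℂ] V) f z)
    (hg : MDifferentiableAt I 𝓘(ℝ, V →L[ℂ] V) g z) (w : TangentSpace I z) :
    mvfderiv I (fun z => f z * g z) z w
      = mvfderiv I f z w * g z
        + f z * mvfderiv I g z w :=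
  mfderiv_bilin ((ContinuousLinearMap.compL ℂ V V V).bilinearRestrictScalars ℝ) hf hg w

theorem mfderiv_clm_apply {f : N → V →L[ℂ] V} {g : N → V} {z : N}
    (hf : MDifferentiableAt I 𝓘(ℝ, V →L[ℂ] V) f z)
    (hg : MDifferentiableAt I 𝓘(ℝ, V) g z) (w : TangentSpace I z) :
    mvfderiv I (fun z => f z (g z)) z w
      = mvfderiv I f z w (g z)
        + f z (mvfderiv I g z w) :=
  mfderiv_bilin (ContinuousLinearMap.restrictScalarsL ℂ V V ℝ ℝ) hf hg w

theorem mdifferentiableAt_mul {f g : N → V →L[ℂ] V} {z : N}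
    (hf : MDifferentiableAt I 𝓘(ℝ, V →L[ℂ] V) f z)
    (hg : MDifferentiableAt I 𝓘(ℝ, V →L[ℂ] V) g z) :
    MDifferentiableAt I 𝓘(ℝ, V →L[ℂ] V) (fun z => f z * g z) z := by
  have h1 := (((ContinuousLinearMap.compL ℂ V V V).bilinearRestrictScalars
    ℝ).isBoundedBilinearMap.hasFDerivAt (f z, g z)).hasMFDerivAt
  exact h1.mdifferentiableAt.comp z (hf.prodMk_space hg)

/-- Two families of projections whose ranges are related by `g` have derivatives which are related
by `g`. -/
theorem mfderiv_mul_of_intertwine {p p' g : N → V →L[ℂ] V} {z : N}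
    (hp : MDifferentiableAt I 𝓘(ℝ, V →L[ℂ] V) p z)
    (hp' : MDifferentiableAt I 𝓘(ℝ, V →L[ℂ] V) p' z)
    (hg : MDifferentiableAt I 𝓘(ℝ, V →L[ℂ] V) g z) (hpp : p z * p z = p z)
    (h : ∀ᶠ y in 𝓝 z, p' y * (g y * p y) = g y * p y) (w : TangentSpace I z) :
    mvfderiv I p' z w * (g z * p z)
      = (1 - p' z) * (mvfderiv I g z w * p z
        + g z * (mvfderiv I p z w * p z)) := by
  have hgp := mdifferentiableAt_mul hg hp
  -- The relation `p' g p = g p` is differentiated. Multiplication by `p` from the right then leaves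
  -- only `dp p` and not `dp` itself, which is the combination that is complex linear along `F`.
  have h1 : mvfderiv I (fun y => p' y * (g y * p y)) z
    = mvfderiv I (fun y => g y * p y) z := Filter.EventuallyEq.mvfderiv_eq h
  have h2 := congrArg (fun L => L w) h1
  simp only [mfderiv_mul hp' hgp, mfderiv_mul hg hp] at h2
  have h3 := congrArg (fun L => L * p z) h2
  simp only [add_mul, mul_add, mul_assoc, hpp] at h3
  simp only [sub_mul, one_mul, mul_add]
  rw [eq_sub_of_add_eq h3]
  abel

end Manifold

/-! ### Homogeneous submanifolds as real manifolds of projections -/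

section RestrictScalars

variable {EF : Type*} [NormedAddCommGroup EF] [NormedSpace ℂ EF]
  {F : Type*} [TopologicalSpace F] [ChartedSpace EF F]

variable (EF F) in
theorem isManifold_restrictScalars [h : IsManifold 𝓘(ℂ, EF) ω F] : IsManifold 𝓘(ℝ, EF) ∞ F := by
  refine isManifold_of_contDiffOn _ _ _ fun e e' he he' => ?_
  have h1 := (contDiffGroupoid ω 𝓘(ℂ, EF)).compatible he he'
  rw [contDiffGroupoid, mem_groupoid_of_pregroupoid] at h1
  have h2 := h1.1
  simp only [contDiffPregroupoid, contDiffPregroupoid] at h2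
  exact (h2.restrict_scalars ℝ).of_le le_top

variable {V : Type*} [NormedAddCommGroup V] [NormedSpace ℂ V] [NormedSpace ℝ V]
  [IsScalarTower ℝ ℂ V] {v : F → V} {f : F}

theorem _root_.ContMDiffAt.restrictScalars_real (hv : ContMDiffAt 𝓘(ℂ, EF) 𝓘(ℂ, V) ω v f) :
    ContMDiffAt 𝓘(ℝ, EF) 𝓘(ℝ, V) ∞ v f := by
  rw [contMDiffAt_iff] at hv ⊢
  exact ⟨hv.1, (hv.2.restrict_scalars ℝ).of_le le_top⟩

theorem mfderiv_restrictScalars (hv : ContMDiffAt 𝓘(ℂ, EF) 𝓘(ℂ, V) ω v f) (ξ : EF) :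
    mvfderiv 𝓘(ℝ, EF) v f ξ = mvfderiv 𝓘(ℂ, EF) v f ξ := by
  let L : EF →L[ℂ] V := mvfderiv 𝓘(ℂ, EF) v f
  have h1 : HasMFDerivAt 𝓘(ℂ, EF) 𝓘(ℂ, V) v f L :=
    (hv.mdifferentiableAt (by simp)).hasMFDerivAt
  have h2 : HasMFDerivAt 𝓘(ℝ, EF) 𝓘(ℝ, V) v f (L.restrictScalars ℝ) :=
    ⟨h1.1, HasFDerivWithinAt.restrictScalars ℝ h1.2⟩
  exact h2.mvfderiv_apply ξ

end RestrictScalars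

/-! ### The projections along a holomorphically immersed manifold -/

section Projections

variable {n q : ℕ} {EF : Type*} [NormedAddCommGroup EF] [NormedSpace ℂ EF]
  {F : Type*} [TopologicalSpace F] [ChartedSpace EF F] {s : F → Submodule ℂ (Fin n → ℂ)}

/-- At `z`, the `q` vectors span a space of dimension `q`, so they are independent and
`contDiffAt_orthProj_span` applies. -/
theorem contMDiffAt_orthProj {EN HN : Type*} [NormedAddCommGroup EN] [NormedSpace ℝ EN]
    [TopologicalSpace HN] {I : ModelWithCorners ℝ EN HN} {N : Type*} [TopologicalSpace N]
    [ChartedSpace HN N] {S : N → Submodule ℂ (Fin n → ℂ)} {v : Fin q → N → (Fin n → ℂ)} {z : N}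
    (hv : ∀ j, ContMDiffAt I 𝓘(ℝ, Fin n → ℂ) ∞ (v j) z)
    (hS : ∀ᶠ y in 𝓝 z, S y = Submodule.span ℂ (range fun j => v j y))
    (hq : finrank ℂ (S z) = q) : ContMDiffAt I 𝓘(ℝ, EndC n) ∞ (fun y => orthProj (S y)) z := by
  have hli : LinearIndependent ℂ fun j => v j z := by
    rw [linearIndependent_iff_card_eq_finrank_span, Set.finrank, ← hS.self_of_nhds, hq,
      Fintype.card_fin]
  have h1 : ContMDiffAt I 𝓘(ℝ, Fin q → Fin n → ℂ) ∞ (fun y j => v j y) z :=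
    contMDiffAt_pi_space.2 hv
  refine ((contDiffAt_orthProj_span hli).contMDiffAt.comp z h1).congr_of_eventuallyEq ?_
  filter_upwards [hS] with y hy
  simp only [hy, Function.comp_def]

variable (hs : IsHolomorphicImmersion (EF := EF) q s)
include hs

theorem IsHolomorphicImmersion.contMDiff_orthProj :
    ContMDiff 𝓘(ℝ, EF) 𝓘(ℝ, EndC n) ∞ fun f => orthProj (s f) := by
  intro f
  obtain ⟨v, hv, hsv, -⟩ := hs.2 f
  exact contMDiffAt_orthProj (fun j => (hv j).restrictScalars_real) hsv (hs.1 f)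

/-- Differentiating `p v_j = v_j` gives `dp(ξ) v_j = (1 - p) dv_j(ξ)`. So `dp p` is the differential
of the inclusion into the Grassmannian, with `ℂⁿ/s(f)` realized as the orthogonal complement of
`s(f)`. -/
theorem IsHolomorphicImmersion.mfderiv_orthProj_frame (f : F) :
    ∃ v : Fin q → F → (Fin n → ℂ), (∀ j, ContMDiffAt 𝓘(ℂ, EF) 𝓘(ℂ, Fin n → ℂ) ω (v j) f) ∧
    (s f = Submodule.span ℂ (range fun j => v j f)) ∧
    (∀ ξ : EF, (∀ j, mvfderiv 𝓘(ℂ, EF) (v j) f ξ ∈ s f) → ξ = 0) ∧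
    ∀ j (ξ : EF),
      mvfderiv 𝓘(ℝ, EF) (fun f => orthProj (s f)) f ξ (v j f)
      = (1 - orthProj (s f)) (mvfderiv 𝓘(ℂ, EF) (v j) f ξ) := by
  obtain ⟨v, hv, hsv, himm⟩ := hs.2 f
  refine ⟨v, hv, hsv.self_of_nhds, himm, fun j ξ => ?_⟩
  have h1 := mfderiv_clm_apply ((hs.contMDiff_orthProj f).mdifferentiableAt (by simp))
    ((hv j).restrictScalars_real.mdifferentiableAt (by simp)) ξ
  have h2 : mvfderiv 𝓘(ℝ, EF) (fun f => orthProj (s f) (v j f)) f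
      = mvfderiv 𝓘(ℝ, EF) (v j) f := by
    refine Filter.EventuallyEq.mvfderiv_eq ?_
    filter_upwards [hsv] with f' hf'
    exact orthProj_apply_eq_iff.2 (hf' ▸ Submodule.subset_span (mem_range_self j))
  rw [h2, mfderiv_restrictScalars (hv j)] at h1
  rw [sub_apply, one_apply_eq_self]
  exact eq_sub_of_add_eq h1.symm

/-- The differential of the inclusion into the Grassmannian is complex linear. -/
theorem IsHolomorphicImmersion.mfderiv_orthProj_I_smul (f : F) (ξ : EF) :
    mvfderiv 𝓘(ℝ, EF) (fun f => orthProj (s f)) f (Complex.I • ξ : EF)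
        * orthProj (s f)
      = Complex.I • (mvfderiv 𝓘(ℝ, EF) (fun f => orthProj (s f)) f ξ
        * orthProj (s f)) := by
  obtain ⟨v, hv, hsv, -, hd⟩ := hs.mfderiv_orthProj_frame f
  ext1 c
  -- Although `dp` need not be complex linear, `dp p` is determined by its values on the holomorphic
  -- basis, where it is `(1 - p) dv_j`.
  have hc : orthProj (s f) c ∈ Submodule.span ℂ (range fun j => v j f) :=
    hsv.le (orthProj_apply_mem (s f) c)
  obtain ⟨b, hb⟩ := (Submodule.mem_span_range_iff_exists_fun ℂ).1 hc
  simp only [mul_apply_eq_comp, smul_apply, ← hb, map_sum, map_smul, hd, Finset.smul_sum]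
  refine Finset.sum_congr rfl fun j _ => ?_
  have : mvfderiv 𝓘(ℂ, EF) (v j) f (Complex.I • ξ : EF)
    = Complex.I • mvfderiv 𝓘(ℂ, EF) (v j) f ξ :=
    (mvfderiv 𝓘(ℂ, EF) (v j) f).map_smul Complex.I ξ
  rw [this, map_smul, smul_comm]

/-- If `dp(ξ) p = 0`, then `(1 - p) dv_j(ξ) = 0` for all `j`, and the immersion condition applies.
-/
theorem IsHolomorphicImmersion.mfderiv_orthProj_injective (f : F) {ξ : EF}
    (hξ : mvfderiv 𝓘(ℝ, EF) (fun f => orthProj (s f)) f ξ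
      * orthProj (s f) = 0) : ξ = 0 := by
  obtain ⟨v, hv, hsv, himm, hd⟩ := hs.mfderiv_orthProj_frame f
  refine himm ξ fun j => ?_
  have h1 : orthProj (s f) (v j f) = v j f :=
    orthProj_apply_eq_iff.2 (hsv ▸ Submodule.subset_span (mem_range_self j))
  have h2 := congrArg (fun L : EndC n => L (v j f)) hξ
  simp only [mul_apply_eq_comp, h1, hd, zero_apply, sub_apply, one_apply_eq_self] at h2
  exact orthProj_apply_eq_iff.1 (sub_eq_zero.1 h2).symm

/-- A continuous map to `F` is smooth if the corresponding family of projections is smooth. -/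
theorem IsHolomorphicImmersion.contMDiffAt_of_orthProj [FiniteDimensional ℂ EF]
    [IsManifold 𝓘(ℝ, EF) ∞ F] {EN HN : Type*} [NormedAddCommGroup EN] [NormedSpace ℝ EN]
    [TopologicalSpace HN] {I : ModelWithCorners ℝ EN HN} {N : Type*} [TopologicalSpace N]
    [ChartedSpace HN N] {γ : N → F} {z : N} (hγ : ContinuousAt γ z)
    (h : ContMDiffAt I 𝓘(ℝ, EndC n) ∞ (fun y => orthProj (s (γ y))) z) :
    ContMDiffAt I 𝓘(ℝ, EF) ∞ γ z := by
  have : FiniteDimensional ℝ EF := FiniteDimensional.complexToReal EF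
  have : CompleteSpace EF := FiniteDimensional.complete ℝ EF
  let φ := extChartAt 𝓘(ℝ, EF) (γ z)
  let D : EF →L[ℝ] EndC n := mvfderiv 𝓘(ℝ, EF) (fun f => orthProj (s f)) (γ z)
  have hD : Function.Injective D := by
    rw [injective_iff_map_eq_zero]
    intro ξ hξ
    refine hs.mfderiv_orthProj_injective (γ z) ?_
    change D ξ * _ = 0
    rw [hξ, zero_mul]
  -- Composing `f ↦ orthProj (s f)`, read in a chart of `F`, with a linear left inverse of its
  -- differential gives a self-map `h₀` of `EF` with derivative the identity. Its local inverse
  -- recovers the coordinates of `γ` from the projections.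
  obtain ⟨T, hT⟩ := D.toLinearMap.exists_leftInverse_of_injective (LinearMap.ker_eq_bot.2 hD)
  let T' : EndC n →L[ℝ] EF := LinearMap.toContinuousLinearMap T
  let h₀ : EF → EF := fun y => T' (orthProj (s (φ.symm y)))
  have hP : ContDiffAt ℝ ∞ (fun y => orthProj (s (φ.symm y))) (φ (γ z)) := by
    have h2 := (contMDiffAt_iff.1 (hs.contMDiff_orthProj (γ z))).2
    rw [ModelWithCorners.range_eq_univ, contDiffWithinAt_univ] at h2
    exact h2
  have hh₀ : ContDiffAt ℝ ∞ h₀ (φ (γ z)) := T'.contDiff.contDiffAt.comp _ hP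
  have hder : HasFDerivAt h₀ (ContinuousLinearEquiv.refl ℝ EF : EF →L[ℝ] EF) (φ (γ z)) := by
    have h1 : HasFDerivAt (fun y => orthProj (s (φ.symm y))) D (φ (γ z)) := by
      have h2 := ((hs.contMDiff_orthProj (γ z)).mdifferentiableAt (by simp)).hasMFDerivAt.2
      rw [ModelWithCorners.range_eq_univ] at h2
      exact HasFDerivWithinAt.hasFDerivAt_of_univ (𝕜 := ℝ) (E := EF) (F := EndC n) h2
    have h2 : HasFDerivAt h₀ (T' ∘L D) (φ (γ z)) := T'.hasFDerivAt.comp _ h1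
    have h3 : T' ∘L D = (ContinuousLinearEquiv.refl ℝ EF : EF →L[ℝ] EF) := by
      ext ξ
      exact LinearMap.congr_fun hT ξ
    rwa [h3] at h2
  let g := hh₀.localInverse hder (by simp)
  have hg : ContDiffAt ℝ ∞ g (h₀ (φ (γ z))) := hh₀.to_localInverse hder (by simp)
  have hleft : ∀ᶠ y in 𝓝 (φ (γ z)), g (h₀ y) = y :=
    (hh₀.hasStrictFDerivAt' hder (by simp)).eventually_left_inverse
  -- An injective immersion need not be a homeomorphism onto its image. The continuity of `γ`
  -- ensures that its values stay where the chart and the local inverse are available.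
  have hsrc : ∀ᶠ y in 𝓝 z, γ y ∈ φ.source := hγ (extChartAt_source_mem_nhds (γ z))
  have hcont : ContinuousAt (fun y => φ (γ y)) z :=
    ContinuousAt.comp (g := φ) (continuousAt_extChartAt (γ z)) hγ
  rw [contMDiffAt_iff_target]
  refine ⟨hγ, ?_⟩
  have h3 : ContMDiffAt I 𝓘(ℝ, EF) ∞ (fun y => g (T' (orthProj (s (γ y))))) z := by
    refine ContMDiffAt.comp (g := g) (f := fun y => T' (orthProj (s (γ y)))) z ?_
      (T'.contDiff.contMDiff.contMDiffAt.comp z h)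
    refine ContDiffAt.contMDiffAt ?_
    convert hg using 1
    change _ = T' (orthProj (s (φ.symm (φ (γ z)))))
    rw [extChartAt_to_inv]
  refine h3.congr_of_eventuallyEq ?_
  filter_upwards [hsrc, hcont.eventually hleft] with y h4 h5
  change φ (γ y) = _
  rw [← h5]
  change g (T' (orthProj (s (φ.symm (φ (γ y)))))) = _
  rw [φ.left_inv h4]

end Projections

end IntRes
end

noncomputable section

namespace IntRes

/-! ### Complexification of vectors and matrices -/

section ToC

variable {n : ℕ}

/-- The inclusion of `ℝⁿ` into `ℂⁿ`. -/
def toC (n : ℕ) : (Fin n → ℝ) →L[ℝ] (Fin n → ℂ) :=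
  ContinuousLinearMap.pi fun i => Complex.ofRealCLM ∘L ContinuousLinearMap.proj i

theorem toC_apply (c : Fin n → ℝ) (i : Fin n) : toC n c i = c i := rfl

theorem toC_single (j : Fin n) : toC n (Pi.single j 1) = Pi.single j 1 := by
  ext i
  by_cases h : i = j
  · subst h; simp [toC_apply]
  · simp [toC_apply, h]

/-- The endomorphism of `ℂⁿ` given by a real matrix. -/
def matC (n : ℕ) : Matrix (Fin n) (Fin n) ℝ →ₐ[ℝ] EndC n :=
  ((Module.End.toContinuousLinearMap (𝕜 := ℂ) (Fin n → ℂ)).toAlgHom.restrictScalars ℝ).comp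
    ((Matrix.toLinAlgEquiv' (R := ℂ) (n := Fin n)).toAlgHom.restrictScalars ℝ |>.comp
      (Algebra.ofId ℝ ℂ).mapMatrix)

theorem matC_apply (A : Matrix (Fin n) (Fin n) ℝ) (c : Fin n → ℂ) :
    matC n A c = A.map ((↑) : ℝ → ℂ) *ᵥ c := rfl

theorem matC_toC (A : Matrix (Fin n) (Fin n) ℝ) (c : Fin n → ℝ) :
    matC n A (toC n c) = toC n (A *ᵥ c) := by
  ext i
  simp [matC_apply, toC_apply, Matrix.mulVec, dotProduct]

theorem EndC_ext {L L' : EndC n} (h : ∀ j, L (Pi.single j 1) = L' (Pi.single j 1)) : L = L' := by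
  apply ContinuousLinearMap.coe_injective
  exact LinearMap.pi_ext' fun j => LinearMap.ext_ring (h j)

end ToC

/-! ### Frames and their coefficients -/

section Frames

variable {n q : ℕ} {EM : Type*} [NormedAddCommGroup EM] [NormedSpace ℝ EM]
  {M : Type*} [TopologicalSpace M] [ChartedSpace EM M]
  {E : M → Type*} [∀ x, AddCommGroup (E x)] [∀ x, Module ℝ (E x)]
  [TopologicalSpace (TotalSpace (Fin n → ℝ) E)] [∀ x, TopologicalSpace (E x)]
  [FiberBundle (Fin n → ℝ) E] [VectorBundle ℝ (Fin n → ℝ) E]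
  {G : Subgroup (GL (Fin n) ℝ)}

theorem sum_frame {x : M} (u : (Fin n → ℝ) ≃ₗ[ℝ] E x) (c : Fin n → ℝ) :
    u c = ∑ j, c j • u (Pi.single j 1) := by
  conv_lhs => rw [pi_eq_sum_univ' c, map_sum]
  refine Finset.sum_congr rfl fun j _ => ?_
  rw [map_smul]

theorem cFrame_toC {x : M} (u : (Fin n → ℝ) ≃ₗ[ℝ] E x) (c : Fin n → ℝ) :
    cFrame u (toC n c) = (1 : ℂ) ⊗ₜ[ℝ] u c := cFrame_ofReal u c

theorem cFrame_cplx {x : M} (u : (Fin n → ℝ) ≃ₗ[ℝ] E x) (c d : Fin n → ℝ) :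
    cFrame u (toC n c + Complex.I • toC n d) = cplx (u c) (u d) := by
  rw [map_add, map_smul, cFrame_toC, cFrame_toC, TensorProduct.smul_tmul', smul_eq_mul, mul_one]
  rfl

section Coefficients

variable {fr : ∀ x, Set ((Fin n → ℝ) ≃ₗ[ℝ] E x)} {O : Set M} {u : ∀ x, (Fin n → ℝ) ≃ₗ[ℝ] E x}

/-- The coefficients of a smooth section with respect to a smooth frame are smooth. -/
theorem IsLocalSection.contMDiffAt_symm (hu : IsLocalSection (EM := EM) fr O u) {x : M}
    (hx : x ∈ O) {σ : ∀ x, E x}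
    (hσ : ContMDiffAt 𝓘(ℝ, EM) (𝓘(ℝ, EM).prod 𝓘(ℝ, Fin n → ℝ)) ∞
      (fun y => TotalSpace.mk' (Fin n → ℝ) y (σ y)) x) :
    ContMDiffAt 𝓘(ℝ, EM) 𝓘(ℝ, Fin n → ℝ) ∞ (fun y => (u y).symm (σ y)) x := by
  let e := trivializationAt (Fin n → ℝ) E x
  have hmem : ∀ᶠ y in 𝓝 x, y ∈ e.baseSet :=
    e.open_baseSet.mem_nhds (FiberBundle.mem_baseSet_trivializationAt _ _ _)
  -- This is the frame `u` in a vector bundle trivialization. The coefficients of `σ` in `u` are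
  -- `A⁻¹` applied to its components in the trivialization.
  let A : M → (Fin n → ℝ) →L[ℝ] (Fin n → ℝ) := fun y =>
    ∑ j, (ContinuousLinearMap.proj j).smulRight (e ⟨y, u y (Pi.single j 1)⟩).2
  have hA : ContMDiffAt 𝓘(ℝ, EM) 𝓘(ℝ, (Fin n → ℝ) →L[ℝ] (Fin n → ℝ)) ∞ A x := by
    refine ContMDiffAt.sum fun j _ => ?_
    have h1 := (Bundle.contMDiffAt_section x).1 ((hu.smooth j).contMDiffAt (hu.isOpen.mem_nhds hx))
    exact (ContinuousLinearMap.smulRightL ℝ (Fin n → ℝ) (Fin n → ℝ)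
      (ContinuousLinearMap.proj j)).contDiff.contMDiff.contMDiffAt.comp x h1
  have hAe : ∀ y, y ∈ e.baseSet → ∀ c, A y c = (e ⟨y, u y c⟩).2 := by
    intro y hy c
    have h1 : ∀ s : E y, (e ⟨y, s⟩).2 = e.linearEquivAt ℝ y hy s := fun s => rfl
    simp only [h1]
    rw [sum_frame (u y) c, map_sum]
    simp only [A, h1, map_smul, sum_apply,
      ContinuousLinearMap.smulRight_apply, ContinuousLinearMap.proj_apply]
  have hunit : ∀ y, y ∈ e.baseSet → IsUnit (A y) := by
    intro y hy
    refine ⟨ContinuousLinearEquiv.toUnit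
      ((u y).trans (e.linearEquivAt ℝ y hy)).toContinuousLinearEquiv, ?_⟩
    ext1 c
    exact (hAe y hy c).symm
  have hinv : ContMDiffAt 𝓘(ℝ, EM) 𝓘(ℝ, (Fin n → ℝ) →L[ℝ] (Fin n → ℝ)) ∞
      (fun y => Ring.inverse (A y)) x := by
    obtain ⟨a, ha⟩ := hunit x hmem.self_of_nhds
    have h2 : ContDiffAt ℝ ∞ Ring.inverse (A x) := ha ▸ contDiffAt_ringInverse ℝ a
    exact h2.contMDiffAt.comp x hA
  refine (hinv.clm_apply ((Bundle.contMDiffAt_section x).1 hσ)).congr_of_eventuallyEq ?_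
  filter_upwards [hmem] with y hy
  have h3 : (e ⟨y, σ y⟩).2 = A y ((u y).symm (σ y)) := by
    rw [hAe y hy, LinearEquiv.apply_symm_apply]
  change _ = Ring.inverse (A y) (e ⟨y, σ y⟩).2
  rw [h3, ← mul_apply_eq_comp, Ring.inverse_mul_cancel _ (hunit y hy)]
  rfl

theorem IsLocalSection.contMDiffAt_apply [ContMDiffVectorBundle ∞ (Fin n → ℝ) E 𝓘(ℝ, EM)]
    (hu : IsLocalSection (EM := EM) fr O u) {x : M}
    (hx : x ∈ O) {c : M → Fin n → ℝ} (hc : ContMDiffAt 𝓘(ℝ, EM) 𝓘(ℝ, Fin n → ℝ) ∞ c x) :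
    ContMDiffAt 𝓘(ℝ, EM) (𝓘(ℝ, EM).prod 𝓘(ℝ, Fin n → ℝ)) ∞
      (fun y => TotalSpace.mk' (Fin n → ℝ) y (u y (c y))) x := by
  have h1 : ∀ j ∈ Finset.univ, ContMDiffAt 𝓘(ℝ, EM) (𝓘(ℝ, EM).prod 𝓘(ℝ, Fin n → ℝ)) ∞
      (fun y => TotalSpace.mk' (Fin n → ℝ) y (c y j • u y (Pi.single j 1))) x := fun j _ =>
    ContMDiffAt.smul_section (contMDiffAt_pi_space.1 hc j)
      ((hu.smooth j).contMDiffAt (hu.isOpen.mem_nhds hx))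
  have h2 := ContMDiffAt.sum_section h1
  refine h2.congr_of_eventuallyEq (Eventually.of_forall fun y => ?_)
  simp only [← sum_frame]

/-- The columns of the transition matrix are the coefficients of the vectors of `u'` with respect to
`u`. -/
theorem IsLocalSection.contMDiffAt_transMat {fr' : ∀ x, Set ((Fin n → ℝ) ≃ₗ[ℝ] E x)} {O' : Set M}
    {u' : ∀ x, (Fin n → ℝ) ≃ₗ[ℝ] E x} (hu : IsLocalSection (EM := EM) fr O u)
    (hu' : IsLocalSection (EM := EM) fr' O' u') {x : M} (hx : x ∈ O) (hx' : x ∈ O') :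
    ContMDiffAt 𝓘(ℝ, EM) 𝓘(ℝ, EndC n) ∞ (fun y => matC n (transMat (u y) (u' y))) x := by
  let B : (Fin n → Fin n → ℝ) →ₗ[ℝ] EndC n :=
    { toFun := fun c => matC n (Matrix.of fun i j => c j i)
      map_add' := fun c d => by rw [← map_add]; rfl
      map_smul' := fun r c => by rw [← map_smul]; rfl }
  have h1 : ContMDiffAt 𝓘(ℝ, EM) 𝓘(ℝ, Fin n → Fin n → ℝ) ∞
      (fun y j => (u y).symm (u' y (Pi.single j 1))) x :=
    contMDiffAt_pi_space.2 fun j => hu.contMDiffAt_symm hx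
      ((hu'.smooth j).contMDiffAt (hu'.isOpen.mem_nhds hx'))
  refine ((LinearMap.toContinuousLinearMap B).contDiff.contMDiff.contMDiffAt.comp x
    h1).congr_of_eventuallyEq (Eventually.of_forall fun y => ?_)
  refine congrArg (matC n) ?_
  ext i j
  simp [transMat, LinearMap.toMatrix'_apply]

end Coefficients

end Frames

/-! ### The smooth structure of the associated bundle -/

section Smooth

variable {n q : ℕ} {EM : Type*} [NormedAddCommGroup EM] [NormedSpace ℝ EM]
  {M : Type*} [TopologicalSpace M] [ChartedSpace EM M]
  {E : M → Type*} [∀ x, AddCommGroup (E x)] [∀ x, Module ℝ (E x)]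
  [TopologicalSpace (TotalSpace (Fin n → ℝ) E)] [∀ x, TopologicalSpace (E x)]
  [FiberBundle (Fin n → ℝ) E] [VectorBundle ℝ (Fin n → ℝ) E]
  {EF : Type*} [NormedAddCommGroup EF] [NormedSpace ℂ EF]
  {F : Type*} [TopologicalSpace F] [ChartedSpace EF F]
  {G : Subgroup (GL (Fin n) ℝ)}
  {P : FrameReduction (EM := EM) E G} {S : HomogeneousSubmanifold (EF := EF) F G q}

theorem toSub_fibreCoord_map {x : M} {u : (Fin n → ℝ) ≃ₗ[ℝ] E x} (hu : u ∈ P.frames x)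
    (p : AssocFibre P S x) : (S.toSub (fibreCoord hu p)).map (cFrame u).toLinearMap = p.1 :=
  congrArg Subtype.val (fibrePoint_fibreCoord hu p)

/-- The component in `F` of the points of `P ×_G F`, with respect to a local section of `P`. -/
def coordF (u : ∀ x, (Fin n → ℝ) ≃ₗ[ℝ] E x) (z : AssocBundle P S) : F :=
  fibreCoord (someFrame_mem P u z.proj) z.snd

theorem sectionOf_coordF (u : ∀ x, (Fin n → ℝ) ≃ₗ[ℝ] E x) (z : AssocBundle P S) :
    sectionOf P S u (coordF u z) z.proj = z := by
  obtain ⟨x, p⟩ := z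
  simp only [sectionOf, coordF, fibrePoint_fibreCoord]

theorem coordF_sectionOf (u : ∀ x, (Fin n → ℝ) ≃ₗ[ℝ] E x) (f : F) (x : M) :
    coordF u (sectionOf P S u f x) = f := fibreCoord_fibrePoint _ f

theorem toSub_coordF_map {u : ∀ x, (Fin n → ℝ) ≃ₗ[ℝ] E x} {z : AssocBundle P S}
    (hu : u z.proj ∈ P.frames z.proj) :
    (S.toSub (coordF u z)).map (cFrame (u z.proj)).toLinearMap = z.sub := by
  rw [← show cFrame (someFrame P u z.proj) = cFrame (u z.proj) by rw [someFrame_eq hu]]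
  exact toSub_fibreCoord_map _ z.snd

theorem mem_sub_iff {u : ∀ x, (Fin n → ℝ) ≃ₗ[ℝ] E x} {z : AssocBundle P S}
    (hu : u z.proj ∈ P.frames z.proj) (c : Fin n → ℂ) :
    cFrame (u z.proj) c ∈ z.sub ↔ orthProj (S.toSub (coordF u z)) c = c := by
  rw [orthProj_apply_eq_iff, ← toSub_coordF_map hu]
  exact ⟨fun ⟨c', hc', h⟩ => (cFrame (u z.proj)).injective h ▸ hc', fun h => ⟨c, h, rfl⟩⟩

/-- This is the relation `[u h, f] = [u, h f]`, where `h` is the transition matrix from `u` to `u'`.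
-/
theorem toSub_coordF_sectionOf {u u' : ∀ x, (Fin n → ℝ) ≃ₗ[ℝ] E x} {x : M}
    (hu : u x ∈ P.frames x) (hu' : u' x ∈ P.frames x) (f : F) :
    S.toSub (coordF u (sectionOf P S u' f x))
      = (S.toSub f).map (matC n (transMat (u x) (u' x))).toLinearMap := by
  obtain ⟨g, hg, h⟩ := (P.torsor _ _ hu _).1 hu'
  apply Submodule.map_injective_of_injective (cFrame (u x)).injective
  refine (toSub_coordF_map (z := sectionOf P S u' f x) hu).trans ?_
  have h2 : (S.toSub f).map (cFrame (u' x)).toLinearMap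
    = (glMap (glC g) (S.toSub f)).map (cFrame (u x)).toLinearMap := map_cFrame_mul h _
  change (S.toSub f).map (cFrame (someFrame P u' x)).toLinearMap = _
  rw [someFrame_eq hu', h2, transMat_eq h]
  rfl

variable [FiniteDimensional ℂ EF] [IsManifold 𝓘(ℝ, EF) ∞ F]

/-- This is the fibre component of a change of trivialization. It is continuous because `G` acts
continuously on `F`. Its subspaces are spanned by the vectors `h(x) v_j(f)`, which are smooth in
`(x, f)`, so its projections are smooth, and smoothness into `F` follows. -/
theorem contMDiffAt_coordF_sectionOf {O O' : Set M} {u u' : ∀ x, (Fin n → ℝ) ≃ₗ[ℝ] E x}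
    (hu : IsLocalSection (EM := EM) P.frames O u) (hu' : IsLocalSection (EM := EM) P.frames O' u')
    {y : M × F} (hy : y.1 ∈ O) (hy' : y.1 ∈ O') :
    ContMDiffAt (assocModel EM EF) 𝓘(ℝ, EF) ∞
      (fun y : M × F => coordF u (sectionOf P S u' y.2 y.1)) y := by
  have hopen : ∀ᶠ y' : M × F in 𝓝 y, y'.1 ∈ O ∧ y'.1 ∈ O' :=
    continuous_fst.continuousAt.eventually
      ((hu.isOpen.eventually_mem hy).and (hu'.isOpen.eventually_mem hy'))
  have hc := continuousOn_trivChange P S hu hu'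
  have hset : (localTriv P S hu').target ∩
      (localTriv P S hu').toPartialEquiv.symm ⁻¹' (localTriv P S hu).source ∈ 𝓝 y := by
    filter_upwards [hopen] with y' h
    exact ⟨⟨h.2, trivial⟩, h.1⟩
  have hcont : ContinuousAt (fun y : M × F => coordF u (sectionOf P S u' y.2 y.1)) y :=
    continuous_snd.continuousAt.comp (hc.continuousAt hset)
  refine S.immersion.contMDiffAt_of_orthProj hcont ?_
  obtain ⟨v, hv, hsv, -⟩ := S.immersion.2 y.2
  refine contMDiffAt_orthProj (q := q)
    (v := fun j (y : M × F) => matC n (transMat (u y.1) (u' y.1)) (v j y.2)) (fun j => ?_) ?_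
    (S.immersion.1 _)
  · have h1 : ContMDiffAt (assocModel EM EF) 𝓘(ℝ, EndC n) ∞
        (fun y : M × F => matC n (transMat (u y.1) (u' y.1))) y :=
      ContMDiffAt.comp (g := fun x => matC n (transMat (u x) (u' x))) y
        (hu.contMDiffAt_transMat hu' hy hy') contMDiffAt_fst
    have h2 : ContMDiffAt (assocModel EM EF) 𝓘(ℝ, Fin n → ℂ) ∞ (fun y : M × F => v j y.2) y :=
      ContMDiffAt.comp y (hv j).restrictScalars_real contMDiffAt_snd
    exact ((ContinuousLinearMap.restrictScalarsL ℂ (Fin n → ℂ) (Fin n → ℂ) ℝ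
      ℝ).contDiff.contMDiff.contMDiffAt.comp y h1).clm_apply h2
  · filter_upwards [hopen, continuous_snd.continuousAt.eventually hsv] with y' h1 h2
    rw [toSub_coordF_sectionOf (hu.mem _ h1.1) (hu'.mem _ h1.2), h2, Submodule.map_span,
      ← range_comp]
    rfl

variable (P S) in
/-- The local trivialization of `P ×_G F` defined by a local section of `P`. -/
def homeoTriv {O : Set M} {u : ∀ x, (Fin n → ℝ) ≃ₗ[ℝ] E x}
    (hu : IsLocalSection (EM := EM) P.frames O u) :
    OpenPartialHomeomorph (AssocBundle P S) (M × F) :=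
  ((assocPrebundle P S).trivializationOfMemPretrivializationAtlas
    ⟨O, u, hu, rfl⟩).toOpenPartialHomeomorph

omit [FiniteDimensional ℂ EF] [IsManifold 𝓘(ℝ, EF) ∞ F] in
theorem exists_eq_homeoTriv {e : OpenPartialHomeomorph (AssocBundle P S) (M × F)}
    (he : e ∈ atlas (M × F) (AssocBundle P S)) :
    ∃ (O : Set M) (u : ∀ x, (Fin n → ℝ) ≃ₗ[ℝ] E x)
      (hu : IsLocalSection (EM := EM) P.frames O u), e = homeoTriv P S hu := by
  obtain ⟨_, ⟨_, ⟨O, u, hu, rfl⟩, rfl⟩, rfl⟩ := he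
  exact ⟨O, u, hu, rfl⟩

theorem contMDiffOn_homeoTriv_change {O O' : Set M} {u u' : ∀ x, (Fin n → ℝ) ≃ₗ[ℝ] E x}
    (hu : IsLocalSection (EM := EM) P.frames O u) (hu' : IsLocalSection (EM := EM) P.frames O' u') :
    ContMDiffOn (assocModel EM EF) (assocModel EM EF) ∞
      ((homeoTriv P S hu').symm ≫ₕ homeoTriv P S hu)
      ((homeoTriv P S hu').symm ≫ₕ homeoTriv P S hu).source := by
  intro y hy
  have h1 : y.1 ∈ O' := hy.1.1
  have h2 : y.1 ∈ O := hy.2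
  exact (contMDiffAt_fst.prodMk
    (contMDiffAt_coordF_sectionOf hu hu' h2 h1)).contMDiffWithinAt

variable [IsManifold 𝓘(ℝ, EM) ∞ M]

/-- A change of charts is an inverse chart of `M × F`, a change of trivialization and a chart of `M
× F`, all of them smooth. -/
instance : IsManifold (assocModel EM EF) ∞ (AssocBundle P S) := by
  have key : ∀ e ∈ atlas (ModelProd EM EF) (AssocBundle P S),
      ∀ e' ∈ atlas (ModelProd EM EF) (AssocBundle P S),
      ContMDiffOn (assocModel EM EF) (assocModel EM EF) ∞ (e.symm ≫ₕ e') (e.symm ≫ₕ e').source := by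
    rintro _ ⟨t, ht, c, hc, rfl⟩ _ ⟨t', ht', c', hc', rfl⟩
    obtain ⟨O, u, hu, rfl⟩ := exists_eq_homeoTriv ht
    obtain ⟨O', u', hu', rfl⟩ := exists_eq_homeoTriv ht'
    have h1 := contMDiffOn_symm_of_mem_maximalAtlas (I := assocModel EM EF) (n := ∞)
      (StructureGroupoid.subset_maximalAtlas _ hc)
    have h2 := contMDiffOn_of_mem_maximalAtlas (I := assocModel EM EF) (n := ∞)
      (StructureGroupoid.subset_maximalAtlas _ hc')
    have h3 := contMDiffOn_homeoTriv_change (S := S) hu' hu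
    intro y hy
    simp only [mfld_simps] at hy
    have hy1 := h1.contMDiffAt (c.open_target.mem_nhds hy.1.1)
    have hy3 := h3.contMDiffAt (((homeoTriv P S hu).symm ≫ₕ homeoTriv P S hu').open_source.mem_nhds
      (x := c.symm y) (by simpa only [mfld_simps] using ⟨hy.1.2, hy.2.1⟩))
    have hy2 := h2.contMDiffAt (c'.open_source.mem_nhds hy.2.2)
    exact (ContMDiffAt.comp y hy2 (ContMDiffAt.comp y hy3 hy1)).contMDiffWithinAt
  refine isManifold_of_contDiffOn _ _ _ fun e e' he he' => ?_
  -- The preferred charts of the model space are all the identity, so any base point `o` serves to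
  -- turn manifold smoothness into ordinary smoothness.
  obtain ⟨o⟩ : Nonempty (ModelProd EM EF) := ⟨(0, 0)⟩
  have h1 := (contMDiffOn_iff.1 (key e he e' he')).2 o o
  have h2 : ∀ y : ModelProd EM EF, y ∈ (extChartAt (assocModel EM EF) o).source := by
    intro y
    rw [extChartAt_source, chartAt_self_eq]
    trivial
  exact h1.mono fun y hy => ⟨(extChartAt (assocModel EM EF) o).map_source
    (h2 ((assocModel EM EF).symm y)), hy.1, h2 _⟩

end Smooth

end IntRes
end

noncomputable section

namespace IntRes

/-! ### Changing a local section of the reduction by functions with values in the group -/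

section Frames

variable {n q : ℕ} {EM : Type*} [NormedAddCommGroup EM] [NormedSpace ℝ EM]
  {M : Type*} [TopologicalSpace M] [ChartedSpace EM M]
  {E : M → Type*} [∀ x, AddCommGroup (E x)] [∀ x, Module ℝ (E x)]
  [TopologicalSpace (TotalSpace (Fin n → ℝ) E)] [∀ x, TopologicalSpace (E x)]
  [FiberBundle (Fin n → ℝ) E] [VectorBundle ℝ (Fin n → ℝ) E]
  {G : Subgroup (GL (Fin n) ℝ)} {P : FrameReduction (EM := EM) E G}

/-- The frames `u_x h_x`. -/
def mulFrame (u : ∀ x, (Fin n → ℝ) ≃ₗ[ℝ] E x) (h : M → GL (Fin n) ℝ) (x : M) :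
    (Fin n → ℝ) ≃ₗ[ℝ] E x :=
  (Matrix.toLin'OfInv (M := ((h x)⁻¹).1) (M' := (h x).1) (Units.inv_mul _)
    (Units.mul_inv _)).trans (u x)

theorem mulFrame_apply (u : ∀ x, (Fin n → ℝ) ≃ₗ[ℝ] E x) (h : M → GL (Fin n) ℝ) (x : M)
    (c : Fin n → ℝ) : mulFrame u h x c = u x ((h x : Matrix (Fin n) (Fin n) ℝ) *ᵥ c) := rfl

theorem IsLocalSection.mulFrame [ContMDiffVectorBundle ∞ (Fin n → ℝ) E 𝓘(ℝ, EM)]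
    {O : Set M} {u : ∀ x, (Fin n → ℝ) ≃ₗ[ℝ] E x}
    (hu : IsLocalSection (EM := EM) P.frames O u) {h : M → GL (Fin n) ℝ} {O' : Set M}
    (hO' : IsOpen O') (hO'O : O' ⊆ O) (hG : ∀ x ∈ O', h x ∈ G)
    (hs : ∀ x ∈ O', ∀ j, ContMDiffAt 𝓘(ℝ, EM) 𝓘(ℝ, Fin n → ℝ) ∞
      (fun x => (h x : Matrix (Fin n) (Fin n) ℝ) *ᵥ Pi.single j 1) x) :
    IsLocalSection (EM := EM) P.frames O' (mulFrame u h) where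
  isOpen := hO'
  mem x hx := (P.torsor x _ (hu.mem x (hO'O hx)) _).2 ⟨h x, hG x hx, mulFrame_apply u h x⟩
  smooth j x hx := (hu.contMDiffAt_apply (hO'O hx) (hs x hx j)).contMDiffWithinAt

/-- Each frame of `P` is a value of a local section of `P`. -/
theorem exists_localSection_eq [ContMDiffVectorBundle ∞ (Fin n → ℝ) E 𝓘(ℝ, EM)] {x : M}
    {u₀ : (Fin n → ℝ) ≃ₗ[ℝ] E x} (hu₀ : u₀ ∈ P.frames x) :
    ∃ O u, x ∈ O ∧ IsLocalSection (EM := EM) P.frames O u ∧ u x = u₀ := by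
  obtain ⟨O, u, hx, hu⟩ := P.exists_section x
  obtain ⟨g, hg, h⟩ := (P.torsor x _ (hu.mem x hx) _).1 hu₀
  refine ⟨O, mulFrame u fun _ => g, hx, hu.mulFrame hu.isOpen subset_rfl (fun _ _ => hg)
    fun _ _ _ => contMDiffAt_const, LinearEquiv.ext fun c => ?_⟩
  rw [mulFrame_apply, h]

end Frames

/-! ### Smooth maps into and out of the associated bundle -/

section Smooth

variable {n q : ℕ} {EM : Type*} [NormedAddCommGroup EM] [NormedSpace ℝ EM]
  {M : Type*} [TopologicalSpace M] [ChartedSpace EM M]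
  {E : M → Type*} [∀ x, AddCommGroup (E x)] [∀ x, Module ℝ (E x)]
  [TopologicalSpace (TotalSpace (Fin n → ℝ) E)] [∀ x, TopologicalSpace (E x)]
  [FiberBundle (Fin n → ℝ) E] [VectorBundle ℝ (Fin n → ℝ) E]
  {EF : Type*} [NormedAddCommGroup EF] [NormedSpace ℂ EF]
  {F : Type*} [TopologicalSpace F] [ChartedSpace EF F]
  {G : Subgroup (GL (Fin n) ℝ)}
  {P : FrameReduction (EM := EM) E G} {S : HomogeneousSubmanifold (EF := EF) F G q}
  [FiniteDimensional ℂ EF] [IsManifold 𝓘(ℝ, EF) ∞ F] [IsManifold 𝓘(ℝ, EM) ∞ M]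

/-- The local section of `P` which defines the chart of `P ×_G F` at `z`. -/
theorem exists_chartAt_eq (z : AssocBundle P S) : ∃ (O : Set M) (u : ∀ x, (Fin n → ℝ) ≃ₗ[ℝ] E x)
    (hu : IsLocalSection (EM := EM) P.frames O u), z.proj ∈ O ∧
    chartAt (ModelProd EM EF) z
      = homeoTriv P S hu ≫ₕ chartAt (ModelProd EM EF) (homeoTriv P S hu z) := by
  obtain ⟨O, u, hu, h⟩ := exists_eq_homeoTriv (chart_mem_atlas (M × F) z)
  refine ⟨O, u, hu, ?_, ?_⟩
  · have : z ∈ (homeoTriv P S hu).source := h ▸ mem_chart_source (M × F) z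
    exact this
  · rw [← h]
    rfl

/-- The chart at `z` is built from a trivialization `t₀` of its own. For `t₀` the claim is read off
from the chart, and any other trivialization differs from it by a smooth transition map. -/
theorem contMDiffAt_homeoTriv {O : Set M} {u : ∀ x, (Fin n → ℝ) ≃ₗ[ℝ] E x}
    (hu : IsLocalSection (EM := EM) P.frames O u) {z : AssocBundle P S} (hz : z.proj ∈ O) :
    ContMDiffAt (assocModel EM EF) (assocModel EM EF) ∞ (homeoTriv P S hu) z := by
  obtain ⟨O₀, u₀, hu₀, hz₀, hc⟩ := exists_chartAt_eq z
  let t := homeoTriv P S hu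
  let t₀ := homeoTriv P S hu₀
  let c := chartAt (ModelProd EM EF) (t₀ z)
  have hz₀' : z ∈ t₀.source := hz₀
  have h1 : ContMDiffAt (assocModel EM EF) (assocModel EM EF) ∞ (t₀ ≫ₕ c) z := by
    rw [← hc]
    exact contMDiffAt_of_mem_maximalAtlas (IsManifold.chart_mem_maximalAtlas z)
      (mem_chart_source _ z)
  have h2 : ContMDiffAt (assocModel EM EF) (assocModel EM EF) ∞ c.symm ((t₀ ≫ₕ c) z) :=
    contMDiffAt_symm_of_mem_maximalAtlas (IsManifold.chart_mem_maximalAtlas (t₀ z))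
      (c.map_source (mem_chart_source _ _))
  have h3 : ContMDiffAt (assocModel EM EF) (assocModel EM EF) ∞ t₀ z := by
    refine (ContMDiffAt.comp z h2 h1).congr_of_eventuallyEq ?_
    filter_upwards [(t₀ ≫ₕ c).open_source.mem_nhds
      (show z ∈ (t₀ ≫ₕ c).source from ⟨hz₀', mem_chart_source (ModelProd EM EF) (t₀ z)⟩)] with y hy
    exact (c.left_inv hy.2).symm
  have h4 : ContMDiffAt (assocModel EM EF) (assocModel EM EF) ∞ (t₀.symm ≫ₕ t) (t₀ z) :=
    (contMDiffOn_homeoTriv_change hu hu₀).contMDiffAt ((t₀.symm ≫ₕ t).open_source.mem_nhds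
      ⟨t₀.map_source hz₀', (show t₀.symm (t₀ z) ∈ t.source by rw [t₀.left_inv hz₀']; exact hz)⟩)
  refine (ContMDiffAt.comp z h4 h3).congr_of_eventuallyEq ?_
  filter_upwards [t₀.open_source.mem_nhds hz₀'] with y hy
  exact (congrArg t (t₀.left_inv hy)).symm

theorem contMDiffAt_homeoTriv_symm {O : Set M} {u : ∀ x, (Fin n → ℝ) ≃ₗ[ℝ] E x}
    (hu : IsLocalSection (EM := EM) P.frames O u) {y : M × F} (hy : y.1 ∈ O) :
    ContMDiffAt (assocModel EM EF) (assocModel EM EF) ∞ (homeoTriv P S hu).symm y := by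
  let t := homeoTriv P S hu
  have hyt : y ∈ t.target := ⟨hy, trivial⟩
  obtain ⟨O₀, u₀, hu₀, hz₀, hc⟩ := exists_chartAt_eq (t.symm y)
  let t₀ := homeoTriv P S hu₀
  let c := chartAt (ModelProd EM EF) (t₀ (t.symm y))
  have hz₀' : t.symm y ∈ t₀.source := hz₀
  have hz₁ : t.symm y ∈ (t₀ ≫ₕ c).source :=
    ⟨hz₀', mem_chart_source (ModelProd EM EF) (t₀ (t.symm y))⟩
  have h1 : ContMDiffAt (assocModel EM EF) (assocModel EM EF) ∞ (t₀ ≫ₕ c).symm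
      (c (t₀ (t.symm y))) := by
    refine contMDiffAt_symm_of_mem_maximalAtlas ?_ ((t₀ ≫ₕ c).map_source hz₁)
    rw [← hc]
    exact IsManifold.chart_mem_maximalAtlas _
  have h2 : ContMDiffAt (assocModel EM EF) (assocModel EM EF) ∞ c (t₀ (t.symm y)) :=
    contMDiffAt_of_mem_maximalAtlas (IsManifold.chart_mem_maximalAtlas _) (mem_chart_source _ _)
  have h4 : ContMDiffAt (assocModel EM EF) (assocModel EM EF) ∞ (t.symm ≫ₕ t₀) y :=
    (contMDiffOn_homeoTriv_change hu₀ hu).contMDiffAt ((t.symm ≫ₕ t₀).open_source.mem_nhds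
      ⟨hyt, hz₀'⟩)
  refine (ContMDiffAt.comp y h1 (ContMDiffAt.comp y h2 h4)).congr_of_eventuallyEq ?_
  filter_upwards [(t.symm ≫ₕ (t₀ ≫ₕ c)).open_source.mem_nhds
    (show y ∈ (t.symm ≫ₕ (t₀ ≫ₕ c)).source from ⟨hyt, hz₁⟩)] with y' hy'
  exact ((t₀ ≫ₕ c).left_inv hy'.2).symm

theorem contMDiffAt_coordF {O : Set M} {u : ∀ x, (Fin n → ℝ) ≃ₗ[ℝ] E x}
    (hu : IsLocalSection (EM := EM) P.frames O u) {z : AssocBundle P S} (hz : z.proj ∈ O) :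
    ContMDiffAt (assocModel EM EF) 𝓘(ℝ, EF) ∞ (coordF u) z :=
  ContMDiffAt.comp (g := (Prod.snd : M × F → F)) z contMDiffAt_snd (contMDiffAt_homeoTriv hu hz)

theorem contMDiffAt_totalSpace_proj (z : AssocBundle P S) :
    ContMDiffAt (assocModel EM EF) 𝓘(ℝ, EM) ∞ (fun z : AssocBundle P S => z.proj) z := by
  obtain ⟨O, u, hx, hu⟩ := P.exists_section z.proj
  exact ContMDiffAt.comp (g := (Prod.fst : M × F → M)) z contMDiffAt_fst
    (contMDiffAt_homeoTriv (S := S) hu hx)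

theorem contMDiffAt_sectionOf {O : Set M} {u : ∀ x, (Fin n → ℝ) ≃ₗ[ℝ] E x}
    (hu : IsLocalSection (EM := EM) P.frames O u) (f : F) {x : M} (hx : x ∈ O) :
    ContMDiffAt 𝓘(ℝ, EM) (assocModel EM EF) ∞ (sectionOf P S u f) x :=
  ContMDiffAt.comp x (contMDiffAt_homeoTriv_symm (S := S) hu (y := (x, f)) hx)
    (contMDiffAt_id.prodMk contMDiffAt_const)

/-- A single frame extends to a local section of the reduction, which presents the fibre inclusion
as an inverse trivialization restricted to one fibre. -/
theorem contMDiffAt_fibreInclusion [ContMDiffVectorBundle ∞ (Fin n → ℝ) E 𝓘(ℝ, EM)] {x : M}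
    {u : (Fin n → ℝ) ≃ₗ[ℝ] E x} (hu : u ∈ P.frames x) (f : F) :
    ContMDiffAt 𝓘(ℝ, EF) (assocModel EM EF) ∞ (fibreInclusion S hu) f := by
  obtain ⟨O, u', hx, hu', rfl⟩ := exists_localSection_eq hu
  refine (ContMDiffAt.comp f (contMDiffAt_homeoTriv_symm (S := S) hu' (y := (x, f)) hx)
    (contMDiffAt_const.prodMk contMDiffAt_id)).congr_of_eventuallyEq ?_
  refine Eventually.of_forall fun f' => ?_
  change fibreInclusion S hu f' = sectionOf P S u' f' x
  simp only [fibreInclusion, sectionOf, fibrePoint, someFrame_eq hu]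

/-- A tangent vector of `P ×_G F` is determined by its components in `M` and in `F`. -/
theorem tangent_ext {O : Set M} {u : ∀ x, (Fin n → ℝ) ≃ₗ[ℝ] E x}
    (hu : IsLocalSection (EM := EM) P.frames O u) {z : AssocBundle P S} (hz : z.proj ∈ O)
    {w w' : TangentSpace (assocModel EM EF) z}
    (h1 : mfderiv (assocModel EM EF) 𝓘(ℝ, EM) (fun z : AssocBundle P S => z.proj) z w
      = mfderiv (assocModel EM EF) 𝓘(ℝ, EM) (fun z : AssocBundle P S => z.proj) z w')
    (h2 : mfderiv (assocModel EM EF) 𝓘(ℝ, EF) (coordF u) z w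
      = mfderiv (assocModel EM EF) 𝓘(ℝ, EF) (coordF u) z w') : w = w' := by
  let t := homeoTriv P S hu
  have ht := (contMDiffAt_homeoTriv hu hz).mdifferentiableAt (by simp)
  have hts := (contMDiffAt_homeoTriv_symm (S := S) hu (y := t z) hz).mdifferentiableAt (by simp)
  have hinj : Function.Injective (mfderiv (assocModel EM EF) (assocModel EM EF) t z) := by
    -- The trivialization is a diffeomorphism near `z`, so its differential, whose components are
    -- those in `M` and in `F`, is injective.
    refine Function.LeftInverse.injective
      (g := mfderiv (assocModel EM EF) (assocModel EM EF) t.symm (t z)) fun w => ?_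
    have h3 := mfderiv_comp_apply z hts ht w
    rw [← h3]
    have h4 : t.symm ∘ t =ᶠ[𝓝 z] id := t.eventually_left_inverse hz
    rw [h4.mfderiv_eq, mfderiv_id]
    rfl
  refine hinj ?_
  have h5 : ∀ w, mfderiv (assocModel EM EF) (assocModel EM EF) t z w
      = (mfderiv (assocModel EM EF) 𝓘(ℝ, EM) (fun z : AssocBundle P S => z.proj) z w,
        mfderiv (assocModel EM EF) 𝓘(ℝ, EF) (coordF u) z w) := by
    intro w
    have h6 := mfderiv_prodMk ((contMDiffAt_totalSpace_proj z).mdifferentiableAt (by simp))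
      ((contMDiffAt_coordF hu hz).mdifferentiableAt (by simp))
    exact congrArg (fun L => L w) h6
  rw [h5, h5, h1, h2]

end Smooth

end IntRes
end

noncomputable section

namespace IntRes

/-! ### The chain rule -/

section Chain

variable {𝕜 : Type*} [NontriviallyNormedField 𝕜]
  {EN HN : Type*} [NormedAddCommGroup EN] [NormedSpace 𝕜 EN] [TopologicalSpace HN]
  {I : ModelWithCorners 𝕜 EN HN} {N : Type*} [TopologicalSpace N] [ChartedSpace HN N]
  {EN' HN' : Type*} [NormedAddCommGroup EN'] [NormedSpace 𝕜 EN'] [TopologicalSpace HN']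
  {I' : ModelWithCorners 𝕜 EN' HN'} {N' : Type*} [TopologicalSpace N'] [ChartedSpace HN' N']
  {EN'' HN'' : Type*} [NormedAddCommGroup EN''] [NormedSpace 𝕜 EN''] [TopologicalSpace HN'']
  {I'' : ModelWithCorners 𝕜 EN'' HN''} {N'' : Type*} [TopologicalSpace N''] [ChartedSpace HN'' N'']
  {V : Type*} [NormedAddCommGroup V] [NormedSpace 𝕜 V]

theorem mvfderiv_comp_vector {g : N' → V} {γ : N → N'} {x : N}
    (hg : MDifferentiableAt I' 𝓘(𝕜, V) g (γ x))
    (hγ : MDifferentiableAt I I' γ x) (v : TangentSpace I x) :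
    mvfderiv I (g ∘ γ) x v = mvfderiv I' g (γ x) (mfderiv I I' γ x v) :=
  mfderiv_comp_apply x hg hγ v

theorem mvfderiv_clm_comp {V' : Type*} [NormedAddCommGroup V'] [NormedSpace 𝕜 V'] (L : V →L[𝕜] V')
    {g : N → V} {x : N} (hg : MDifferentiableAt I 𝓘(𝕜, V) g x) (v : TangentSpace I x) :
    mvfderiv I (fun y => L (g y)) x v = L (mvfderiv I g x v) := by
  have h1 := HasMFDerivAt.comp x (L.hasFDerivAt (x := g x)).hasMFDerivAt hg.hasMFDerivAt
  exact h1.mvfderiv_apply v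

/-- An equality in the tangent bundle contains both the base point and the vector, so no vector has
to be transported from the tangent space at `γ x` to the one at `z`. -/
theorem mvfderiv_of_tangentMap {g : N' → V} {γ : N → N'} {x : N} {v : TangentSpace I x} {z : N'}
    {w : TangentSpace I' z} (h : tangentMap I I' γ ⟨x, v⟩ = ⟨z, w⟩)
    (hg : MDifferentiableAt I' 𝓘(𝕜, V) g z) (hγ : MDifferentiableAt I I' γ x) :
    mvfderiv I' g z w = mvfderiv I (g ∘ γ) x v := by
  cases h
  exact (mvfderiv_comp_vector hg hγ v).symm

theorem mfderiv_of_tangentMap {g : N' → N''} {γ : N → N'} {x : N} {v : TangentSpace I x} {z : N'}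
    {w : TangentSpace I' z} (h : tangentMap I I' γ ⟨x, v⟩ = ⟨z, w⟩)
    (hg : MDifferentiableAt I' I'' g z) (hγ : MDifferentiableAt I I' γ x) :
    (mfderiv I' I'' g z w : EN'') = mfderiv I I'' (g ∘ γ) x v := by
  cases h
  exact (mfderiv_comp_apply x hg hγ v).symm

theorem exists_tangentMap_eq {γ : N → N'} {x : N} (v : TangentSpace I x) {z : N'} (h : γ x = z) :
    ∃ w : TangentSpace I' z, tangentMap I I' γ ⟨x, v⟩ = ⟨z, w⟩ := by
  subst h
  exact ⟨_, rfl⟩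

end Chain

/-! ### Connection forms -/

section Connection

variable {n q : ℕ} {EM : Type*} [NormedAddCommGroup EM] [NormedSpace ℝ EM]
  {M : Type*} [TopologicalSpace M] [ChartedSpace EM M]
  {E : M → Type*} [∀ x, AddCommGroup (E x)] [∀ x, Module ℝ (E x)]
  [TopologicalSpace (TotalSpace (Fin n → ℝ) E)] [∀ x, TopologicalSpace (E x)]
  [∀ x, IsTopologicalAddGroup (E x)] [∀ x, ContinuousSMul ℝ (E x)]
  [FiberBundle (Fin n → ℝ) E]
  (cov : CovariantDerivative 𝓘(ℝ, EM) (Fin n → ℝ) E)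

/-- The matrix of the connection form with respect to the frames `u`. -/
def connMat (u : ∀ x, (Fin n → ℝ) ≃ₗ[ℝ] E x) (x : M) :
    TangentSpace 𝓘(ℝ, EM) x →ₗ[ℝ] Matrix (Fin n) (Fin n) ℝ where
  toFun v := Matrix.of fun i j => (u x).symm (cov (fun y => u y (Pi.single j 1)) x v) i
  map_add' v w := by ext i j; simp
  map_smul' r v := by ext i j; simp

/-- The connection form with respect to the frames `u`, with values in the endomorphisms of
`ℂⁿ`. -/
def connForm (u : ∀ x, (Fin n → ℝ) ≃ₗ[ℝ] E x) (x : M) : TangentSpace 𝓘(ℝ, EM) x →ₗ[ℝ] EndC n :=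
  (matC n).toLinearMap ∘ₗ connMat cov u x

/-- The components of `α` with respect to the frames `u`. -/
def alphaForm (α : ∀ x, TangentSpace 𝓘(ℝ, EM) x →L[ℝ] E x) (u : ∀ x, (Fin n → ℝ) ≃ₗ[ℝ] E x)
    (x : M) : TangentSpace 𝓘(ℝ, EM) x →ₗ[ℝ] (Fin n → ℂ) :=
  (toC n).toLinearMap ∘ₗ (u x).symm.toLinearMap ∘ₗ (α x).toLinearMap

theorem apply_connMat_single (u : ∀ x, (Fin n → ℝ) ≃ₗ[ℝ] E x) (x : M) (v : TangentSpace 𝓘(ℝ, EM) x)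
    (j : Fin n) : u x (connMat cov u x v *ᵥ Pi.single j 1)
      = cov (fun y => u y (Pi.single j 1)) x v := by
  rw [← (u x).apply_symm_apply (cov _ x v)]
  congr 1
  ext i
  simp [connMat]

theorem connMat_eq {u : ∀ x, (Fin n → ℝ) ≃ₗ[ℝ] E x} {x : M} {v : TangentSpace 𝓘(ℝ, EM) x}
    {A : Matrix (Fin n) (Fin n) ℝ}
    (h : ∀ j, cov (fun y => u y (Pi.single j 1)) x v = u x (A *ᵥ Pi.single j 1)) :
    connMat cov u x v = A := by
  ext i j
  simp [connMat, h]

variable [VectorBundle ℝ (Fin n → ℝ) E] [ContMDiffVectorBundle ∞ (Fin n → ℝ) E 𝓘(ℝ, EM)]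

/-- The covariant derivative of the section with components `c`. -/
theorem symm_cov_apply {fr : ∀ x, Set ((Fin n → ℝ) ≃ₗ[ℝ] E x)} {O : Set M}
    {u : ∀ x, (Fin n → ℝ) ≃ₗ[ℝ] E x} (hu : IsLocalSection (EM := EM) fr O u) {x : M} (hx : x ∈ O)
    {c : M → Fin n → ℝ} (hc : ContMDiffAt 𝓘(ℝ, EM) 𝓘(ℝ, Fin n → ℝ) ∞ c x)
    (v : TangentSpace 𝓘(ℝ, EM) x) :
    (u x).symm (cov (fun y => u y (c y)) x v)
      = mvfderiv 𝓘(ℝ, EM) c x v + connMat cov u x v *ᵥ c x := by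
  have hs : ∀ j, ContMDiffAt 𝓘(ℝ, EM) (𝓘(ℝ, EM).prod 𝓘(ℝ, Fin n → ℝ)) ∞
      (fun y => TotalSpace.mk' (Fin n → ℝ) y (u y (Pi.single j 1))) x := fun j =>
    (hu.smooth j).contMDiffAt (hu.isOpen.mem_nhds hx)
  have hcj := contMDiffAt_pi_space.1 hc
  -- Additivity of `cov` is available for differentiable sections only, so the sum is treated one
  -- term at a time, together with the Leibniz rule.
  have key : ∀ s : Finset (Fin n), cov (fun y => ∑ j ∈ s, c y j • u y (Pi.single j 1)) x v
      = ∑ j ∈ s, (c x j • u x (connMat cov u x v *ᵥ Pi.single j 1)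
        + mvfderiv 𝓘(ℝ, EM) (fun y => c y j) x v • u x (Pi.single j 1)) := by
    intro s
    induction s using Finset.induction_on with
    | empty =>
      have := congrFun cov.zero x
      simp only [Finset.sum_empty]
      exact congrArg (fun L => L v) this
    | insert j s hj ih =>
      rw [Finset.sum_insert hj, ← ih]
      have h1 : (fun y => ∑ j ∈ insert j s, c y j • u y (Pi.single j 1))
          = ((fun y => c y j) • fun y => u y (Pi.single j 1))
            + fun y => ∑ j ∈ s, c y j • u y (Pi.single j 1) := by
        funext y
        simp [Finset.sum_insert hj]
      have h2 := (ContMDiffAt.smul_section (hcj j) (hs j)).mdifferentiableAt (by simp)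
      have h3' : ∀ j ∈ s, ContMDiffAt 𝓘(ℝ, EM) (𝓘(ℝ, EM).prod 𝓘(ℝ, Fin n → ℝ)) ∞
          (fun y => TotalSpace.mk' (Fin n → ℝ) y (c y j • u y (Pi.single j 1))) x := fun j _ =>
        ContMDiffAt.smul_section (hcj j) (hs j)
      have h3 := (ContMDiffAt.sum_section h3').mdifferentiableAt (by simp)
      rw [h1, cov.isCovariantDerivativeOnUniv.add h2 h3,
        cov.isCovariantDerivativeOnUniv.leibniz ((hs j).mdifferentiableAt (by simp))
          ((hcj j).mdifferentiableAt (by simp)), apply_connMat_single]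
      rfl
  have h4 : (fun y => u y (c y)) = fun y => ∑ j, c y j • u y (Pi.single j 1) :=
    funext fun y => sum_frame (u y) (c y)
  have h5 : ∀ j, mvfderiv 𝓘(ℝ, EM) (fun y => c y j) x v = mvfderiv 𝓘(ℝ, EM) c x v j := by
    intro j
    exact mvfderiv_clm_comp (ContinuousLinearMap.proj (R := ℝ) (φ := fun _ : Fin n => ℝ) j)
      (hc.mdifferentiableAt (by simp)) v
  rw [LinearEquiv.symm_apply_eq, h4, key, Finset.sum_add_distrib, map_add, add_comm]
  simp only [h5]
  rw [← sum_frame]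
  congr 1
  conv_rhs => rw [pi_eq_sum_univ' (c x), Matrix.mulVec_sum, map_sum]
  simp only [Matrix.mulVec_smul, map_smul]

/-- The derivative of the matrices which transform a frame into a frame that is parallel in the
direction `v`. -/
theorem mvfderiv_transMat {fr fr' : ∀ x, Set ((Fin n → ℝ) ≃ₗ[ℝ] E x)} {O O' : Set M}
    {u u' : ∀ x, (Fin n → ℝ) ≃ₗ[ℝ] E x} (hu : IsLocalSection (EM := EM) fr O u)
    (hu' : IsLocalSection (EM := EM) fr' O' u') {x : M} (hx : x ∈ O) (hx' : x ∈ O')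
    {v : TangentSpace 𝓘(ℝ, EM) x} (hv : ∀ j, cov (fun y => u' y (Pi.single j 1)) x v = 0) :
    mvfderiv 𝓘(ℝ, EM) (fun y => matC n (transMat (u y) (u' y))) x v
      = -(connForm cov u x v * matC n (transMat (u x) (u' x))) := by
  have hg := (hu.contMDiffAt_transMat hu' hx hx').mdifferentiableAt (by simp)
  refine EndC_ext fun j => ?_
  have hc : ContMDiffAt 𝓘(ℝ, EM) 𝓘(ℝ, Fin n → ℝ) ∞
      (fun y => (u y).symm (u' y (Pi.single j 1))) x := hu.contMDiffAt_symm hx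
        ((hu'.smooth j).contMDiffAt (hu'.isOpen.mem_nhds hx'))
  -- For the `j`-th column `g_j` of the transition matrix, `∇_v u'_j = 0` reads `0 = dg_j(v) + θ(v)
  -- g_j`.
  have h1 := symm_cov_apply cov hu hx hc v
  simp only [LinearEquiv.apply_symm_apply, hv, map_zero] at h1
  have h2 : ∀ y, matC n (transMat (u y) (u' y)) (Pi.single j 1)
      = toC n ((u y).symm (u' y (Pi.single j 1))) := by
    intro y
    rw [← toC_single, matC_toC, transMat_mulVec (u y) (u' y), LinearEquiv.symm_apply_apply]
  have h3 := mfderiv_clm_apply hg (mdifferentiableAt_const (c := (Pi.single j 1 : Fin n → ℂ))) v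
  simp only [h2, mvfderiv_const, zero_apply, map_zero, add_zero] at h3
  rw [← h3, neg_apply, mul_apply_eq_comp, h2]
  have h4 : mvfderiv 𝓘(ℝ, EM) (fun y => toC n ((u y).symm (u' y (Pi.single j 1)))) x v
      = toC n (mvfderiv 𝓘(ℝ, EM) (fun y => (u y).symm (u' y (Pi.single j 1))) x v) :=
    mvfderiv_clm_comp (toC n) (hc.mdifferentiableAt (by simp)) v
  rw [h4, eq_neg_of_add_eq_zero_left h1.symm, map_neg]
  congr 1
  exact (matC_toC _ _).symm

end Connection
end IntRes
end

noncomputable section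

namespace IntRes

/-! ### One-parameter subgroups -/

section Exp

variable {n : ℕ}

attribute [local instance] Matrix.linftyOpNormedRing Matrix.linftyOpNormedAlgebra in
theorem contDiff_exp_mulVec (A : Matrix (Fin n) (Fin n) ℝ) (c : Fin n → ℝ) :
    ContDiff ℝ ∞ fun t : ℝ => NormedSpace.exp (t • A) *ᵥ c := by
  have h1 : ContDiff ℝ ∞ fun t : ℝ => NormedSpace.exp (t • A) :=
    contDiff_iff_contDiffAt.2 fun t =>
      (NormedSpace.exp_analytic (𝕂 := ℝ) (t • A)).contDiffAt.comp t
        (contDiff_id.smul contDiff_const).contDiffAt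
  let L : Matrix (Fin n) (Fin n) ℝ →ₗ[ℝ] (Fin n → ℝ) := (Matrix.mulVecBilin ℝ ℝ).flip c
  exact (LinearMap.toContinuousLinearMap L).contDiff.comp h1

attribute [local instance] Matrix.linftyOpNormedRing Matrix.linftyOpNormedAlgebra in
theorem hasDerivAt_exp_mulVec (A : Matrix (Fin n) (Fin n) ℝ) (c : Fin n → ℝ) :
    HasDerivAt (fun t : ℝ => NormedSpace.exp (t • A) *ᵥ c) (A *ᵥ c) 0 := by
  have h1 := hasDerivAt_exp_smul_const (𝕂 := ℝ) A 0
  rw [zero_smul, NormedSpace.exp_zero, one_mul] at h1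
  let L : Matrix (Fin n) (Fin n) ℝ →ₗ[ℝ] (Fin n → ℝ) := (Matrix.mulVecBilin ℝ ℝ).flip c
  exact (LinearMap.toContinuousLinearMap L).hasFDerivAt.comp_hasDerivAt 0 h1

end Exp

/-! ### Horizontal and vertical parts of tangent vectors, and the distribution -/

section Distribution

variable {n q : ℕ} {EM : Type*} [NormedAddCommGroup EM] [NormedSpace ℝ EM]
  {M : Type*} [TopologicalSpace M] [ChartedSpace EM M]
  {E : M → Type*} [∀ x, AddCommGroup (E x)] [∀ x, Module ℝ (E x)]
  [TopologicalSpace (TotalSpace (Fin n → ℝ) E)] [∀ x, TopologicalSpace (E x)]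
  [∀ x, IsTopologicalAddGroup (E x)] [∀ x, ContinuousSMul ℝ (E x)]
  [FiberBundle (Fin n → ℝ) E] [VectorBundle ℝ (Fin n → ℝ) E]
  [ContMDiffVectorBundle ∞ (Fin n → ℝ) E 𝓘(ℝ, EM)]
  {EF : Type*} [NormedAddCommGroup EF] [NormedSpace ℂ EF]
  {F : Type*} [TopologicalSpace F] [ChartedSpace EF F]
  {G : Subgroup (GL (Fin n) ℝ)}
  {P : FrameReduction (EM := EM) E G} {S : HomogeneousSubmanifold (EF := EF) F G q}
  [FiniteDimensional ℂ EF] [IsManifold 𝓘(ℝ, EF) ∞ F] [IsManifold 𝓘(ℝ, EM) ∞ M]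
  (cov : CovariantDerivative 𝓘(ℝ, EM) (Fin n → ℝ) E)

theorem EndC_smul_mul (r : ℂ) (A B : EndC n) : (r • A) * B = r • (A * B) := rfl

theorem EndC_mul_smul (r : ℂ) (A B : EndC n) : A * (r • B) = r • (A * B) := by
  ext1 c
  exact map_smul A r (B c)

theorem I_smul_I_smul {V : Type*} [AddCommGroup V] [Module ℂ V] (v : V) :
    Complex.I • Complex.I • v = -v := by
  rw [smul_smul, Complex.I_mul_I, neg_smul, one_smul]

/-- The differential of `P ×_G F → M`. -/
def tproj (z : AssocBundle P S) : TangentSpace (assocModel EM EF) z →L[ℝ]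
    TangentSpace 𝓘(ℝ, EM) z.proj :=
  mfderiv (assocModel EM EF) 𝓘(ℝ, EM) (fun z : AssocBundle P S => z.proj) z

/-- The orthogonal projection onto a point of `P ×_G F`, in the frame `u`. -/
def projField (u : ∀ x, (Fin n → ℝ) ≃ₗ[ℝ] E x) (z : AssocBundle P S) : EndC n :=
  orthProj (S.toSub (coordF u z))

theorem projField_mul_self (u : ∀ x, (Fin n → ℝ) ≃ₗ[ℝ] E x) (z : AssocBundle P S) :
    projField u z * projField u z = projField u z := orthProj_mul_self _

theorem contMDiffAt_projField {O : Set M} {u : ∀ x, (Fin n → ℝ) ≃ₗ[ℝ] E x}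
    (hu : IsLocalSection (EM := EM) P.frames O u) {z : AssocBundle P S} (hz : z.proj ∈ O) :
    ContMDiffAt (assocModel EM EF) 𝓘(ℝ, EndC n) ∞ (projField u) z :=
  ContMDiffAt.comp z (g := fun f => orthProj (S.toSub f)) (S.immersion.contMDiff_orthProj _)
    (contMDiffAt_coordF hu hz)

/-- The vertical part of a tangent vector of `P ×_G F`, as a homomorphism from the subspace to its
orthogonal complement. -/
def vertPart (u : ∀ x, (Fin n → ℝ) ≃ₗ[ℝ] E x) (z : AssocBundle P S) :
    TangentSpace (assocModel EM EF) z →ₗ[ℝ] EndC n where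
  toFun w := mvfderiv (assocModel EM EF) (projField u) z w * projField u z
    + (1 - projField u z) * connForm cov u z.proj (tproj z w) * projField u z
  map_add' v w := by simp only [map_add, add_mul, mul_add]; abel
  map_smul' r w := by
    have h1 : ∀ A B : EndC n, (r • A) * B = r • (A * B) := fun _ _ => rfl
    have h2 : ∀ A B : EndC n, A * (r • B) = r • (A * B) := fun A B => by
      ext1 c
      exact A.toLinearMap.map_smul_of_tower r (B c)
    simp only [map_smul, h1, h2, smul_add, RingHom.id_apply]

variable {cov}

theorem tproj_of_tangentMap_sectionOf {O : Set M} {u : ∀ x, (Fin n → ℝ) ≃ₗ[ℝ] E x}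
    (hu : IsLocalSection (EM := EM) P.frames O u) {z : AssocBundle P S} (hz : z.proj ∈ O) {f : F}
    {v : TangentSpace 𝓘(ℝ, EM) z.proj} {w : TangentSpace (assocModel EM EF) z}
    (h : tangentMap 𝓘(ℝ, EM) (assocModel EM EF) (sectionOf P S u f) ⟨z.proj, v⟩ = ⟨z, w⟩) :
    tproj z w = v := by
  refine (mfderiv_of_tangentMap h ((contMDiffAt_totalSpace_proj z).mdifferentiableAt (by simp))
    ((contMDiffAt_sectionOf hu f hz).mdifferentiableAt (by simp))).trans ?_
  change mfderiv 𝓘(ℝ, EM) 𝓘(ℝ, EM) id z.proj v = v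
  rw [mfderiv_id]
  rfl

/-- In the frame `u`, the section `[u', f]` is the family of subspaces `g(y) f`, where `dg(v) =
-θ(v) g` because `u'` is parallel in the direction `v`. The change of these subspaces along `v` is
therefore the one prescribed by `-θ(v)`, and the two terms of the vertical part cancel. -/
theorem vertPart_of_tangentMap_sectionOf {O O' : Set M} {u u' : ∀ x, (Fin n → ℝ) ≃ₗ[ℝ] E x}
    (hu : IsLocalSection (EM := EM) P.frames O u) (hu' : IsLocalSection (EM := EM) P.frames O' u')
    {z : AssocBundle P S} (hz : z.proj ∈ O) (hz' : z.proj ∈ O') {f : F}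
    {v : TangentSpace 𝓘(ℝ, EM) z.proj} (hv : ∀ j, cov (fun y => u' y (Pi.single j 1)) z.proj v = 0)
    {w : TangentSpace (assocModel EM EF) z}
    (h : tangentMap 𝓘(ℝ, EM) (assocModel EM EF) (sectionOf P S u' f) ⟨z.proj, v⟩ = ⟨z, w⟩) :
    vertPart cov u z w = 0 := by
  have hzf : sectionOf P S u' f z.proj = z := congrArg TotalSpace.proj h
  have hd := mvfderiv_of_tangentMap h ((contMDiffAt_projField hu hz).mdifferentiableAt (by simp))
    ((contMDiffAt_sectionOf hu' f hz').mdifferentiableAt (by simp))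
  have htr := mvfderiv_transMat cov hu hu' hz hz' hv
  set g : M → EndC n := fun y => matC n (transMat (u y) (u' y)) with hg
  have hgd : MDifferentiableAt 𝓘(ℝ, EM) 𝓘(ℝ, EndC n) g z.proj :=
    (hu.contMDiffAt_transMat hu' hz hz').mdifferentiableAt (by simp)
  have hmap : ∀ y ∈ O ∩ O', S.toSub (coordF u (sectionOf P S u' f y))
      = (S.toSub f).map (g y).toLinearMap := fun y hy =>
    toSub_coordF_sectionOf (hu.mem y hy.1) (hu'.mem y hy.2) f
  have hint : ∀ y ∈ O ∩ O', projField u (sectionOf P S u' f y) * (g y * orthProj (S.toSub f))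
      = g y * orthProj (S.toSub f) := by
    intro y hy
    ext1 c
    refine orthProj_apply_eq_iff.2 ?_
    rw [hmap y hy]
    exact ⟨_, orthProj_apply_mem _ c, rfl⟩
  have hp : MDifferentiableAt 𝓘(ℝ, EM) 𝓘(ℝ, EndC n)
      (fun y => projField u (sectionOf P S u' f y)) z.proj := by
    refine ContMDiffAt.mdifferentiableAt (n := ∞) ?_ (by simp)
    refine ContMDiffAt.comp z.proj (g := projField u) ?_ (contMDiffAt_sectionOf hu' f hz')
    rw [hzf]
    exact contMDiffAt_projField hu hz
  have key := mfderiv_mul_of_intertwine (p := fun _ : M => orthProj (S.toSub f))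
    mdifferentiableAt_const hp hgd (orthProj_mul_self _)
    (Filter.eventually_of_mem ((hu.isOpen.inter hu'.isOpen).mem_nhds ⟨hz, hz'⟩) hint) v
  rw [show (projField u ∘ sectionOf P S u' f) = fun y => projField u (sectionOf P S u' f y)
    from rfl] at hd
  rw [← hd, mvfderiv_const, htr, hzf] at key
  simp only [zero_apply, zero_mul, mul_zero, add_zero] at key
  have hint' := hint z.proj ⟨hz, hz'⟩
  rw [hzf] at hint'
  -- `mfderiv_mul_of_intertwine` with constant `p` turns `dp(w) g p_f` into `-(1 - p) θ(v) g p_f`,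
  -- so the vertical part vanishes on the range of `g p_f`.
  have hK : vertPart cov u z w * (g z.proj * orthProj (S.toSub f)) = 0 := by
    change (mvfderiv (assocModel EM EF) (projField u) z w * projField u z
      + (1 - projField u z) * connForm cov u z.proj (tproj z w) * projField u z) * _ = 0
    rw [tproj_of_tangentMap_sectionOf hu' hz' h, add_mul, mul_assoc, mul_assoc, hint', key]
    simp only [hg, mul_assoc, neg_mul, mul_neg]
    exact neg_add_cancel _
  -- The vertical part sees only the range of `p`, which is the range of `g p_f`, so it vanishes
  -- altogether.
  have hKp : vertPart cov u z w = vertPart cov u z w * projField u z := by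
    change _ = (mvfderiv (assocModel EM EF) (projField u) z w * projField u z
      + (1 - projField u z) * connForm cov u z.proj (tproj z w) * projField u z) * _
    rw [add_mul, mul_assoc, mul_assoc _ (projField u z) (projField u z), projField_mul_self]
    rfl
  rw [hKp]
  ext1 c
  have hc : projField u z c ∈ (S.toSub f).map (g z.proj).toLinearMap := by
    rw [← hmap _ ⟨hz, hz'⟩, hzf]
    exact orthProj_apply_mem _ c
  obtain ⟨d, hd', hdc⟩ := hc
  have hdc' : g z.proj (orthProj (S.toSub f) d) = projField u z c := by
    rw [orthProj_apply_eq_iff.2 hd']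
    exact hdc
  have := congrArg (fun L : EndC n => L d) hK
  rw [mul_apply_eq_comp, ← hdc']
  exact this

theorem vertPart_horizontal {O : Set M} {u : ∀ x, (Fin n → ℝ) ≃ₗ[ℝ] E x}
    (hu : IsLocalSection (EM := EM) P.frames O u) {z : AssocBundle P S} (hz : z.proj ∈ O)
    {w : TangentSpace (assocModel EM EF) z} (hw : w ∈ horizontal cov z) :
    vertPart cov u z w = 0 := by
  have : horizontal cov z ≤ LinearMap.ker (vertPart cov u z) := by
    refine Submodule.span_le.2 ?_
    rintro w ⟨O', u', f, v, hu', hz', hv, h⟩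
    exact vertPart_of_tangentMap_sectionOf hu hu' hz hz' hv h
  exact this hw

/-- Tangent vectors of `M` have horizontal lifts. -/
theorem exists_horizontal_lift (hP : P.IsPreservedBy cov) (z : AssocBundle P S)
    (v : TangentSpace 𝓘(ℝ, EM) z.proj) : ∃ w ∈ horizontal cov z, tproj z w = v := by
  obtain ⟨O, u, hz, hu⟩ := P.exists_section z.proj
  -- A section `u'` of the reduction which is parallel in the direction `v` moves `z` horizontally.
  -- It is sought in the form `u exp(φ A)`, where `A` is the value of the connection form on `v`.
  suffices H : ∃ O' u', z.proj ∈ O' ∧ IsLocalSection (EM := EM) P.frames O' u' ∧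
      ∀ j, cov (fun y => u' y (Pi.single j 1)) z.proj v = 0 by
    obtain ⟨O', u', hz', hu', hv⟩ := H
    obtain ⟨w, hw⟩ := exists_tangentMap_eq (I := 𝓘(ℝ, EM)) (I' := assocModel EM EF) v
      (sectionOf_coordF (S := S) u' z)
    exact ⟨w, Submodule.subset_span ⟨O', u', _, v, hu', hz', hv, hw⟩,
      tproj_of_tangentMap_sectionOf hu' hz' hw⟩
  -- Only for `v ≠ 0` is there a function `φ` with `dφ(v) = -1`; for `v = 0` every section is
  -- parallel.
  by_cases hv0 : v = 0
  · exact ⟨O, u, hz, hu, fun j => by rw [hv0, map_zero]⟩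
  have : IsManifold 𝓘(ℝ, EM) 1 M := IsManifold.of_le (n := ∞) (by simp)
  let D : TangentSpace 𝓘(ℝ, EM) z.proj →L[ℝ] EM :=
    mvfderiv 𝓘(ℝ, EM) (extChartAt 𝓘(ℝ, EM) z.proj) z.proj
  have hDv : D v ≠ 0 := by
    intro h
    obtain ⟨e, he⟩ := isInvertible_mfderiv_extChartAt (I := 𝓘(ℝ, EM))
      (mem_extChartAt_source (I := 𝓘(ℝ, EM)) z.proj)
    refine hv0 (e.injective ?_)
    rw [map_zero]
    refine Eq.trans ?_ h
    exact congrArg (fun L => L v) he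
  obtain ⟨l, hl⟩ := SeparatingDual.exists_eq_one (R := ℝ) hDv
  -- The function vanishes at the point and has derivative `-1` along `v`, so that the derivative
  -- `-A` of `exp(φ A)` cancels the connection matrix `A`.
  let φ : M → ℝ := fun y =>
    l (extChartAt 𝓘(ℝ, EM) z.proj z.proj) - l (extChartAt 𝓘(ℝ, EM) z.proj y)
  have hφ0 : φ z.proj = 0 := sub_self _
  let O' := O ∩ (chartAt EM z.proj).source
  have hO' : IsOpen O' := hu.isOpen.inter (chartAt EM z.proj).open_source
  have hext : ∀ y ∈ O', ContMDiffAt 𝓘(ℝ, EM) 𝓘(ℝ, EM) ∞ (extChartAt 𝓘(ℝ, EM) z.proj) y :=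
    fun y hy => contMDiffAt_extChartAt' hy.2
  have hφ : ∀ y ∈ O', ContMDiffAt 𝓘(ℝ, EM) 𝓘(ℝ, ℝ) ∞ φ y := fun y hy =>
    contMDiffAt_const.sub (l.contDiff.contMDiff.contMDiffAt.comp y (hext y hy))
  have hz' : z.proj ∈ O' := ⟨hz, mem_chart_source _ _⟩
  have hdφ : mvfderiv 𝓘(ℝ, EM) φ z.proj v = -1 := by
    have h1 := (hext _ hz').mdifferentiableAt (by simp)
    have h2 := mvfderiv_clm_comp l h1 v
    have h3 : MDifferentiableAt 𝓘(ℝ, EM) 𝓘(ℝ, ℝ) (fun y => l (extChartAt 𝓘(ℝ, EM) z.proj y))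
      z.proj := (l.contDiff.contMDiff.contMDiffAt.comp _ (hext _ hz')).mdifferentiableAt
        (n := ∞) (by simp)
    have h4 := mvfderiv_sub (mdifferentiableAt_const
      (c := l (extChartAt 𝓘(ℝ, EM) z.proj z.proj))) h3
    have h5 := congrArg (fun L => L v) h4
    refine h5.trans ?_
    rw [sub_apply, mvfderiv_const, h2]
    simp [← hl, D]
  -- Because `∇` is reducible, `A` lies in the Lie algebra of `G`. Its exponentials belong to `G`,
  -- and the new frames to the reduction.
  obtain ⟨A, hA, hAv⟩ := hP O u hu z.proj hz v
  choose γ hγ hγA using hA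
  let h : M → GL (Fin n) ℝ := fun y => γ (φ y)
  have hcol : ∀ j y, (h y : Matrix (Fin n) (Fin n) ℝ) *ᵥ Pi.single j 1
      = NormedSpace.exp (φ y • A) *ᵥ Pi.single j 1 := fun j y => by rw [hγA]
  have hsm : ∀ y ∈ O', ∀ j, ContMDiffAt 𝓘(ℝ, EM) 𝓘(ℝ, Fin n → ℝ) ∞
      (fun x => (h x : Matrix (Fin n) (Fin n) ℝ) *ᵥ Pi.single j 1) y := by
    intro y hy j
    simp only [hcol]
    exact (contDiff_exp_mulVec A (Pi.single j 1)).contMDiff.contMDiffAt.comp y (hφ y hy)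
  refine ⟨O', mulFrame u h, hz', hu.mulFrame hO' inter_subset_left (fun y _ => hγ _) hsm,
    fun j => ?_⟩
  have h1 := symm_cov_apply cov hu hz (hsm _ hz' j) v
  rw [connMat_eq cov hAv, hcol, hφ0, zero_smul, NormedSpace.exp_zero, Matrix.one_mulVec] at h1
  have h2 : mvfderiv 𝓘(ℝ, EM) (fun x => (h x : Matrix (Fin n) (Fin n) ℝ) *ᵥ Pi.single j 1)
      z.proj v = -(A *ᵥ Pi.single j 1) := by
    simp only [hcol]
    have h3 : HasFDerivAt (𝕜 := ℝ) (fun t : ℝ => NormedSpace.exp (t • A) *ᵥ Pi.single j (1 : ℝ))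
      (ContinuousLinearMap.toSpanSingleton ℝ (A *ᵥ Pi.single j 1)) (φ z.proj) := by
        rw [hφ0]
        exact (hasDerivAt_exp_mulVec A (Pi.single j 1)).hasFDerivAt
    have h4 := HasMFDerivAt.comp z.proj h3.hasMFDerivAt
      ((hφ _ hz').mdifferentiableAt (by simp)).hasMFDerivAt
    refine (h4.mvfderiv_apply v).trans ?_
    change mvfderiv 𝓘(ℝ, EM) φ z.proj v • (A *ᵥ Pi.single j 1) = _
    rw [hdφ, neg_one_smul]
  rw [h2, neg_add_cancel] at h1
  exact (u z.proj).symm.map_eq_zero_iff.1 h1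

/-! ### The distribution in a local trivialization -/

theorem tproj_of_tangentMap_fibreInclusion {z : AssocBundle P S} {u : (Fin n → ℝ) ≃ₗ[ℝ] E z.proj}
    (hu : u ∈ P.frames z.proj) {f : F} {ξ : EF} {w : TangentSpace (assocModel EM EF) z}
    (h : tangentMap 𝓘(ℝ, EF) (assocModel EM EF) (fibreInclusion S hu) ⟨f, ξ⟩ = ⟨z, w⟩) :
    tproj z w = 0 := by
  refine (mfderiv_of_tangentMap h ((contMDiffAt_totalSpace_proj z).mdifferentiableAt (by simp))
    ((contMDiffAt_fibreInclusion hu f).mdifferentiableAt (by simp))).trans ?_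
  change mfderiv 𝓘(ℝ, EF) 𝓘(ℝ, EM) (fun _ => z.proj) f ξ = 0
  rw [mfderiv_const]
  rfl

theorem mvfderiv_coordF {O : Set M} {u : ∀ x, (Fin n → ℝ) ≃ₗ[ℝ] E x}
    (hu : IsLocalSection (EM := EM) P.frames O u) {z : AssocBundle P S} (hz : z.proj ∈ O)
    (w : TangentSpace (assocModel EM EF) z) :
    mvfderiv (assocModel EM EF) (projField u) z w = mvfderiv 𝓘(ℝ, EF)
      (fun f => orthProj (S.toSub f)) (coordF u z)
        (mfderiv (assocModel EM EF) 𝓘(ℝ, EF) (coordF u) z w) :=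
  mvfderiv_comp_vector (g := fun f => orthProj (S.toSub f))
    ((S.immersion.contMDiff_orthProj _).mdifferentiableAt (by simp))
    ((contMDiffAt_coordF hu hz).mdifferentiableAt (by simp)) w

/-- The differentials of the projections along the fibres are complex linear. -/
theorem vertPart_of_tangentMap_fibreInclusion {O : Set M} {u : ∀ x, (Fin n → ℝ) ≃ₗ[ℝ] E x}
    (hu : IsLocalSection (EM := EM) P.frames O u) {z : AssocBundle P S} (hz : z.proj ∈ O)
    {u₀ : (Fin n → ℝ) ≃ₗ[ℝ] E z.proj} (hu₀ : u₀ ∈ P.frames z.proj) {f : F} {ξ : EF}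
    {w w' : TangentSpace (assocModel EM EF) z}
    (h : tangentMap 𝓘(ℝ, EF) (assocModel EM EF) (fibreInclusion S hu₀) ⟨f, ξ⟩ = ⟨z, w⟩)
    (h' : tangentMap 𝓘(ℝ, EF) (assocModel EM EF) (fibreInclusion S hu₀) ⟨f, Complex.I • ξ⟩
      = ⟨z, w'⟩) :
    vertPart cov u z w' = Complex.I • vertPart cov u z w := by
  have hzf : fibreInclusion S hu₀ f = z := congrArg TotalSpace.proj h
  have hfi := (contMDiffAt_fibreInclusion (S := S) hu₀ f).mdifferentiableAt (n := ∞) (by simp)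
  have hpf := (contMDiffAt_projField hu hz).mdifferentiableAt (n := ∞) (by simp)
  have hd := mvfderiv_of_tangentMap h hpf hfi
  have hd' := mvfderiv_of_tangentMap h' hpf hfi
  obtain ⟨O', u', hz', hu', rfl⟩ := exists_localSection_eq hu₀
  let g : EndC n := matC n (transMat (u z.proj) (u' z.proj))
  have hmap : ∀ y, S.toSub (coordF u (fibreInclusion S hu₀ y)) = (S.toSub y).map g.toLinearMap := by
    intro y
    have h1 := toSub_coordF_sectionOf (S := S) (hu.mem _ hz) hu₀ y
    have h2 : sectionOf P S u' y z.proj = fibreInclusion S hu₀ y := by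
      simp only [fibreInclusion, sectionOf, fibrePoint, someFrame_eq hu₀]
    rwa [h2] at h1
  have hint : ∀ y, projField u (fibreInclusion S hu₀ y) * (g * orthProj (S.toSub y))
      = g * orthProj (S.toSub y) := by
    intro y
    ext1 c
    refine orthProj_apply_eq_iff.2 ?_
    rw [hmap y]
    exact ⟨_, orthProj_apply_mem _ c, rfl⟩
  have hp : MDifferentiableAt 𝓘(ℝ, EF) 𝓘(ℝ, EndC n)
      (fun y => projField u (fibreInclusion S hu₀ y)) f := by
    refine MDifferentiableAt.comp f (g := projField u) ?_ hfi
    rw [hzf]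
    exact hpf
  -- Along one fibre, the change of frame `g` is constant and complex linear, so the complex
  -- linearity of `dp p` on `F` carries over to the frame `u`.
  have key := mfderiv_mul_of_intertwine (p := fun y => orthProj (S.toSub y)) (g := fun _ => g)
    ((S.immersion.contMDiff_orthProj f).mdifferentiableAt (by simp)) hp mdifferentiableAt_const
    (orthProj_mul_self _) (Eventually.of_forall hint)
  simp only [mvfderiv_const, zero_apply, zero_mul, zero_add] at key
  have hK : ∀ w, tproj z w = 0 → vertPart cov u z w
      = mvfderiv (assocModel EM EF) (projField u) z w * projField u z := by
    intro w hw
    change mvfderiv (assocModel EM EF) (projField u) z w * projField u z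
      + (1 - projField u z) * connForm cov u z.proj (tproj z w) * projField u z = _
    rw [hw, map_zero, mul_zero, zero_mul, add_zero]
  rw [hK w (tproj_of_tangentMap_fibreInclusion hu₀ h),
    hK w' (tproj_of_tangentMap_fibreInclusion hu₀ h'), hd, hd']
  have hI := S.immersion.mfderiv_orthProj_I_smul f ξ
  have key' : mvfderiv 𝓘(ℝ, EF) (projField u ∘ fibreInclusion S hu₀) f (Complex.I • ξ : EF)
        * (g * orthProj (S.toSub f))
      = Complex.I • mvfderiv 𝓘(ℝ, EF) (projField u ∘ fibreInclusion S hu₀) f ξ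
        * (g * orthProj (S.toSub f)) := by
    have k1 := key (Complex.I • ξ : EF)
    have k2 := key ξ
    rw [hI] at k1
    refine k1.trans ?_
    rw [EndC_smul_mul]
    refine Eq.trans ?_ (congrArg (fun L => Complex.I • L) k2).symm
    simp only [EndC_mul_smul]
  ext1 c
  have hc : projField u z c ∈ (S.toSub f).map g.toLinearMap := by
    rw [← hmap, hzf]
    exact orthProj_apply_mem _ c
  obtain ⟨d, hd1, hdc⟩ := hc
  have hdc' : g (orthProj (S.toSub f) d) = projField u z c := by
    rw [orthProj_apply_eq_iff.2 hd1]
    exact hdc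
  have := congrArg (fun L : EndC n => L d) key'
  rw [smul_apply, mul_apply_eq_comp, mul_apply_eq_comp, ← hdc']
  exact this

variable (cov) in
/-- The complex linear extension of the vertical part. -/
def vertPartC (u : ∀ x, (Fin n → ℝ) ≃ₗ[ℝ] E x) (z : AssocBundle P S) :
    ℂ ⊗[ℝ] TangentSpace (assocModel EM EF) z →ₗ[ℂ] EndC n :=
  (vertPart cov u z).liftBaseChange ℂ

theorem liftBaseChange_cplx {V W : Type*} [AddCommGroup V] [Module ℝ V] [AddCommGroup W]
    [Module ℝ W] [Module ℂ W] [IsScalarTower ℝ ℂ W] (L : V →ₗ[ℝ] W) (v w : V) :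
    L.liftBaseChange ℂ (cplx v w) = L v + Complex.I • L w := by
  simp [cplx]

theorem baseChange_cplx {V W : Type*} [AddCommGroup V] [Module ℝ V] [AddCommGroup W]
    [Module ℝ W] (L : V →ₗ[ℝ] W) (v w : V) :
    L.baseChange ℂ (cplx v w) = cplx (L v) (L w) := by
  simp [cplx]

theorem mem_alphaInv_iff (α : ∀ x, TangentSpace 𝓘(ℝ, EM) x →L[ℝ] E x)
    {u : ∀ x, (Fin n → ℝ) ≃ₗ[ℝ] E x} {z : AssocBundle P S}
    (hu : u z.proj ∈ P.frames z.proj) (v w : TangentSpace 𝓘(ℝ, EM) z.proj) :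
    cplx v w ∈ alphaInv α z ↔ projField u z (alphaForm α u z.proj v
      + Complex.I • alphaForm α u z.proj w)
        = alphaForm α u z.proj v + Complex.I • alphaForm α u z.proj w := by
  rw [projField, ← mem_sub_iff hu]
  change (α z.proj).toLinearMap.baseChange ℂ (cplx v w) ∈ z.sub ↔ _
  rw [baseChange_cplx]
  refine Eq.to_iff (congrArg (· ∈ z.sub) ?_)
  have h := cFrame_cplx (u z.proj) ((u z.proj).symm (α z.proj v)) ((u z.proj).symm (α z.proj w))
  rw [LinearEquiv.apply_symm_apply, LinearEquiv.apply_symm_apply] at h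
  exact h.symm

theorem mfderiv_coordF_of_tangentMap_fibreInclusion {O : Set M} {u : ∀ x, (Fin n → ℝ) ≃ₗ[ℝ] E x}
    (hu : IsLocalSection (EM := EM) P.frames O u) {z : AssocBundle P S} (hz : z.proj ∈ O) {f : F}
    {ξ : EF} {w : TangentSpace (assocModel EM EF) z}
    (h : tangentMap 𝓘(ℝ, EF) (assocModel EM EF) (fibreInclusion S (hu.mem _ hz)) ⟨f, ξ⟩
      = ⟨z, w⟩) : (mfderiv (assocModel EM EF) 𝓘(ℝ, EF) (coordF u) z w : EF) = ξ := by
  refine (mfderiv_of_tangentMap h ((contMDiffAt_coordF hu hz).mdifferentiableAt (by simp))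
    ((contMDiffAt_fibreInclusion (hu.mem _ hz) f).mdifferentiableAt (by simp))).trans ?_
  have h1 : coordF u ∘ fibreInclusion S (hu.mem _ hz) = id := by
    funext f
    have h2 : sectionOf P S u f z.proj = fibreInclusion S (hu.mem _ hz) f := by
      simp only [fibreInclusion, sectionOf, fibrePoint, someFrame_eq (hu.mem _ hz)]
    rw [Function.comp_apply, ← h2, coordF_sectionOf]
    rfl
  rw [h1, mfderiv_id]
  rfl

/-- For a vertical vector with component `η` in `F`, the vertical part is the differential of the
inclusion into the Grassmannian at `η`. As this is complex linear and injective, the hypothesis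
becomes `η₁ + i η₂ = 0`, that is, `w₂ = J w₁`, and `w₁ + i J w₁` is of type `(0,1)`. -/
theorem cplx_mem_verticalZeroOne {O : Set M} {u : ∀ x, (Fin n → ℝ) ≃ₗ[ℝ] E x}
    (hu : IsLocalSection (EM := EM) P.frames O u) {z : AssocBundle P S} (hz : z.proj ∈ O)
    {w₁ w₂ : TangentSpace (assocModel EM EF) z} (h₁ : tproj z w₁ = 0) (h₂ : tproj z w₂ = 0)
    (h : vertPart cov u z w₁ + Complex.I • vertPart cov u z w₂ = 0) :
    cplx w₁ w₂ ∈ verticalZeroOne z := by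
  let D : EF →L[ℝ] EndC n := mvfderiv 𝓘(ℝ, EF) (fun f => orthProj (S.toSub f)) (coordF u z)
  let η : TangentSpace (assocModel EM EF) z → EF := fun w =>
    mfderiv (assocModel EM EF) 𝓘(ℝ, EF) (coordF u) z w
  have hK : ∀ w, tproj z w = 0 → vertPart cov u z w = D (η w) * projField u z := by
    intro w hw
    change mvfderiv (assocModel EM EF) (projField u) z w * projField u z
      + (1 - projField u z) * connForm cov u z.proj (tproj z w) * projField u z = _
    rw [hw, map_zero, mul_zero, zero_mul, add_zero, mvfderiv_coordF hu hz]
    rfl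
  rw [hK _ h₁, hK _ h₂] at h
  have hI : D (Complex.I • η w₂) * projField u z = Complex.I • (D (η w₂) * projField u z) :=
    S.immersion.mfderiv_orthProj_I_smul (coordF u z) (η w₂)
  have h0 : η w₁ + Complex.I • η w₂ = 0 := by
    refine S.immersion.mfderiv_orthProj_injective (coordF u z) ?_
    change D (η w₁ + Complex.I • η w₂) * projField u z = 0
    rw [map_add, add_mul, hI, h]
  have hη : Complex.I • η w₁ = η w₂ := by
    rw [eq_neg_of_add_eq_zero_left h0, smul_neg, I_smul_I_smul, neg_neg]
  have hz' : fibreInclusion S (hu.mem _ hz) (coordF u z) = z := by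
    have h2 : sectionOf P S u (coordF u z) z.proj
        = fibreInclusion S (hu.mem _ hz) (coordF u z) := by
      simp only [fibreInclusion, sectionOf, fibrePoint, someFrame_eq (hu.mem _ hz)]
    rw [← h2, sectionOf_coordF]
  have hgen : ∀ w, tproj z w = 0 → tangentMap 𝓘(ℝ, EF) (assocModel EM EF)
      (fibreInclusion S (hu.mem _ hz)) ⟨coordF u z, η w⟩ = ⟨z, w⟩ := by
    intro w hw
    obtain ⟨w', hw'⟩ := exists_tangentMap_eq (I := 𝓘(ℝ, EF)) (I' := assocModel EM EF) (η w) hz'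
    rw [hw']
    congr 1
    exact tangent_ext hu hz ((tproj_of_tangentMap_fibreInclusion _ hw').trans hw.symm)
      (mfderiv_coordF_of_tangentMap_fibreInclusion hu hz hw')
  refine Submodule.subset_span ⟨u z.proj, hu.mem _ hz, coordF u z, η w₁, w₁, w₂, hgen _ h₁, ?_, rfl⟩
  rw [hη]
  exact hgen _ h₂

/-- Both summands are killed by the complex vertical part: horizontal vectors have none, and on `w +
i J w` complex linearity gives `s(w) + i i s(w) = 0`. Conversely, after subtraction of horizontal
lifts of the real and imaginary parts of the projection, the remainder is vertical and
`cplx_mem_verticalZeroOne` applies. -/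
theorem mem_twistorDistribution_iff (α : ∀ x, TangentSpace 𝓘(ℝ, EM) x →L[ℝ] E x)
    (hP : P.IsPreservedBy cov) {O : Set M} {u : ∀ x, (Fin n → ℝ) ≃ₗ[ℝ] E x}
    (hu : IsLocalSection (EM := EM) P.frames O u) {z : AssocBundle P S} (hz : z.proj ∈ O)
    (w₁ w₂ : TangentSpace (assocModel EM EF) z) :
    cplx w₁ w₂ ∈ twistorDistribution α cov z ↔
      cplx (tproj z w₁) (tproj z w₂) ∈ alphaInv α z ∧
        vertPart cov u z w₁ + Complex.I • vertPart cov u z w₂ = 0 := by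
  have hdProj : ∀ w w', dProj z (cplx w w') = cplx (tproj z w) (tproj z w') := fun w w' =>
    baseChange_cplx _ w w'
  have hvert : verticalZeroOne z ≤ LinearMap.ker (dProj z) ⊓ LinearMap.ker (vertPartC cov u z) := by
    refine Submodule.span_le.2 ?_
    rintro c ⟨u₀, hu₀, f, ξ, w, w', h, h', rfl⟩
    refine ⟨?_, ?_⟩
    · change dProj z _ = 0
      rw [hdProj, tproj_of_tangentMap_fibreInclusion hu₀ h,
        tproj_of_tangentMap_fibreInclusion hu₀ h']
      simp [cplx]
    · change (vertPart cov u z).liftBaseChange ℂ _ = 0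
      rw [liftBaseChange_cplx, vertPart_of_tangentMap_fibreInclusion hu hz hu₀ h h']
      exact (congrArg _ (I_smul_I_smul _)).trans (add_neg_cancel _)
  have hhor : (horizontal cov z).baseChange ℂ ≤ LinearMap.ker (vertPartC cov u z) := by
    rw [Submodule.baseChange_eq_span]
    refine Submodule.span_le.2 ?_
    rintro _ ⟨w, hw, rfl⟩
    change (vertPart cov u z).liftBaseChange ℂ (1 ⊗ₜ w) = 0
    rw [LinearMap.liftBaseChange_one_tmul, vertPart_horizontal hu hz hw]
  rw [← hdProj, ← liftBaseChange_cplx]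
  constructor
  · intro h
    have h1 : twistorDistribution α cov z
        ≤ (alphaInv α z).comap (dProj z) ⊓ LinearMap.ker (vertPartC cov u z) := by
      refine sup_le (le_inf inf_le_right (inf_le_left.trans hhor)) (le_inf (fun c hc => ?_)
        (hvert.trans inf_le_right))
      change dProj z c ∈ alphaInv α z
      rw [show dProj z c = 0 from (hvert hc).1]
      exact zero_mem _
    exact h1 h
  · rintro ⟨h1, h2⟩
    obtain ⟨v₁, hv₁, hv₁'⟩ := exists_horizontal_lift hP z (tproj z w₁)
    obtain ⟨v₂, hv₂, hv₂'⟩ := exists_horizontal_lift hP z (tproj z w₂)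
    have hsplit : cplx w₁ w₂ = cplx v₁ v₂ + cplx (w₁ - v₁) (w₂ - v₂) := by
      simp only [cplx, TensorProduct.tmul_sub]
      abel
    rw [hsplit]
    refine Submodule.add_mem_sup ⟨?_, ?_⟩ ?_
    · exact add_mem (Submodule.tmul_mem_baseChange_of_mem _ hv₁)
        (Submodule.tmul_mem_baseChange_of_mem _ hv₂)
    · change dProj z _ ∈ alphaInv α z
      rw [hdProj, hv₁', hv₂', ← hdProj]
      exact h1
    · have hv : vertPart cov u z (w₁ - v₁) + Complex.I • vertPart cov u z (w₂ - v₂) = 0 := by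
        rw [map_sub, map_sub, vertPart_horizontal hu hz hv₁, vertPart_horizontal hu hz hv₂,
          sub_zero, sub_zero, ← liftBaseChange_cplx]
        exact h2
      refine cplx_mem_verticalZeroOne hu hz ?_ ?_ hv
      · rw [map_sub, hv₁', sub_self]
      · rw [map_sub, hv₂', sub_self]

end Distribution
end IntRes
end

noncomputable section

namespace IntRes

/-! ### Vector fields in a chart -/

section Chart

variable {EN HN : Type*} [NormedAddCommGroup EN] [NormedSpace ℝ EN] [TopologicalSpace HN]
  {I : ModelWithCorners ℝ EN HN} {N : Type*} [TopologicalSpace N] [ChartedSpace HN N]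
  [IsManifold I ∞ N]

variable (I) in
/-- The differential at `z` of the chart at `z₀`. -/
def chartD (z₀ z : N) : TangentSpace I z →L[ℝ] EN := mfderiv I 𝓘(ℝ, EN) (extChartAt I z₀) z

variable (I) in
/-- The inverse of the differential at `z` of the chart at `z₀`. -/
def chartDInv (z₀ z : N) : EN →L[ℝ] TangentSpace I z :=
  (trivializationAt EN (TangentSpace I) z₀).symmL ℝ z

variable {z₀ z : N}

theorem continuousLinearMapAt_eq_chartD (hz : z ∈ (chartAt HN z₀).source) :
    (trivializationAt EN (TangentSpace I) z₀).continuousLinearMapAt ℝ z = chartD I z₀ z :=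
  TangentBundle.continuousLinearMapAt_trivializationAt hz

theorem chartD_chartDInv (hz : z ∈ (chartAt HN z₀).source) (v : EN) :
    chartD I z₀ z (chartDInv I z₀ z v) = v := by
  rw [← continuousLinearMapAt_eq_chartD hz]
  exact (trivializationAt EN (TangentSpace I) z₀).continuousLinearMapAt_symmL (R := ℝ) hz v

theorem chartDInv_chartD (hz : z ∈ (chartAt HN z₀).source) (w : TangentSpace I z) :
    chartDInv I z₀ z (chartD I z₀ z w) = w := by
  rw [← continuousLinearMapAt_eq_chartD hz]
  exact (trivializationAt EN (TangentSpace I) z₀).symmL_continuousLinearMapAt (R := ℝ) hz w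

theorem chartD_self (w : TangentSpace I z₀) : chartD I z₀ z₀ w = w := by
  rw [chartD, mfderiv_extChartAt_self]
  rfl

theorem chartDInv_self (v : EN) : chartDInv I z₀ z₀ v = v := by
  have h := chartD_chartDInv (I := I) (mem_chart_source HN z₀) v
  rwa [chartD_self] at h

theorem mvfderiv_eq_fderiv_chart [I.Boundaryless] {V : Type*} [NormedAddCommGroup V]
    [NormedSpace ℝ V] {h : N → V} (hz : z ∈ (chartAt HN z₀).source)
    (hh : ContMDiffAt I 𝓘(ℝ, V) ∞ h z) :
    ContDiffAt ℝ ∞ (h ∘ (extChartAt I z₀).symm) (extChartAt I z₀ z) ∧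
    ∀ w, mvfderiv I h z w
      = fderiv ℝ (h ∘ (extChartAt I z₀).symm) (extChartAt I z₀ z) (chartD I z₀ z w) := by
  have hz' : z ∈ (extChartAt I z₀).source := by rwa [extChartAt_source]
  have hsymm : ContMDiffAt 𝓘(ℝ, EN) I ∞ (extChartAt I z₀).symm (extChartAt I z₀ z) :=
    (contMDiffOn_extChartAt_symm z₀).contMDiffAt
      (extChartAt_target_mem_nhds' ((extChartAt I z₀).map_source hz'))
  have h1 : ContMDiffAt 𝓘(ℝ, EN) 𝓘(ℝ, V) ∞ (h ∘ (extChartAt I z₀).symm) (extChartAt I z₀ z) := by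
    refine ContMDiffAt.comp _ ?_ hsymm
    rwa [(extChartAt I z₀).left_inv hz']
  refine ⟨h1.contDiffAt, fun w => ?_⟩
  have h2 : h =ᶠ[𝓝 z] (h ∘ (extChartAt I z₀).symm) ∘ extChartAt I z₀ := by
    filter_upwards [extChartAt_source_mem_nhds' hz'] with y hy
    rw [Function.comp_apply, Function.comp_apply, (extChartAt I z₀).left_inv hy]
  rw [h2.mvfderiv_eq, mvfderiv_comp_vector (h1.mdifferentiableAt (by simp))
    ((contMDiffAt_extChartAt' hz).mdifferentiableAt (n := ∞) (by simp))]
  rw [mvfderiv, mfderiv_eq_fderiv]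
  rfl

variable (I) in
/-- The components of a vector field in the chart at `z₀`. -/
def chartField (z₀ : N) (X : ∀ z : N, TangentSpace I z) (y : EN) : EN :=
  chartD I z₀ ((extChartAt I z₀).symm y) (X ((extChartAt I z₀).symm y))

variable (I) in
/-- The vector field with given components in the chart at `z₀`. -/
def ofChartField (z₀ : N) (ξ : EN → EN) (z : N) : TangentSpace I z :=
  chartDInv I z₀ z (ξ (extChartAt I z₀ z))

theorem chartD_ofChartField (hz : z ∈ (chartAt HN z₀).source) (ξ : EN → EN) :
    chartD I z₀ z (ofChartField I z₀ ξ z) = ξ (extChartAt I z₀ z) := chartD_chartDInv hz _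

theorem chartField_ofChartField {y : EN} (hy : y ∈ (extChartAt I z₀).target) (ξ : EN → EN) :
    chartField I z₀ (ofChartField I z₀ ξ) y = ξ y := by
  have h := (extChartAt I z₀).map_target hy
  rw [extChartAt_source] at h
  rw [chartField, chartD_ofChartField h, (extChartAt I z₀).right_inv hy]

theorem IsSmoothVectorFieldOn.contDiffAt_chartField [I.Boundaryless]
    {X : ∀ z : N, TangentSpace I z} {O : Set N}
    (hX : IsSmoothVectorFieldOn I X O) (hz₀ : z₀ ∈ O) :
    ContDiffAt ℝ ∞ (chartField I z₀ X) (extChartAt I z₀ z₀) :=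
  (mvfderiv_eq_fderiv_chart (mem_chart_source HN z₀) (hX z₀ hz₀)).1

theorem isSmoothVectorFieldOn_ofChartField {ξ : EN → EN} {U : Set EN} (hU : IsOpen U)
    (hξ : ContDiffOn ℝ ∞ ξ U) : IsSmoothVectorFieldOn I (ofChartField I z₀ ξ)
      ((extChartAt I z₀).source ∩ extChartAt I z₀ ⁻¹' U) := by
  have hO : IsOpen ((extChartAt I z₀).source ∩ extChartAt I z₀ ⁻¹' U) :=
    isOpen_extChartAt_preimage' z₀ hU
  rw [isSmoothVectorFieldOn_iff I _ hO]
  have hsub : (extChartAt I z₀).source ∩ extChartAt I z₀ ⁻¹' U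
      ⊆ (trivializationAt EN (TangentSpace I) z₀).baseSet := by
    rw [extChartAt_source]
    exact inter_subset_left
  rw [(trivializationAt EN (TangentSpace I) z₀).contMDiffOn_section_iff hO hsub]
  refine ContMDiffOn.congr (f := fun z => ξ (extChartAt I z₀ z)) ?_ fun z hz => ?_
  · refine ContMDiffOn.comp (t := U) hξ.contMDiffOn ?_ fun z hz => hz.2
    refine (contMDiffOn_extChartAt (I := I) (x := z₀)).mono fun z hz => ?_
    have := hz.1
    rwa [extChartAt_source] at this
  · have h1 := chartD_ofChartField (I := I) (hsub hz) ξ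
    rw [← continuousLinearMapAt_eq_chartD (hsub hz)] at h1
    refine Eq.trans ?_ h1
    exact (congrFun (Bundle.Trivialization.coe_linearMapAt_of_mem
      (R := ℝ) (trivializationAt EN (TangentSpace I) z₀) (hsub hz)) _).symm

/-- The bracket on a manifold is computed after pull-back by the inverse chart, and the inverse of
the differential of that map is the differential of the chart. At the centre `z₀` this differential
is the identity, so no correction appears. -/
theorem mlieBracket_eq_lieBracket_chartField [I.Boundaryless] [CompleteSpace EN]
    (X Y : ∀ z : N, TangentSpace I z) :
    (VectorField.mlieBracket I X Y z₀ : EN)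
      = VectorField.lieBracket ℝ (chartField I z₀ X) (chartField I z₀ Y) (extChartAt I z₀ z₀) := by
  have key : ∀ X : ∀ z : N, TangentSpace I z,
      VectorField.mpullbackWithin 𝓘(ℝ, EN) I (extChartAt I z₀).symm X (range I)
        =ᶠ[𝓝 (extChartAt I z₀ z₀)] chartField I z₀ X := by
    intro X
    filter_upwards [extChartAt_target_mem_nhds (I := I) z₀] with y hy
    rw [VectorField.mpullbackWithin_apply, chartField, chartD]
    have h1 := mfderiv_extChartAt_comp_mfderivWithin_extChartAt_symm (I := I) hy
    have h2 := isInvertible_mfderivWithin_extChartAt_symm (I := I) hy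
    obtain ⟨e, he⟩ := h2
    rw [← he] at h1 ⊢
    rw [ContinuousLinearMap.inverse_equiv]
    have h3 := congrArg (fun L => L (e.symm (X ((extChartAt I z₀).symm y)))) h1
    refine h3.symm.trans ?_
    exact congrArg (fun v => mfderiv I 𝓘(ℝ, EN) (extChartAt I z₀) _ v) (e.apply_symm_apply _)
  rw [← VectorField.mlieBracketWithin_univ, VectorField.mlieBracketWithin_apply,
    mfderiv_extChartAt_self]
  refine (congrArg (fun L : EN →L[ℝ] EN => L _) ContinuousLinearMap.inverse_id).trans ?_
  have hset : (extChartAt I z₀).symm ⁻¹' univ ∩ range I = univ := by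
    rw [I.range_eq_univ, preimage_univ, inter_univ]
  have gen : ∀ (A B : EN → EN) (S : Set EN) (y : EN), S = univ →
      VectorField.lieBracketWithin ℝ A B S y = VectorField.lieBracket ℝ A B y := by
    rintro A B S y rfl
    rw [VectorField.lieBracketWithin_univ]
  exact (gen _ _ _ _ hset).trans ((key X).lieBracket_vectorField_eq (key Y))

end Chart

end IntRes
end

noncomputable section

namespace IntRes

/-! ### Connections in a chart of the base and a local frame -/

section Coordinates

variable {n q : ℕ} {EM : Type*} [NormedAddCommGroup EM] [NormedSpace ℝ EM]
  [FiniteDimensional ℝ EM]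
  {M : Type*} [TopologicalSpace M] [ChartedSpace EM M] [IsManifold 𝓘(ℝ, EM) ∞ M]
  {E : M → Type*} [∀ x, AddCommGroup (E x)] [∀ x, Module ℝ (E x)]
  [TopologicalSpace (TotalSpace (Fin n → ℝ) E)] [∀ x, TopologicalSpace (E x)]
  [∀ x, IsTopologicalAddGroup (E x)] [∀ x, ContinuousSMul ℝ (E x)]
  [FiberBundle (Fin n → ℝ) E] [VectorBundle ℝ (Fin n → ℝ) E]
  [ContMDiffVectorBundle ∞ (Fin n → ℝ) E 𝓘(ℝ, EM)]

/-! ### Constant vector fields -/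

section Const

variable {B V : Type*} [NormedAddCommGroup B] [NormedSpace ℝ B]
  [NormedAddCommGroup V] [NormedSpace ℂ V] [NormedSpace ℝ V] [IsScalarTower ℝ ℂ V]
  {a : B → B →L[ℝ] V} {θ : B → B →L[ℝ] V →L[ℂ] V} {y : B}

theorem lieBracket_const_const (v w : B) :
    VectorField.lieBracket ℝ (fun _ : B => v) (fun _ : B => w) y = 0 := by
  simp [VectorField.lieBracket]

theorem flatCov_torsion_const (ha : DifferentiableAt ℝ a y) (v w : B) :
    flatCov θ (fun y => a y w) y v - flatCov θ (fun y => a y v) y w = flatTorsion a θ y v w := by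
  have h := flatCov_torsion (θ := θ) (X := fun _ => v) (Y := fun _ => w) ha
    (differentiableAt_const _) (differentiableAt_const _)
  rwa [lieBracket_const_const, map_zero, add_zero] at h

theorem flatCov_curvature_const {σ : B → V} (hθ : DifferentiableAt ℝ θ y)
    (hσ : ContDiffAt ℝ 2 σ y) (v w : B) :
    flatCov θ (fun y => flatCov θ σ y w) y v - flatCov θ (fun y => flatCov θ σ y v) y w
      = flatCurvature θ y v w (σ y) := by
  have h := flatCov_curvature (X := fun _ => v) (Y := fun _ => w) hθ
    (differentiableAt_const _) (differentiableAt_const _) hσ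
  have h0 : flatCov θ σ y 0 = 0 := by rw [flatCov, map_zero, map_zero, zero_apply, add_zero]
  rwa [lieBracket_const_const, h0, zero_add] at h

theorem flatCov_congr {σ τ : B → V} (h : σ =ᶠ[𝓝 y] τ) (v : B) :
    flatCov θ σ y v = flatCov θ τ y v := by
  rw [flatCov, flatCov, h.fderiv_eq, h.eq_of_nhds]

end Const

/-- Covariant derivatives of sections which are smooth near a point are smooth at that point. -/
theorem contMDiffAt_cov [T2Space M] {cov : CovariantDerivative 𝓘(ℝ, EM) (Fin n → ℝ) E}
    (hcov : CovariantDerivative.ContMDiffCovariantDerivative cov ∞) {σ : ∀ x, E x} {O : Set M}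
    (hO : IsOpen O) (hσ : ContMDiffOn 𝓘(ℝ, EM) (𝓘(ℝ, EM).prod 𝓘(ℝ, Fin n → ℝ)) ∞
      (fun x => TotalSpace.mk' (Fin n → ℝ) x (σ x)) O) {x : M} (hx : x ∈ O) :
    ContMDiffAt 𝓘(ℝ, EM) (𝓘(ℝ, EM).prod 𝓘(ℝ, EM →L[ℝ] (Fin n → ℝ))) ∞
      (fun x => TotalSpace.mk' (EM →L[ℝ] (Fin n → ℝ))
        (E := fun x => TangentSpace 𝓘(ℝ, EM) x →L[ℝ] E x) x (cov σ x)) x := by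
  -- The smoothness of `cov` is applied to a section that is smooth on all of `M`. A bump function
  -- supported in `O` provides one which agrees with `σ` near `x`, and hence has the same covariant
  -- derivatives there.
  obtain ⟨f, -, hf⟩ := (SmoothBumpFunction.nhds_basis_tsupport (I := 𝓘(ℝ, EM)) x).mem_iff.1
    (hO.mem_nhds hx)
  have h1 : ContMDiff 𝓘(ℝ, EM) (𝓘(ℝ, EM).prod 𝓘(ℝ, Fin n → ℝ)) ∞
      (fun x => TotalSpace.mk' (Fin n → ℝ) x (((f : M → ℝ) • σ) x)) :=
    ContMDiffOn.smul_section_of_tsupport (f.contMDiff.contMDiffOn) hO hf hσ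
  have h2 := (hcov.contMDiff.contMDiff (σ := (f : M → ℝ) • σ) h1.contMDiffOn).contMDiffAt
    (x := x) univ_mem
  refine h2.congr_of_eventuallyEq ?_
  filter_upwards [hO.mem_nhds hx, f.eventuallyEq_one.eventually_nhds] with y hy hfy
  have h3 := cov.isCovariantDerivativeOnUniv.congr_of_eventuallyEq
    (((hσ y hy).contMDiffAt (hO.mem_nhds hy)).mdifferentiableAt (by simp))
    ((h1 y).mdifferentiableAt (by simp)) univ_mem
    (hfy.mono fun z hz => show σ z = f z • σ z by rw [hz]; simp)
  exact congrArg (fun L => TotalSpace.mk' (EM →L[ℝ] (Fin n → ℝ))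
        (E := fun x => TangentSpace 𝓘(ℝ, EM) x →L[ℝ] E x) y L) h3

/-- The components of a section in the frames `u`, as a function on the chart at `x₀`. -/
def secCoord (u : ∀ x, (Fin n → ℝ) ≃ₗ[ℝ] E x) (x₀ : M) (σ : ∀ x, E x) (y : EM) : Fin n → ℂ :=
  toC n ((u ((extChartAt 𝓘(ℝ, EM) x₀).symm y)).symm (σ ((extChartAt 𝓘(ℝ, EM) x₀).symm y)))

/-- The form `α` in the frames `u` and the chart at `x₀`. -/
def alphaCoord (α : ∀ x, TangentSpace 𝓘(ℝ, EM) x →L[ℝ] E x) (u : ∀ x, (Fin n → ℝ) ≃ₗ[ℝ] E x)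
    (x₀ : M) (y : EM) : EM →L[ℝ] (Fin n → ℂ) :=
  LinearMap.toContinuousLinearMap (alphaForm α u ((extChartAt 𝓘(ℝ, EM) x₀).symm y) ∘ₗ
    (chartDInv 𝓘(ℝ, EM) x₀ ((extChartAt 𝓘(ℝ, EM) x₀).symm y)).toLinearMap)

/-- The connection form in the frames `u` and the chart at `x₀`. -/
def connCoord (cov : CovariantDerivative 𝓘(ℝ, EM) (Fin n → ℝ) E)
    (u : ∀ x, (Fin n → ℝ) ≃ₗ[ℝ] E x) (x₀ : M) (y : EM) : EM →L[ℝ] EndC n :=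
  LinearMap.toContinuousLinearMap (connForm cov u ((extChartAt 𝓘(ℝ, EM) x₀).symm y) ∘ₗ
    (chartDInv 𝓘(ℝ, EM) x₀ ((extChartAt 𝓘(ℝ, EM) x₀).symm y)).toLinearMap)

variable {cov : CovariantDerivative 𝓘(ℝ, EM) (Fin n → ℝ) E}
  {α : ∀ x, TangentSpace 𝓘(ℝ, EM) x →L[ℝ] E x}
  {fr : ∀ x, Set ((Fin n → ℝ) ≃ₗ[ℝ] E x)} {O : Set M} {u : ∀ x, (Fin n → ℝ) ≃ₗ[ℝ] E x} {x₀ x : M}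

theorem alphaCoord_chartD (hx : x ∈ (chartAt EM x₀).source) (v : TangentSpace 𝓘(ℝ, EM) x) :
    alphaCoord α u x₀ (extChartAt 𝓘(ℝ, EM) x₀ x) (chartD 𝓘(ℝ, EM) x₀ x v) = alphaForm α u x v := by
  have hx' : x ∈ (extChartAt 𝓘(ℝ, EM) x₀).source := by rwa [extChartAt_source]
  change alphaForm α u ((extChartAt 𝓘(ℝ, EM) x₀).symm (extChartAt 𝓘(ℝ, EM) x₀ x))
    (chartDInv 𝓘(ℝ, EM) x₀ ((extChartAt 𝓘(ℝ, EM) x₀).symm (extChartAt 𝓘(ℝ, EM) x₀ x))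
      (chartD 𝓘(ℝ, EM) x₀ x v)) = _
  rw [(extChartAt 𝓘(ℝ, EM) x₀).left_inv hx', chartDInv_chartD hx]

theorem connCoord_chartD (hx : x ∈ (chartAt EM x₀).source) (v : TangentSpace 𝓘(ℝ, EM) x) :
    connCoord cov u x₀ (extChartAt 𝓘(ℝ, EM) x₀ x) (chartD 𝓘(ℝ, EM) x₀ x v)
      = connForm cov u x v := by
  have hx' : x ∈ (extChartAt 𝓘(ℝ, EM) x₀).source := by rwa [extChartAt_source]
  change connForm cov u ((extChartAt 𝓘(ℝ, EM) x₀).symm (extChartAt 𝓘(ℝ, EM) x₀ x))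
    (chartDInv 𝓘(ℝ, EM) x₀ ((extChartAt 𝓘(ℝ, EM) x₀).symm (extChartAt 𝓘(ℝ, EM) x₀ x))
      (chartD 𝓘(ℝ, EM) x₀ x v)) = _
  rw [(extChartAt 𝓘(ℝ, EM) x₀).left_inv hx', chartDInv_chartD hx]

theorem contDiffAt_secCoord (hu : IsLocalSection (EM := EM) fr O u) (hx : x ∈ O)
    (hx₀ : x ∈ (chartAt EM x₀).source) {σ : ∀ x, E x}
    (hσ : ContMDiffAt 𝓘(ℝ, EM) (𝓘(ℝ, EM).prod 𝓘(ℝ, Fin n → ℝ)) ∞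
      (fun y => TotalSpace.mk' (Fin n → ℝ) y (σ y)) x) :
    ContDiffAt ℝ ∞ (secCoord u x₀ σ) (extChartAt 𝓘(ℝ, EM) x₀ x) :=
  (mvfderiv_eq_fderiv_chart hx₀ ((toC n).contDiff.contMDiff.contMDiffAt.comp x
    (hu.contMDiffAt_symm hx hσ))).1

/-- The covariant derivative in a chart and a local frame. -/
theorem toC_symm_cov (hu : IsLocalSection (EM := EM) fr O u) (hx : x ∈ O)
    (hx₀ : x ∈ (chartAt EM x₀).source) {σ : ∀ x, E x}
    (hσ : ContMDiffAt 𝓘(ℝ, EM) (𝓘(ℝ, EM).prod 𝓘(ℝ, Fin n → ℝ)) ∞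
      (fun y => TotalSpace.mk' (Fin n → ℝ) y (σ y)) x) (v : TangentSpace 𝓘(ℝ, EM) x) :
    toC n ((u x).symm (cov σ x v)) = flatCov (connCoord cov u x₀) (secCoord u x₀ σ)
      (extChartAt 𝓘(ℝ, EM) x₀ x) (chartD 𝓘(ℝ, EM) x₀ x v) := by
  have hx' : x ∈ (extChartAt 𝓘(ℝ, EM) x₀).source := by rwa [extChartAt_source]
  have hc := hu.contMDiffAt_symm hx hσ
  have h1 := symm_cov_apply cov hu hx hc v
  simp only [LinearEquiv.apply_symm_apply] at h1
  rw [h1, map_add, flatCov, connCoord_chartD hx₀]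
  congr 1
  · rw [← mvfderiv_clm_comp (toC n) (hc.mdifferentiableAt (by simp)) v]
    exact (mvfderiv_eq_fderiv_chart hx₀ ((toC n).contDiff.contMDiff.contMDiffAt.comp x hc)).2 v
  · rw [secCoord, (extChartAt 𝓘(ℝ, EM) x₀).left_inv hx']
    exact (matC_toC _ _).symm

theorem contMDiffAt_ofChartField_const (hx₀ : x ∈ (chartAt EM x₀).source) (v : EM) :
    ContMDiffAt 𝓘(ℝ, EM) 𝓘(ℝ, EM).tangent ∞ (fun y =>
      (⟨y, ofChartField 𝓘(ℝ, EM) x₀ (fun _ => v) y⟩ : TangentBundle 𝓘(ℝ, EM) M)) x := by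
  have h1 := isSmoothVectorFieldOn_ofChartField (I := 𝓘(ℝ, EM)) (z₀ := x₀) isOpen_univ
    (contDiffOn_const (c := v))
  have hO := isOpen_extChartAt_preimage' (I := 𝓘(ℝ, EM)) x₀ isOpen_univ
  refine ((isSmoothVectorFieldOn_iff _ _ hO).1 h1).contMDiffAt (hO.mem_nhds ⟨?_, trivial⟩)
  rwa [extChartAt_source]

theorem contMDiffAt_alphaForm (hα : ContMDiff 𝓘(ℝ, EM) (𝓘(ℝ, EM).prod 𝓘(ℝ, EM →L[ℝ] (Fin n → ℝ))) ∞
      (fun x => TotalSpace.mk' (EM →L[ℝ] (Fin n → ℝ))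
        (E := fun x => TangentSpace 𝓘(ℝ, EM) x →L[ℝ] E x) x (α x)))
    (hx₀ : x ∈ (chartAt EM x₀).source) (v : EM) :
    ContMDiffAt 𝓘(ℝ, EM) (𝓘(ℝ, EM).prod 𝓘(ℝ, Fin n → ℝ)) ∞ (fun y =>
      TotalSpace.mk' (Fin n → ℝ) y (α y (ofChartField 𝓘(ℝ, EM) x₀ (fun _ => v) y))) x :=
  ContMDiffAt.clm_bundle_apply (hα x) (contMDiffAt_ofChartField_const hx₀ v)

/-- As `EM` has finite dimension, smoothness of an operator-valued function can be tested on single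
vectors. The test is made on an open set, so it is assumed at all points of `O` in the chart. -/
theorem contDiffAt_of_forall_mem_chart {V : Type*} [NormedAddCommGroup V] [NormedSpace ℝ V]
    (hO : IsOpen O) {A : EM → EM →L[ℝ] V}
    (h : ∀ x ∈ O, x ∈ (chartAt EM x₀).source → ∀ v,
      ContDiffAt ℝ ∞ (fun y => A y v) (extChartAt 𝓘(ℝ, EM) x₀ x)) :
    ∀ x ∈ O, x ∈ (chartAt EM x₀).source → ContDiffAt ℝ ∞ A (extChartAt 𝓘(ℝ, EM) x₀ x) := by
  intro x hx hx₀
  have hx' : x ∈ (extChartAt 𝓘(ℝ, EM) x₀).source := by rwa [extChartAt_source]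
  let U : Set EM := (extChartAt 𝓘(ℝ, EM) x₀).target ∩ (extChartAt 𝓘(ℝ, EM) x₀).symm ⁻¹' O
  have hU : IsOpen U := (continuousOn_extChartAt_symm x₀).isOpen_inter_preimage
    (isOpen_extChartAt_target x₀) hO
  have hxU : extChartAt 𝓘(ℝ, EM) x₀ x ∈ U := by
    refine ⟨(extChartAt 𝓘(ℝ, EM) x₀).map_source hx', ?_⟩
    rwa [mem_preimage, (extChartAt 𝓘(ℝ, EM) x₀).left_inv hx']
  refine ContDiffOn.contDiffAt (contDiffOn_clm_apply.2 fun v y hy => ?_) (hU.mem_nhds hxU)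
  have h1 := (extChartAt 𝓘(ℝ, EM) x₀).map_target hy.1
  rw [extChartAt_source] at h1
  have h2 := h _ hy.2 h1 v
  rw [(extChartAt 𝓘(ℝ, EM) x₀).right_inv hy.1] at h2
  exact h2.contDiffWithinAt

theorem contDiffAt_alphaCoord
    (hα : ContMDiff 𝓘(ℝ, EM) (𝓘(ℝ, EM).prod 𝓘(ℝ, EM →L[ℝ] (Fin n → ℝ))) ∞
      (fun x => TotalSpace.mk' (EM →L[ℝ] (Fin n → ℝ))
        (E := fun x => TangentSpace 𝓘(ℝ, EM) x →L[ℝ] E x) x (α x)))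
    (hu : IsLocalSection (EM := EM) fr O u) (hx : x ∈ O) (hx₀ : x ∈ (chartAt EM x₀).source) :
    ContDiffAt ℝ ∞ (alphaCoord α u x₀) (extChartAt 𝓘(ℝ, EM) x₀ x) :=
  contDiffAt_of_forall_mem_chart hu.isOpen (fun _ hx hx₀ v =>
    contDiffAt_secCoord hu hx hx₀ (contMDiffAt_alphaForm hα hx₀ v)) x hx hx₀

theorem contDiffAt_connCoord [T2Space M]
    (hcov : CovariantDerivative.ContMDiffCovariantDerivative cov ∞)
    (hu : IsLocalSection (EM := EM) fr O u) (hx : x ∈ O) (hx₀ : x ∈ (chartAt EM x₀).source) :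
    ContDiffAt ℝ ∞ (connCoord cov u x₀) (extChartAt 𝓘(ℝ, EM) x₀ x) := by
  refine contDiffAt_of_forall_mem_chart hu.isOpen (fun x hx hx₀ v => ?_) x hx hx₀
  let B : (Fin n → Fin n → ℝ) →ₗ[ℝ] EndC n :=
    { toFun := fun c => matC n (Matrix.of fun i j => c j i)
      map_add' := fun c d => by rw [← map_add]; rfl
      map_smul' := fun r c => by rw [← map_smul]; rfl }
  have h1 : ContMDiffAt 𝓘(ℝ, EM) 𝓘(ℝ, Fin n → Fin n → ℝ) ∞
      (fun y j => (u y).symm (cov (fun y => u y (Pi.single j 1)) y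
        (ofChartField 𝓘(ℝ, EM) x₀ (fun _ => v) y))) x :=
    contMDiffAt_pi_space.2 fun j => hu.contMDiffAt_symm hx (ContMDiffAt.clm_bundle_apply
      (contMDiffAt_cov hcov hu.isOpen (hu.smooth j) hx) (contMDiffAt_ofChartField_const hx₀ v))
  exact (mvfderiv_eq_fderiv_chart hx₀
    ((LinearMap.toContinuousLinearMap B).contDiff.contMDiff.contMDiffAt.comp x h1)).1

/-- The trivialization of the tangent bundle at `x₀` is the differential of the chart, which is the
identity at `x₀`. The extensions in the definitions of torsion and curvature thus have constant
components, so their brackets vanish at `x₀`. -/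
theorem extend_eventuallyEq_ofChartField (v : TangentSpace 𝓘(ℝ, EM) x₀) :
    ∀ᶠ y in 𝓝 x₀, (FiberBundle.extend EM v : ∀ y, TangentSpace 𝓘(ℝ, EM) y) y
      = ofChartField 𝓘(ℝ, EM) x₀ (fun _ => v) y := by
  filter_upwards [(trivializationAt EM (TangentSpace 𝓘(ℝ, EM)) x₀).open_baseSet.mem_nhds
    (FiberBundle.mem_baseSet_trivializationAt' x₀)] with y hy
  have h1 : (trivializationAt EM (TangentSpace 𝓘(ℝ, EM)) x₀ ⟨x₀, v⟩).2 = v := by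
    have h2 := chartD_self (I := 𝓘(ℝ, EM)) v
    rw [← continuousLinearMapAt_eq_chartD (mem_chart_source _ _)] at h2
    refine Eq.trans ?_ h2
    exact (congrFun (Bundle.Trivialization.coe_linearMapAt_of_mem
      (R := ℝ) (trivializationAt EM (TangentSpace 𝓘(ℝ, EM)) x₀)
        (FiberBundle.mem_baseSet_trivializationAt' x₀)) v).symm
  rw [FiberBundle.extend, h1]
  exact (Bundle.Trivialization.symmL_apply (R := ℝ) _ hy _).symm

theorem cov_congr {σ τ : ∀ x, E x} (h : ∀ᶠ y in 𝓝 x, σ y = τ y)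
    (hτ : ContMDiffAt 𝓘(ℝ, EM) (𝓘(ℝ, EM).prod 𝓘(ℝ, Fin n → ℝ)) ∞
      (fun y => TotalSpace.mk' (Fin n → ℝ) y (τ y)) x) : cov σ x = cov τ x :=
  cov.isCovariantDerivativeOnUniv.congr_of_eventuallyEq
    ((hτ.congr_of_eventuallyEq (h.mono fun y hy =>
      congrArg (TotalSpace.mk' (Fin n → ℝ) y) hy)).mdifferentiableAt (by simp))
    (hτ.mdifferentiableAt (by simp)) univ_mem h

theorem mlieBracket_extend (v w : TangentSpace 𝓘(ℝ, EM) x₀) :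
    VectorField.mlieBracket 𝓘(ℝ, EM) (FiberBundle.extend EM v) (FiberBundle.extend EM w) x₀
      = 0 := by
  refine (Filter.EventuallyEq.mlieBracket_vectorField_eq (extend_eventuallyEq_ofChartField v)
    (extend_eventuallyEq_ofChartField w)).trans ?_
  refine (mlieBracket_eq_lieBracket_chartField _ _).trans ?_
  have h : ∀ v : EM, chartField 𝓘(ℝ, EM) x₀ (ofChartField 𝓘(ℝ, EM) x₀ (fun _ => v))
      =ᶠ[𝓝 (extChartAt 𝓘(ℝ, EM) x₀ x₀)] fun _ => v := fun v => by
    filter_upwards [extChartAt_target_mem_nhds (I := 𝓘(ℝ, EM)) x₀] with y hy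
      using chartField_ofChartField hy _
  exact ((h v).lieBracket_vectorField_eq (h w)).trans (lieBracket_const_const (B := EM) v w)

/-- With extensions that are constant in the chart the bracket term drops out, and the two covariant
derivatives are those of the flat model. -/
theorem toC_symm_torsion
    (hα : ContMDiff 𝓘(ℝ, EM) (𝓘(ℝ, EM).prod 𝓘(ℝ, EM →L[ℝ] (Fin n → ℝ))) ∞
      (fun x => TotalSpace.mk' (EM →L[ℝ] (Fin n → ℝ))
        (E := fun x => TangentSpace 𝓘(ℝ, EM) x →L[ℝ] E x) x (α x)))
    (hu : IsLocalSection (EM := EM) fr O u) (hx₀ : x₀ ∈ O) (v w : TangentSpace 𝓘(ℝ, EM) x₀) :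
    toC n ((u x₀).symm (torsion α cov x₀ v w))
      = flatTorsion (alphaCoord α u x₀) (connCoord cov u x₀) (extChartAt 𝓘(ℝ, EM) x₀ x₀) v w := by
  have hs := mem_chart_source EM x₀
  have h1 := fun v w : EM => toC_symm_cov (cov := cov) hu hx₀ hs (contMDiffAt_alphaForm hα hs w) v
  have h2 := flatCov_torsion_const (θ := connCoord cov u x₀)
    ((contDiffAt_alphaCoord hα hu hx₀ hs).differentiableAt (by simp)) v w
  have h3 : torsion α cov x₀ v w
      = cov (fun y => α y (ofChartField 𝓘(ℝ, EM) x₀ (fun _ => w) y)) x₀ v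
        - cov (fun y => α y (ofChartField 𝓘(ℝ, EM) x₀ (fun _ => v) y)) x₀ w := by
    refine (congrArg (fun L => _ - α x₀ L) (mlieBracket_extend v w)).trans ?_
    rw [map_zero, sub_zero]
    have h4 := fun w : TangentSpace 𝓘(ℝ, EM) x₀ => cov_congr (cov := cov)
      ((extend_eventuallyEq_ofChartField w).mono fun y hy => congrArg (α y) hy)
      (contMDiffAt_alphaForm hα hs _)
    rw [h4, h4]
  rw [h3, map_sub, map_sub]
  refine Eq.trans ?_ h2
  congr 1
  · refine (h1 v w).trans ?_
    rw [chartD_self]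
    rfl
  · refine (h1 w v).trans ?_
    rw [chartD_self]
    rfl

theorem toC_symm_curvature [T2Space M]
    (hcov : CovariantDerivative.ContMDiffCovariantDerivative cov ∞)
    (hu : IsLocalSection (EM := EM) fr O u) (hx₀ : x₀ ∈ O) (v w : TangentSpace 𝓘(ℝ, EM) x₀)
    (e : E x₀) : toC n ((u x₀).symm (curvature cov x₀ v w e))
      = flatCurvature (connCoord cov u x₀) (extChartAt 𝓘(ℝ, EM) x₀ x₀) v w
        (toC n ((u x₀).symm e)) := by
  have hs := mem_chart_source EM x₀
  obtain ⟨N, hN, hsN⟩ := FiberBundle.exists_contMDiffOn_extend (k := ∞) 𝓘(ℝ, EM) (Fin n → ℝ) e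
  obtain ⟨N', hN'N, hN', hxN'⟩ := mem_nhds_iff.1 hN
  let s : ∀ y : M, E y := FiberBundle.extend (Fin n → ℝ) e
  have hsm : ∀ y ∈ N', ContMDiffAt 𝓘(ℝ, EM) (𝓘(ℝ, EM).prod 𝓘(ℝ, Fin n → ℝ)) ∞
      (fun y => TotalSpace.mk' (Fin n → ℝ) y (s y)) y := fun y hy =>
    (hsN.mono hN'N).contMDiffAt (hN'.mem_nhds hy)
  have hcs : ∀ w : EM, ContMDiffAt 𝓘(ℝ, EM) (𝓘(ℝ, EM).prod 𝓘(ℝ, Fin n → ℝ)) ∞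
      (fun y => TotalSpace.mk' (Fin n → ℝ) y
        (cov s y (ofChartField 𝓘(ℝ, EM) x₀ (fun _ => w) y))) x₀ := fun w =>
    ContMDiffAt.clm_bundle_apply (contMDiffAt_cov hcov hN' (hsN.mono hN'N) hxN')
      (contMDiffAt_ofChartField_const hs w)
  -- The inner covariant derivative is differentiated again, so its coordinate expression is needed
  -- on a neighbourhood of `x₀` and not only at `x₀`.
  have hev : ∀ w : EM, secCoord u x₀ (fun y => cov s y (ofChartField 𝓘(ℝ, EM) x₀ (fun _ => w) y))
      =ᶠ[𝓝 (extChartAt 𝓘(ℝ, EM) x₀ x₀)]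
        fun y => flatCov (connCoord cov u x₀) (secCoord u x₀ s) y w := by
    intro w
    have hcont : ContinuousAt (extChartAt 𝓘(ℝ, EM) x₀).symm (extChartAt 𝓘(ℝ, EM) x₀ x₀) :=
      continuousAt_extChartAt_symm x₀
    have hmem : O ∩ N' ∈ 𝓝 ((extChartAt 𝓘(ℝ, EM) x₀).symm (extChartAt 𝓘(ℝ, EM) x₀ x₀)) := by
      rw [extChartAt_to_inv]
      exact (hu.isOpen.inter hN').mem_nhds ⟨hx₀, hxN'⟩
    filter_upwards [extChartAt_target_mem_nhds (I := 𝓘(ℝ, EM)) x₀, hcont hmem] with y hy hy'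
    have hy₀ := (extChartAt 𝓘(ℝ, EM) x₀).map_target hy
    rw [extChartAt_source] at hy₀
    have := toC_symm_cov (cov := cov) hu hy'.1 hy₀ (hsm _ hy'.2)
      (ofChartField 𝓘(ℝ, EM) x₀ (fun _ => w) ((extChartAt 𝓘(ℝ, EM) x₀).symm y))
    rw [chartD_ofChartField hy₀, (extChartAt 𝓘(ℝ, EM) x₀).right_inv hy] at this
    exact this
  have h1 := fun v w : EM => (toC_symm_cov (cov := cov) hu hx₀ hs (hcs w) v).trans
    (flatCov_congr (hev w) _)
  have h2 := flatCov_curvature_const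
    ((contDiffAt_connCoord hcov hu hx₀ hs).differentiableAt (by simp))
    ((contDiffAt_secCoord hu hx₀ hs (hsm _ hxN')).of_le (by norm_cast)) v w
  have h4 : secCoord u x₀ s (extChartAt 𝓘(ℝ, EM) x₀ x₀) = toC n ((u x₀).symm e) := by
    rw [secCoord, extChartAt_to_inv]
    exact congrArg (fun e => toC n ((u x₀).symm e)) (FiberBundle.extend_apply_self _ e)
  rw [h4] at h2
  have h3 : curvature cov x₀ v w e
      = cov (fun y => cov s y (ofChartField 𝓘(ℝ, EM) x₀ (fun _ => w) y)) x₀ v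
        - cov (fun y => cov s y (ofChartField 𝓘(ℝ, EM) x₀ (fun _ => v) y)) x₀ w := by
    refine (congrArg (fun L => _ - cov s x₀ L) (mlieBracket_extend v w)).trans ?_
    rw [map_zero, sub_zero]
    have h4 := fun w : TangentSpace 𝓘(ℝ, EM) x₀ => cov_congr (cov := cov)
      ((extend_eventuallyEq_ofChartField w).mono fun y hy => congrArg (cov s y) hy) (hcs _)
    rw [h4, h4]
  rw [h3, map_sub, map_sub]
  refine Eq.trans ?_ h2
  congr 1
  · refine (h1 v w).trans ?_
    rw [chartD_self]
  · refine (h1 w v).trans ?_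
    rw [chartD_self]

end Coordinates

/-! ### Torsion and curvature of complex tangent vectors -/

section ComplexExtension

variable {n q : ℕ} {EM : Type*} [NormedAddCommGroup EM] [NormedSpace ℝ EM]
  [FiniteDimensional ℝ EM]
  {M : Type*} [TopologicalSpace M] [ChartedSpace EM M] [IsManifold 𝓘(ℝ, EM) ∞ M]
  {E : M → Type*} [∀ x, AddCommGroup (E x)] [∀ x, Module ℝ (E x)]
  [TopologicalSpace (TotalSpace (Fin n → ℝ) E)] [∀ x, TopologicalSpace (E x)]
  [∀ x, IsTopologicalAddGroup (E x)] [∀ x, ContinuousSMul ℝ (E x)]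
  [FiberBundle (Fin n → ℝ) E] [VectorBundle ℝ (Fin n → ℝ) E]
  [ContMDiffVectorBundle ∞ (Fin n → ℝ) E 𝓘(ℝ, EM)]
  {EF : Type*} [NormedAddCommGroup EF] [NormedSpace ℂ EF]
  {F : Type*} [TopologicalSpace F] [ChartedSpace EF F]
  {G : Subgroup (GL (Fin n) ℝ)} {P : FrameReduction (EM := EM) E G}
  {S : HomogeneousSubmanifold (EF := EF) F G q}
  {cov : CovariantDerivative 𝓘(ℝ, EM) (Fin n → ℝ) E}
  {α : ∀ x, TangentSpace 𝓘(ℝ, EM) x →L[ℝ] E x}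
  {O : Set M} {u : ∀ x, (Fin n → ℝ) ≃ₗ[ℝ] E x}

theorem cplxBilin_cplx_eq_cFrame {V W : Type*} [AddCommGroup V] [Module ℝ V] [AddCommGroup W]
    [Module ℝ W] {x : M} (u : (Fin n → ℝ) ≃ₗ[ℝ] E x) {B : V → W → E x} {b : V → W → Fin n → ℂ}
    (h : ∀ v w, toC n (u.symm (B v w)) = b v w) (v₁ v₂ : V) (w₁ w₂ : W) :
    cplxBilin B (cplx v₁ v₂) (cplx w₁ w₂)
      = cFrame u (b v₁ w₁ - b v₂ w₂ + Complex.I • (b v₁ w₂ + b v₂ w₁)) := by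
  rw [cplxBilin, rePart_cplx, rePart_cplx, imPart_cplx, imPart_cplx, ← h, ← h, ← h, ← h,
    ← map_sub, ← map_sub, ← map_add, ← map_add, cFrame_cplx, LinearEquiv.apply_symm_apply,
    LinearEquiv.apply_symm_apply]

theorem torsionC_mem_sub_iff
    (hα : ContMDiff 𝓘(ℝ, EM) (𝓘(ℝ, EM).prod 𝓘(ℝ, EM →L[ℝ] (Fin n → ℝ))) ∞
      (fun x => TotalSpace.mk' (EM →L[ℝ] (Fin n → ℝ))
        (E := fun x => TangentSpace 𝓘(ℝ, EM) x →L[ℝ] E x) x (α x)))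
    (hu : IsLocalSection (EM := EM) P.frames O u) {z : AssocBundle P S} (hz : z.proj ∈ O)
    (v₁ v₂ w₁ w₂ : TangentSpace 𝓘(ℝ, EM) z.proj) :
    torsionC α cov z.proj (cplx v₁ v₂) (cplx w₁ w₂) ∈ z.sub ↔
      (1 - projField u z) (flatTorsionC (alphaCoord α u z.proj) (connCoord cov u z.proj)
        (extChartAt 𝓘(ℝ, EM) z.proj z.proj) v₁ v₂ w₁ w₂) = 0 := by
  rw [torsionC, cplxBilin_cplx_eq_cFrame (u z.proj) (toC_symm_torsion hα hu hz),
    mem_sub_iff (hu.mem _ hz), sub_apply, one_apply_eq_self, sub_eq_zero, eq_comm]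
  rfl

/-- An endomorphism `K` preserves the range of a projection `p` if and only if `(1 - p) K p = 0`. -/
theorem curvatureC_mem_sub_iff [T2Space M]
    (hcov : CovariantDerivative.ContMDiffCovariantDerivative cov ∞)
    (hu : IsLocalSection (EM := EM) P.frames O u) {z : AssocBundle P S} (hz : z.proj ∈ O)
    (v₁ v₂ w₁ w₂ : TangentSpace 𝓘(ℝ, EM) z.proj) :
    (∀ e ∈ z.sub, curvatureC cov z.proj (cplx v₁ v₂) (cplx w₁ w₂) e ∈ z.sub) ↔
      (1 - projField u z) * flatCurvatureC (connCoord cov u z.proj)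
        (extChartAt 𝓘(ℝ, EM) z.proj z.proj) v₁ v₂ w₁ w₂ * projField u z = 0 := by
  let K : EndC n := flatCurvatureC (connCoord cov u z.proj)
        (extChartAt 𝓘(ℝ, EM) z.proj z.proj) v₁ v₂ w₁ w₂
  have hcurv : ∀ c, curvatureC cov z.proj (cplx v₁ v₂) (cplx w₁ w₂) (cFrame (u z.proj) c)
      = cFrame (u z.proj) (K c) := by
    intro c
    have h1 := fun e => cplxBilin_cplx_eq_cFrame (u z.proj)
      (B := fun v w => curvature cov z.proj v w e)
      (fun v w => toC_symm_curvature hcov hu hz v w e) v₁ v₂ w₁ w₂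
    have h2 : ∀ e, cplxBilin (fun v w => curvature cov z.proj v w e) (cplx v₁ v₂) (cplx w₁ w₂)
        = cFrame (u z.proj) (K (toC n ((u z.proj).symm e))) := h1
    -- The complex curvature is defined through the real and imaginary parts of its argument; their
    -- coordinates recombine to `c`, on which `K` acts complex linearly.
    have h3 := cFrame_cplx (u z.proj) ((u z.proj).symm (rePart (cFrame (u z.proj) c)))
      ((u z.proj).symm (imPart (cFrame (u z.proj) c)))
    rw [LinearEquiv.apply_symm_apply, LinearEquiv.apply_symm_apply, cplx_rePart_imPart] at h3
    rw [curvatureC, h2, h2, ← map_smul, ← map_add, ← map_smul, ← map_add,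
      (cFrame (u z.proj)).injective h3]
  have hP : ∀ c, cFrame (u z.proj) c ∈ z.sub ↔ projField u z c = c := mem_sub_iff (hu.mem _ hz)
  constructor
  · intro h
    ext1 c
    have h1 := h _ ((hP _).2 (congrArg (fun L : EndC n => L c)
      (orthProj_mul_self (S.toSub (coordF u z)))))
    rw [hcurv, hP] at h1
    change K (projField u z c) - projField u z (K (projField u z c)) = 0
    exact sub_eq_zero.2 h1.symm
  · intro h e he
    obtain ⟨c, rfl⟩ := (cFrame (u z.proj)).surjective e
    rw [hcurv, hP]
    rw [hP] at he
    have h1 : K (projField u z c) - projField u z (K (projField u z c)) = 0 :=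
      congrArg (fun L : EndC n => L c) h
    rw [he] at h1
    exact (sub_eq_zero.1 h1).symm

end ComplexExtension

end IntRes
end

noncomputable section

namespace IntRes

/-! ### The distribution in a chart -/

section PullBack

variable {B B' V : Type*} [NormedAddCommGroup B] [NormedSpace ℝ B] [NormedAddCommGroup B']
  [NormedSpace ℝ B'] [NormedAddCommGroup V] [NormedSpace ℝ V]

/-- The pull-back of a form on `B` to `B × B'`. -/
def fstPullback (a : B → B →L[ℝ] V) (y : B × B') : B × B' →L[ℝ] V :=
  a y.1 ∘L ContinuousLinearMap.fst ℝ B B'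

theorem fstPullback_apply (a : B → B →L[ℝ] V) (y X : B × B') : fstPullback a y X = a y.1 X.1 := rfl

theorem contDiffAt_fstPullback {a : B → B →L[ℝ] V} {y : B × B'} (ha : ContDiffAt ℝ ∞ a y.1) :
    ContDiffAt ℝ ∞ (fstPullback (B' := B') a) y :=
  (ContDiffAt.comp y ha contDiffAt_fst).clm_comp contDiffAt_const

theorem fderiv_fstPullback {a : B → B →L[ℝ] V} {y : B × B'} (ha : DifferentiableAt ℝ a y.1)
    (X Y : B × B') : fderiv ℝ (fstPullback (B' := B') a) y X Y = fderiv ℝ a y.1 X.1 Y.1 := by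
  have h1 : HasFDerivAt (fun y : B × B' => a y.1) _ y := ha.hasFDerivAt.comp y hasFDerivAt_fst
  have h2 := (h1.clm_comp (hasFDerivAt_const (ContinuousLinearMap.fst ℝ B B') y)).fderiv
  change fderiv ℝ (fun y : B × B' => a y.1 ∘L ContinuousLinearMap.fst ℝ B B') y X Y = _
  rw [h2]
  simp

variable {W : Type*} [NormedAddCommGroup W] [NormedSpace ℂ W] [NormedSpace ℝ W]
  [IsScalarTower ℝ ℂ W]

/-- Torsion and curvature commute with pull-back along the projection. This is why brackets on the
total space impose conditions on vectors of `M` only. -/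
theorem flatTorsionC_fstPullback {a : B → B →L[ℝ] W} {θ : B → B →L[ℝ] W →L[ℂ] W} {y : B × B'}
    (ha : DifferentiableAt ℝ a y.1) (X₁ X₂ Y₁ Y₂ : B × B') :
    flatTorsionC (fstPullback a) (fstPullback θ) y X₁ X₂ Y₁ Y₂
      = flatTorsionC a θ y.1 X₁.1 X₂.1 Y₁.1 Y₂.1 := by
  simp only [flatTorsionC, flatTorsion, fderiv_fstPullback ha, fstPullback_apply]

theorem flatCurvatureC_fstPullback {θ : B → B →L[ℝ] W →L[ℂ] W} {y : B × B'}
    (hθ : DifferentiableAt ℝ θ y.1) (X₁ X₂ Y₁ Y₂ : B × B') :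
    flatCurvatureC (fstPullback θ) y X₁ X₂ Y₁ Y₂
      = flatCurvatureC θ y.1 X₁.1 X₂.1 Y₁.1 Y₂.1 := by
  simp only [flatCurvatureC, flatCurvature, fderiv_fstPullback hθ, fstPullback_apply]

end PullBack

/-! ### Charts of the bundle adapted to a chart of the base and a local section -/

section Local

variable {n q : ℕ} {EM : Type*} [NormedAddCommGroup EM] [NormedSpace ℝ EM]
  [FiniteDimensional ℝ EM]
  {M : Type*} [TopologicalSpace M] [ChartedSpace EM M]
  {E : M → Type*} [∀ x, AddCommGroup (E x)] [∀ x, Module ℝ (E x)]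
  [TopologicalSpace (TotalSpace (Fin n → ℝ) E)] [∀ x, TopologicalSpace (E x)]
  [∀ x, IsTopologicalAddGroup (E x)] [∀ x, ContinuousSMul ℝ (E x)]
  [FiberBundle (Fin n → ℝ) E] [VectorBundle ℝ (Fin n → ℝ) E]
  [ContMDiffVectorBundle ∞ (Fin n → ℝ) E 𝓘(ℝ, EM)]
  {EF : Type*} [NormedAddCommGroup EF] [NormedSpace ℂ EF]
  {F : Type*} [TopologicalSpace F] [ChartedSpace EF F]
  {G : Subgroup (GL (Fin n) ℝ)}
  {P : FrameReduction (EM := EM) E G} {S : HomogeneousSubmanifold (EF := EF) F G q}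
  [FiniteDimensional ℂ EF] [IsManifold 𝓘(ℝ, EF) ∞ F] [IsManifold 𝓘(ℝ, EM) ∞ M]
  {cov : CovariantDerivative 𝓘(ℝ, EM) (Fin n → ℝ) E}
  {α : ∀ x, TangentSpace 𝓘(ℝ, EM) x →L[ℝ] E x}

/-- For a vertical vector the connection term vanishes, and the immersion property forces its
component in `F` to be zero. -/
theorem eq_zero_of_tproj_eq_zero_of_vertPart_eq_zero {O : Set M}
    {u : ∀ x, (Fin n → ℝ) ≃ₗ[ℝ] E x} (hu : IsLocalSection (EM := EM) P.frames O u)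
    {z : AssocBundle P S} (hz : z.proj ∈ O) {w : TangentSpace (assocModel EM EF) z}
    (h₁ : tproj z w = 0) (h₂ : vertPart cov u z w = 0) : w = 0 := by
  have h3 : mvfderiv (assocModel EM EF) (projField u) z w * projField u z
      + (1 - projField u z) * connForm cov u z.proj (tproj z w) * projField u z = 0 := h₂
  rw [h₁, map_zero, mul_zero, zero_mul, add_zero, mvfderiv_coordF hu hz] at h3
  have h4 := S.immersion.mfderiv_orthProj_injective (coordF u z) h3
  refine tangent_ext hu hz (h₁.trans (map_zero _).symm) (h4.trans (map_zero _).symm)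

/-- The local section `u` of the reduction is adapted to the chart at `z₀`: the first component of
the chart is the chart of the base, and the domain lies over the domain of `u`. -/
structure IsAdapted (z₀ : AssocBundle P S) (O : Set M) (u : ∀ x, (Fin n → ℝ) ≃ₗ[ℝ] E x) : Prop where
  isLocalSection : IsLocalSection (EM := EM) P.frames O u
  mem_of_mem_source : ∀ z ∈ (chartAt (ModelProd EM EF) z₀).source, z.proj ∈ O
  proj_mem_source : ∀ z ∈ (chartAt (ModelProd EM EF) z₀).source,
    z.proj ∈ (chartAt EM z₀.proj).source
  fst_extChartAt : ∀ z, (extChartAt (assocModel EM EF) z₀ z).1 = extChartAt 𝓘(ℝ, EM) z₀.proj z.proj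

theorem exists_isAdapted (z₀ : AssocBundle P S) : ∃ O u, IsAdapted z₀ O u := by
  obtain ⟨O, u, hu, hz₀, hc⟩ := exists_chartAt_eq z₀
  refine ⟨O, u, hu, fun z hz => ?_, fun z hz => ?_, fun z => ?_⟩
  · rw [hc, OpenPartialHomeomorph.trans_source] at hz
    exact hz.1
  · rw [hc, OpenPartialHomeomorph.trans_source] at hz
    exact hz.2.1
  · rw [extChartAt_coe, hc]
    rfl

namespace IsAdapted

variable {z₀ z : AssocBundle P S} {O : Set M} {u : ∀ x, (Fin n → ℝ) ≃ₗ[ℝ] E x}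

theorem fst_chartD (h : IsAdapted z₀ O u) (hz : z ∈ (chartAt (ModelProd EM EF) z₀).source)
    (w : TangentSpace (assocModel EM EF) z) :
    (chartD (assocModel EM EF) z₀ z w).1 = chartD 𝓘(ℝ, EM) z₀.proj z.proj (tproj z w) := by
  have h1 : (ContinuousLinearMap.fst ℝ EM EF) ∘ extChartAt (assocModel EM EF) z₀
      = extChartAt 𝓘(ℝ, EM) z₀.proj ∘ fun z : AssocBundle P S => z.proj :=
    funext h.fst_extChartAt
  have h2 := mvfderiv_clm_comp (ContinuousLinearMap.fst ℝ EM EF)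
    ((contMDiffAt_extChartAt' hz).mdifferentiableAt (n := ∞) (I := assocModel EM EF) (by simp)) w
  have h3 := mvfderiv_comp_vector
    ((contMDiffAt_extChartAt' (h.proj_mem_source z hz)).mdifferentiableAt (n := ∞)
      (I := 𝓘(ℝ, EM)) (by simp))
    ((contMDiffAt_totalSpace_proj z).mdifferentiableAt (by simp)) w
  rw [← h1] at h3
  exact h2.symm.trans h3

variable (u z₀) in
/-- The projections onto the points of the bundle, in the chart at `z₀`. -/
def _root_.IntRes.projCoord (y : EM × EF) : EndC n :=
  projField u ((extChartAt (assocModel EM EF) z₀).symm y)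

theorem projCoord_mul_self (y : EM × EF) :
    projCoord z₀ u y * projCoord z₀ u y = projCoord z₀ u y := projField_mul_self u _

theorem projCoord_extChartAt (hz : z ∈ (chartAt (ModelProd EM EF) z₀).source) :
    projCoord z₀ u (extChartAt (assocModel EM EF) z₀ z) = projField u z := by
  have hz' : z ∈ (extChartAt (assocModel EM EF) z₀).source := by rwa [extChartAt_source]
  rw [projCoord, (extChartAt (assocModel EM EF) z₀).left_inv hz']

theorem contDiffAt_projCoord (h : IsAdapted z₀ O u)
    (hz : z ∈ (chartAt (ModelProd EM EF) z₀).source) :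
    ContDiffAt ℝ ∞ (projCoord z₀ u) (extChartAt (assocModel EM EF) z₀ z) :=
  (mvfderiv_eq_fderiv_chart hz
    (contMDiffAt_projField h.isLocalSection (h.mem_of_mem_source z hz))).1

theorem alphaCoord_fst_chartD (h : IsAdapted z₀ O u)
    (hz : z ∈ (chartAt (ModelProd EM EF) z₀).source) (w : TangentSpace (assocModel EM EF) z) :
    fstPullback (alphaCoord α u z₀.proj) (extChartAt (assocModel EM EF) z₀ z)
      (chartD (assocModel EM EF) z₀ z w) = alphaForm α u z.proj (tproj z w) := by
  rw [fstPullback_apply, h.fst_chartD hz, h.fst_extChartAt,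
    alphaCoord_chartD (h.proj_mem_source z hz)]

theorem flatSecond_chartD (h : IsAdapted z₀ O u)
    (hz : z ∈ (chartAt (ModelProd EM EF) z₀).source) (w : TangentSpace (assocModel EM EF) z) :
    flatSecond (projCoord z₀ u) (fstPullback (connCoord cov u z₀.proj))
      (extChartAt (assocModel EM EF) z₀ z) (chartD (assocModel EM EF) z₀ z w)
      = vertPart cov u z w := by
  rw [flatSecond, fstPullback_apply, h.fst_chartD hz, h.fst_extChartAt,
    connCoord_chartD (h.proj_mem_source z hz), projCoord_extChartAt hz]
  have h1 := (mvfderiv_eq_fderiv_chart hz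
    (contMDiffAt_projField h.isLocalSection (h.mem_of_mem_source z hz))).2 w
  refine congrArg (fun L => L * projField u z + _) ?_
  exact h1.symm

/-- This is the bridge between the geometry and the flat calculus: in an adapted chart, the two
conditions of `mem_twistorDistribution_iff` become those of `FlatMem`. -/
theorem flatMem_iff (h : IsAdapted z₀ O u) (hP : P.IsPreservedBy cov)
    (hz : z ∈ (chartAt (ModelProd EM EF) z₀).source) (w₁ w₂ : TangentSpace (assocModel EM EF) z) :
    FlatMem (fstPullback (alphaCoord α u z₀.proj)) (projCoord z₀ u)
      (fstPullback (connCoord cov u z₀.proj)) (extChartAt (assocModel EM EF) z₀ z)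
      (chartD (assocModel EM EF) z₀ z w₁) (chartD (assocModel EM EF) z₀ z w₂)
      ↔ cplx w₁ w₂ ∈ twistorDistribution α cov z := by
  have hzO := h.mem_of_mem_source z hz
  rw [mem_twistorDistribution_iff α hP h.isLocalSection hzO,
    mem_alphaInv_iff α (h.isLocalSection.mem _ hzO), FlatMem, h.alphaCoord_fst_chartD hz,
    h.alphaCoord_fst_chartD hz, h.flatSecond_chartD hz, h.flatSecond_chartD hz,
    projCoord_extChartAt hz]

theorem contDiffAt_alphaCoord (h : IsAdapted z₀ O u)
    (hα : ContMDiff 𝓘(ℝ, EM) (𝓘(ℝ, EM).prod 𝓘(ℝ, EM →L[ℝ] (Fin n → ℝ))) ∞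
      (fun x => TotalSpace.mk' (EM →L[ℝ] (Fin n → ℝ))
        (E := fun x => TangentSpace 𝓘(ℝ, EM) x →L[ℝ] E x) x (α x)))
    (hz : z ∈ (chartAt (ModelProd EM EF) z₀).source) :
    ContDiffAt ℝ ∞ (alphaCoord α u z₀.proj) (extChartAt (assocModel EM EF) z₀ z).1 := by
  rw [h.fst_extChartAt]
  exact IntRes.contDiffAt_alphaCoord hα h.isLocalSection (h.mem_of_mem_source z hz)
    (h.proj_mem_source z hz)

theorem contDiffAt_connCoord [T2Space M] (h : IsAdapted z₀ O u)
    (hcov : CovariantDerivative.ContMDiffCovariantDerivative cov ∞)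
    (hz : z ∈ (chartAt (ModelProd EM EF) z₀).source) :
    ContDiffAt ℝ ∞ (connCoord cov u z₀.proj) (extChartAt (assocModel EM EF) z₀ z).1 := by
  rw [h.fst_extChartAt]
  exact IntRes.contDiffAt_connCoord hcov h.isLocalSection (h.mem_of_mem_source z hz)
    (h.proj_mem_source z hz)

theorem eventually_flatMem (h : IsAdapted z₀ O u) (hP : P.IsPreservedBy cov)
    {N : Set (AssocBundle P S)} (hN : IsOpen N)
    (hz₀ : z₀ ∈ N) {X₁ X₂ : ∀ z : AssocBundle P S, TangentSpace (assocModel EM EF) z}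
    (hX : ∀ z ∈ N, cplx (X₁ z) (X₂ z) ∈ twistorDistribution α cov z) :
    ∀ᶠ y in 𝓝 (extChartAt (assocModel EM EF) z₀ z₀),
      FlatMem (fstPullback (alphaCoord α u z₀.proj)) (projCoord z₀ u)
        (fstPullback (connCoord cov u z₀.proj)) y
        (chartField (assocModel EM EF) z₀ X₁ y) (chartField (assocModel EM EF) z₀ X₂ y) := by
  have hcont : ContinuousAt (extChartAt (assocModel EM EF) z₀).symm
      (extChartAt (assocModel EM EF) z₀ z₀) := continuousAt_extChartAt_symm z₀
  have hmem : N ∈ 𝓝 ((extChartAt (assocModel EM EF) z₀).symm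
      (extChartAt (assocModel EM EF) z₀ z₀)) := by
    rw [extChartAt_to_inv]
    exact hN.mem_nhds hz₀
  filter_upwards [extChartAt_target_mem_nhds (I := assocModel EM EF) z₀, hcont hmem] with y hy hy'
  have hs := (extChartAt (assocModel EM EF) z₀).map_target hy
  rw [extChartAt_source] at hs
  have := (h.flatMem_iff hP hs _ _).2 (hX _ hy')
  rwa [(extChartAt (assocModel EM EF) z₀).right_inv hy] at this

end IsAdapted

end Local

end IntRes
end

noncomputable section

namespace IntRes

/-! ### Brackets of sections of the distribution -/

section Brackets

variable {n q : ℕ} {EM : Type*} [NormedAddCommGroup EM] [NormedSpace ℝ EM]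
  [FiniteDimensional ℝ EM]
  {M : Type*} [TopologicalSpace M] [ChartedSpace EM M]
  {E : M → Type*} [∀ x, AddCommGroup (E x)] [∀ x, Module ℝ (E x)]
  [TopologicalSpace (TotalSpace (Fin n → ℝ) E)] [∀ x, TopologicalSpace (E x)]
  [∀ x, IsTopologicalAddGroup (E x)] [∀ x, ContinuousSMul ℝ (E x)]
  [FiberBundle (Fin n → ℝ) E] [VectorBundle ℝ (Fin n → ℝ) E]
  [ContMDiffVectorBundle ∞ (Fin n → ℝ) E 𝓘(ℝ, EM)]
  {EF : Type*} [NormedAddCommGroup EF] [NormedSpace ℂ EF]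
  {F : Type*} [TopologicalSpace F] [ChartedSpace EF F]
  {G : Subgroup (GL (Fin n) ℝ)}
  {P : FrameReduction (EM := EM) E G} {S : HomogeneousSubmanifold (EF := EF) F G q}
  [FiniteDimensional ℂ EF] [IsManifold 𝓘(ℝ, EF) ∞ F] [IsManifold 𝓘(ℝ, EM) ∞ M]
  {cov : CovariantDerivative 𝓘(ℝ, EM) (Fin n → ℝ) E}
  {α : ∀ x, TangentSpace 𝓘(ℝ, EM) x →L[ℝ] E x}

theorem chartField_extChartAt_self {EN HN : Type*} [NormedAddCommGroup EN] [NormedSpace ℝ EN]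
    [TopologicalSpace HN] {I : ModelWithCorners ℝ EN HN} {N : Type*} [TopologicalSpace N]
    [ChartedSpace HN N] [IsManifold I ∞ N] (z₀ : N) (X : ∀ z : N, TangentSpace I z) :
    chartField I z₀ X (extChartAt I z₀ z₀) = chartD I z₀ z₀ (X z₀) := by
  rw [chartField, extChartAt_to_inv]

theorem lieBracket_chartField_eq_chartD {EN HN : Type*} [NormedAddCommGroup EN] [NormedSpace ℝ EN]
    [CompleteSpace EN]
    [TopologicalSpace HN] {I : ModelWithCorners ℝ EN HN} [I.Boundaryless] {N : Type*}
    [TopologicalSpace N] [ChartedSpace HN N] [IsManifold I ∞ N] (z₀ : N)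
    (X Y : ∀ z : N, TangentSpace I z) :
    VectorField.lieBracket ℝ (chartField I z₀ X) (chartField I z₀ Y) (extChartAt I z₀ z₀)
      = chartD I z₀ z₀ (VectorField.mlieBracket I X Y z₀) :=
  (mlieBracket_eq_lieBracket_chartField X Y).symm.trans (chartD_self (I := I) _).symm

/-- The bracket of two sections of the distribution belongs to the distribution if and only if the
torsion and the curvature satisfy the corresponding conditions. -/
theorem mlieBracket_mem_twistorDistribution_iff [T2Space M]
    (hα : ContMDiff 𝓘(ℝ, EM) (𝓘(ℝ, EM).prod 𝓘(ℝ, EM →L[ℝ] (Fin n → ℝ))) ∞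
      (fun x => TotalSpace.mk' (EM →L[ℝ] (Fin n → ℝ))
        (E := fun x => TangentSpace 𝓘(ℝ, EM) x →L[ℝ] E x) x (α x)))
    (hcov : CovariantDerivative.ContMDiffCovariantDerivative cov ∞) (hP : P.IsPreservedBy cov)
    {N : Set (AssocBundle P S)} (hN : IsOpen N)
    {X₁ X₂ Y₁ Y₂ : ∀ z : AssocBundle P S, TangentSpace (assocModel EM EF) z}
    (hX₁ : IsSmoothVectorFieldOn (assocModel EM EF) X₁ N)
    (hX₂ : IsSmoothVectorFieldOn (assocModel EM EF) X₂ N)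
    (hY₁ : IsSmoothVectorFieldOn (assocModel EM EF) Y₁ N)
    (hY₂ : IsSmoothVectorFieldOn (assocModel EM EF) Y₂ N)
    (hX : ∀ z ∈ N, cplx (X₁ z) (X₂ z) ∈ twistorDistribution α cov z)
    (hY : ∀ z ∈ N, cplx (Y₁ z) (Y₂ z) ∈ twistorDistribution α cov z)
    {z : AssocBundle P S} (hz : z ∈ N) :
    cplx (VectorField.mlieBracket (assocModel EM EF) X₁ Y₁ z
          - VectorField.mlieBracket (assocModel EM EF) X₂ Y₂ z)
        (VectorField.mlieBracket (assocModel EM EF) X₁ Y₂ z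
          + VectorField.mlieBracket (assocModel EM EF) X₂ Y₁ z) ∈ twistorDistribution α cov z ↔
      torsionC α cov z.proj (cplx (tproj z (X₁ z)) (tproj z (X₂ z)))
          (cplx (tproj z (Y₁ z)) (tproj z (Y₂ z))) ∈ z.sub ∧
        ∀ e ∈ z.sub, curvatureC cov z.proj (cplx (tproj z (X₁ z)) (tproj z (X₂ z)))
          (cplx (tproj z (Y₁ z)) (tproj z (Y₂ z))) e ∈ z.sub := by
  have : FiniteDimensional ℝ EF := FiniteDimensional.complexToReal EF
  have : CompleteSpace (EM × EF) := FiniteDimensional.complete ℝ _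
  obtain ⟨O, u, h⟩ := exists_isAdapted z
  have hs : z ∈ (chartAt (ModelProd EM EF) z).source := mem_chart_source _ z
  have hd := fun {X} (hX : IsSmoothVectorFieldOn (assocModel EM EF) X N) =>
    (hX.contDiffAt_chartField hz).differentiableAt (by simp)
  have hp := h.contDiffAt_projCoord hs
  have ha := h.contDiffAt_alphaCoord hα hs
  have hθ := h.contDiffAt_connCoord hcov hs
  have hpp : ∀ᶠ y in 𝓝 (extChartAt (assocModel EM EF) z z),
      projCoord z u y * projCoord z u y = projCoord z u y :=
    Eventually.of_forall IsAdapted.projCoord_mul_self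
  have hfX := h.eventually_flatMem hP hN hz hX
  have hfY := h.eventually_flatMem hP hN hz hY
  -- The two flat identities are applied to the components of the fields in the chart at `z`; they
  -- are then rewritten in terms of tangent vectors at `z`.
  have hT := flatTorsion_bracket (hp.differentiableAt (by simp)) hpp
    ((contDiffAt_fstPullback ha).differentiableAt (by simp)) (hd hX₁) (hd hX₂) (hd hY₁) (hd hY₂)
    hfX hfY
  have hR := flatCurvature_bracket (hp.of_le (by norm_cast)) hpp
    ((contDiffAt_fstPullback hθ).differentiableAt (by simp)) (hd hX₁) (hd hX₂) (hd hY₁) (hd hY₂)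
    hfX hfY
  have h1 : ∀ w : TangentSpace (assocModel EM EF) z,
      (chartD (assocModel EM EF) z z w).1 = tproj z w := fun w => by
    rw [h.fst_chartD hs, chartD_self]
  rw [flatTorsionC_fstPullback (ha.differentiableAt (by simp))] at hT
  rw [flatCurvatureC_fstPullback (hθ.differentiableAt (by simp))] at hR
  simp only [lieBracket_chartField_eq_chartD, chartField_extChartAt_self, ← map_sub, ← map_add,
    h.alphaCoord_fst_chartD hs, h.flatSecond_chartD hs, h1, IsAdapted.projCoord_extChartAt hs,
    h.fst_extChartAt] at hT hR
  have hzO := h.mem_of_mem_source z hs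
  rw [torsionC_mem_sub_iff hα h.isLocalSection hzO,
    curvatureC_mem_sub_iff hcov h.isLocalSection hzO,
    mem_twistorDistribution_iff α hP h.isLocalSection hzO,
    mem_alphaInv_iff α (h.isLocalSection.mem _ hzO)]
  have key : ∀ c, projField u z c = c ↔ (1 - projField u z) c = 0 := fun c => by
    rw [sub_apply, one_apply_eq_self, sub_eq_zero, eq_comm]
  rw [map_add] at hT
  -- Each identity is a sum of two terms equal to zero, so the bracket term vanishes if and only if
  -- the torsion or curvature term does.
  refine and_congr ?_ ?_
  · rw [key]
    exact ⟨fun h => by rwa [h, add_zero] at hT, fun h => by rwa [h, zero_add] at hT⟩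
  · exact ⟨fun h => by rwa [h, add_zero] at hR, fun h => by rwa [h, zero_add] at hR⟩

end Brackets

/-! ### Existence of sections of the distribution -/

section Sections

variable {n q : ℕ} {EM : Type*} [NormedAddCommGroup EM] [NormedSpace ℝ EM]
  [FiniteDimensional ℝ EM]
  {M : Type*} [TopologicalSpace M] [ChartedSpace EM M]
  {E : M → Type*} [∀ x, AddCommGroup (E x)] [∀ x, Module ℝ (E x)]
  [TopologicalSpace (TotalSpace (Fin n → ℝ) E)] [∀ x, TopologicalSpace (E x)]
  [∀ x, IsTopologicalAddGroup (E x)] [∀ x, ContinuousSMul ℝ (E x)]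
  [FiberBundle (Fin n → ℝ) E] [VectorBundle ℝ (Fin n → ℝ) E]
  [ContMDiffVectorBundle ∞ (Fin n → ℝ) E 𝓘(ℝ, EM)]
  {EF : Type*} [NormedAddCommGroup EF] [NormedSpace ℂ EF]
  {F : Type*} [TopologicalSpace F] [ChartedSpace EF F]
  {G : Subgroup (GL (Fin n) ℝ)}
  {P : FrameReduction (EM := EM) E G} {S : HomogeneousSubmanifold (EF := EF) F G q}
  [FiniteDimensional ℂ EF] [IsManifold 𝓘(ℝ, EF) ∞ F] [IsManifold 𝓘(ℝ, EM) ∞ M]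
  {cov : CovariantDerivative 𝓘(ℝ, EM) (Fin n → ℝ) E}
  {α : ∀ x, TangentSpace 𝓘(ℝ, EM) x →L[ℝ] E x}

theorem exists_eq_extChartAt {EN HN : Type*} [NormedAddCommGroup EN] [NormedSpace ℝ EN]
    [TopologicalSpace HN] {I : ModelWithCorners ℝ EN HN} {N : Type*} [TopologicalSpace N]
    [ChartedSpace HN N] {z₀ : N} {y : EN} (hy : y ∈ (extChartAt I z₀).target) :
    ∃ z ∈ (chartAt HN z₀).source, extChartAt I z₀ z = y := by
  refine ⟨(extChartAt I z₀).symm y, ?_, (extChartAt I z₀).right_inv hy⟩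
  rw [← extChartAt_source I]
  exact (extChartAt I z₀).map_target hy

/-- The complexified tangent space, in the chart at `x₀`. -/
def cplxChart {x₀ x : M} (hx : x ∈ (chartAt EM x₀).source) :
    (EM × EM) ≃ₗ[ℝ] ℂ ⊗[ℝ] TangentSpace 𝓘(ℝ, EM) x where
  toFun v := cplx (chartDInv 𝓘(ℝ, EM) x₀ x v.1) (chartDInv 𝓘(ℝ, EM) x₀ x v.2)
  invFun c := (chartD 𝓘(ℝ, EM) x₀ x (rePart c), chartD 𝓘(ℝ, EM) x₀ x (imPart c))
  map_add' v w := by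
    simp only [cplx, Prod.fst_add, Prod.snd_add, map_add, TensorProduct.tmul_add]
    abel
  map_smul' r v := by
    simp only [cplx, Prod.smul_fst, Prod.smul_snd, map_smul, TensorProduct.tmul_smul, smul_add,
      RingHom.id_apply]
  left_inv v := by
    simp only [rePart_cplx, imPart_cplx, chartD_chartDInv hx]
  right_inv c := by
    simp only [chartDInv_chartD hx, cplx_rePart_imPart]

variable (α) in
/-- The linear map whose kernel is `α⁻¹(p)`, in the chart at `z₀`. -/
def alphaInvMap (z₀ : AssocBundle P S) (u : ∀ x, (Fin n → ℝ) ≃ₗ[ℝ] E x) (y : EM × EF) :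
    (EM × EM) →L[ℝ] (Fin n → ℂ) :=
  LinearMap.toContinuousLinearMap
    { toFun := fun v => (1 - projCoord z₀ u y) (alphaCoord α u z₀.proj y.1 v.1
        + Complex.I • alphaCoord α u z₀.proj y.1 v.2)
      map_add' := fun v w => by
        rw [← map_add]
        refine congrArg (fun c => (1 - projCoord z₀ u y) c) ?_
        rw [Prod.fst_add, Prod.snd_add, map_add, map_add, smul_add]
        abel
      map_smul' := fun r v => by
        rw [Prod.smul_fst, Prod.smul_snd, map_smul, map_smul, smul_comm, ← smul_add]
        exact ((1 - projCoord z₀ u y).restrictScalars ℝ).map_smul r _ }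

/-! ### The spaces `α⁻¹(p)` and horizontal lifts in an adapted chart -/

namespace IsAdapted

variable {z₀ z : AssocBundle P S} {O : Set M} {u : ∀ x, (Fin n → ℝ) ≃ₗ[ℝ] E x}

theorem ker_alphaInvMap (h : IsAdapted z₀ O u)
    (hz : z ∈ (chartAt (ModelProd EM EF) z₀).source) :
    (alphaInvMap α z₀ u (extChartAt (assocModel EM EF) z₀ z)).ker
      = ((alphaInv α z).restrictScalars ℝ).comap
        (cplxChart (h.proj_mem_source z hz)).toLinearMap := by
  ext v
  change (1 - projCoord z₀ u _) (alphaCoord α u z₀.proj _ v.1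
    + Complex.I • alphaCoord α u z₀.proj _ v.2) = 0 ↔ cplx (chartDInv 𝓘(ℝ, EM) z₀.proj z.proj v.1)
      (chartDInv 𝓘(ℝ, EM) z₀.proj z.proj v.2) ∈ alphaInv α z
  have h1 : ∀ v, alphaForm α u z.proj (chartDInv 𝓘(ℝ, EM) z₀.proj z.proj v)
      = alphaCoord α u z₀.proj (extChartAt 𝓘(ℝ, EM) z₀.proj z.proj) v := fun v => by
    rw [← alphaCoord_chartD (h.proj_mem_source z hz), chartD_chartDInv (h.proj_mem_source z hz)]
  rw [mem_alphaInv_iff α (h.isLocalSection.mem _ (h.mem_of_mem_source z hz)), h1, h1,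
    projCoord_extChartAt hz, h.fst_extChartAt, sub_apply, one_apply_eq_self, sub_eq_zero, eq_comm]

/-- The kernel is real linearly isomorphic to `α⁻¹(p)`; constancy of the complex dimension thus
becomes the constant rank condition of `exists_contDiffOn_mem_ker`. -/
theorem finrank_ker_alphaInvMap (h : IsAdapted z₀ O u)
    (hz : z ∈ (chartAt (ModelProd EM EF) z₀).source) :
    finrank ℝ (alphaInvMap α z₀ u (extChartAt (assocModel EM EF) z₀ z)).ker
      = 2 * finrank ℂ (alphaInv α z) := by
  rw [h.ker_alphaInvMap hz, ← finrank_real_of_complex]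
  exact (LinearEquiv.ofSubmodule' _ _).finrank_eq

theorem contDiffOn_alphaInvMap (h : IsAdapted z₀ O u)
    (hα : ContMDiff 𝓘(ℝ, EM) (𝓘(ℝ, EM).prod 𝓘(ℝ, EM →L[ℝ] (Fin n → ℝ))) ∞
      (fun x => TotalSpace.mk' (EM →L[ℝ] (Fin n → ℝ))
        (E := fun x => TangentSpace 𝓘(ℝ, EM) x →L[ℝ] E x) x (α x))) :
    ContDiffOn ℝ ∞ (alphaInvMap α z₀ u) (extChartAt (assocModel EM EF) z₀).target := by
  refine contDiffOn_clm_apply.2 fun v y hy => ContDiffAt.contDiffWithinAt ?_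
  obtain ⟨z, hz, rfl⟩ := exists_eq_extChartAt hy
  have ha := contDiffAt_fstPullback (B' := EF) (h.contDiffAt_alphaCoord hα hz)
  have hb : ∀ v, ContDiffAt ℝ ∞ (fun y : EM × EF => alphaCoord α u z₀.proj y.1 v)
      (extChartAt (assocModel EM EF) z₀ z) := fun v => ha.clm_apply (contDiffAt_const (c := (v, 0)))
  let ev : EndC n →L[ℝ] (Fin n → ℂ) →L[ℝ] (Fin n → ℂ) :=
    ContinuousLinearMap.restrictScalarsL ℂ _ _ ℝ ℝ
  exact (ev.contDiff.contDiffAt.comp _ (contDiffAt_const.sub (h.contDiffAt_projCoord hz))).clm_apply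
    ((hb v.1).add ((hb v.2).const_smul Complex.I))

/-- Smooth families of tangent vectors of the base have smooth horizontal lifts. -/
theorem exists_contDiffOn_horizontal_lift [T2Space M] (h : IsAdapted z₀ O u)
    (hcov : CovariantDerivative.ContMDiffCovariantDerivative cov ∞) (hP : P.IsPreservedBy cov)
    {U : Set (EM × EF)} (hU : IsOpen U) (hUt : U ⊆ (extChartAt (assocModel EM EF) z₀).target)
    {y₀ : EM × EF} (hy₀ : y₀ ∈ U) {b : EM × EF → EM} (hb : ContDiffOn ℝ ∞ b U) :
    ∃ U' ⊆ U, IsOpen U' ∧ y₀ ∈ U' ∧ ∃ ζ : EM × EF → EM × EF, ContDiffOn ℝ ∞ ζ U' ∧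
      ∀ y ∈ U', (ζ y).1 = b y ∧
        flatSecond (projCoord z₀ u) (fstPullback (connCoord cov u z₀.proj)) y (ζ y) = 0 := by
  have : FiniteDimensional ℝ EF := FiniteDimensional.complexToReal EF
  let s : EM × EF → (EM × EF) →ₗ[ℝ] EndC n := fun y =>
    { toFun := flatSecond (projCoord z₀ u) (fstPullback (connCoord cov u z₀.proj)) y
      map_add' := fun v w => by
        simp only [flatSecond, map_add, add_mul, mul_add]
        abel
      map_smul' := fun r v => by
        have h1 : ∀ A B : EndC n, (r • A) * B = r • (A * B) := fun _ _ => rfl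
        have h2 : ∀ A B : EndC n, A * (r • B) = r • (A * B) := fun A B => by
          ext1 c
          exact A.toLinearMap.map_smul_of_tower r (B c)
        simp only [flatSecond, map_smul, h1, h2, smul_add, RingHom.id_apply] }
  -- A horizontal lift of `b` solves the overdetermined linear system `L ζ = (b, 0)`. It is
  -- injective because a vector without projection and vertical part is zero, and solvable by
  -- `exists_horizontal_lift`, so `exists_contDiffOn_solution` applies.
  let L : EM × EF → (EM × EF) →L[ℝ] EM × EndC n := fun y =>
    LinearMap.toContinuousLinearMap ((LinearMap.fst ℝ EM EF).prod (s y))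
  have hL : ContDiffOn ℝ ∞ L U := by
    refine contDiffOn_clm_apply.2 fun v y hy => ContDiffAt.contDiffWithinAt ?_
    obtain ⟨z, hz, rfl⟩ := exists_eq_extChartAt (hUt hy)
    have hp := h.contDiffAt_projCoord hz
    have hθ := (contDiffAt_fstPullback (B' := EF) (h.contDiffAt_connCoord hcov hz)).clm_apply
      (contDiffAt_const (c := v))
    have hdp := (hp.fderiv_right (m := ∞) (by simp)).clm_apply (contDiffAt_const (c := v))
    exact contDiffAt_const.prodMk ((ContDiffAt.clm_comp_complex hdp hp).add
      (ContDiffAt.clm_comp_complex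
        (ContDiffAt.clm_comp_complex (contDiffAt_const.sub hp) hθ) hp))
  have hs : ∀ {z}, z ∈ (chartAt (ModelProd EM EF) z₀).source →
      ∀ w : TangentSpace (assocModel EM EF) z, s (extChartAt (assocModel EM EF) z₀ z)
        (chartD (assocModel EM EF) z₀ z w) = vertPart cov u z w :=
    fun hz w => h.flatSecond_chartD hz w
  have hinj : Function.Injective (L y₀) := by
    obtain ⟨z, hz, rfl⟩ := exists_eq_extChartAt (hUt hy₀)
    refine (injective_iff_map_eq_zero _).2 fun ξ hξ => ?_
    have h1 : ξ.1 = 0 := congrArg Prod.fst hξ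
    have h2 : s (extChartAt (assocModel EM EF) z₀ z) ξ = 0 := congrArg Prod.snd hξ
    rw [← chartD_chartDInv (I := assocModel EM EF) hz ξ] at h1 h2 ⊢
    rw [hs hz] at h2
    rw [h.fst_chartD hz] at h1
    have h3 : tproj z (chartDInv (assocModel EM EF) z₀ z ξ) = 0 := by
      rw [← chartDInv_chartD (h.proj_mem_source z hz) (tproj z _), h1, map_zero]
    rw [eq_zero_of_tproj_eq_zero_of_vertPart_eq_zero h.isLocalSection (h.mem_of_mem_source z hz)
      h3 h2, map_zero]
  have hsol : ∀ y ∈ U, ∃ ξ, L y ξ = (b y, 0) := by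
    intro y hy
    obtain ⟨z, hz, rfl⟩ := exists_eq_extChartAt (hUt hy)
    obtain ⟨w, hw, hw'⟩ := exists_horizontal_lift hP z
      (chartDInv 𝓘(ℝ, EM) z₀.proj z.proj (b (extChartAt (assocModel EM EF) z₀ z)))
    refine ⟨chartD (assocModel EM EF) z₀ z w, Prod.ext ?_ ?_⟩
    · exact (h.fst_chartD hz w).trans (by rw [hw', chartD_chartDInv (h.proj_mem_source z hz)])
    · exact (hs hz w).trans (vertPart_horizontal h.isLocalSection (h.mem_of_mem_source z hz) hw)
  obtain ⟨U', hU'U, hU', hyU', ζ, hζ, hζL⟩ := exists_contDiffOn_solution hU hL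
    (hb.prodMk (contDiffOn_const (c := (0 : EndC n)))) hy₀ hinj hsol
  exact ⟨U', hU'U, hU', hyU', ζ, hζ, fun y hy =>
    ⟨congrArg Prod.fst (hζL y hy), congrArg Prod.snd (hζL y hy)⟩⟩

end IsAdapted

/-- Each vector of `α⁻¹(p)` is the projection of the value at `p` of a local section of the
distribution. -/
theorem exists_section_twistorDistribution [T2Space M]
    (hα : ContMDiff 𝓘(ℝ, EM) (𝓘(ℝ, EM).prod 𝓘(ℝ, EM →L[ℝ] (Fin n → ℝ))) ∞
      (fun x => TotalSpace.mk' (EM →L[ℝ] (Fin n → ℝ))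
        (E := fun x => TangentSpace 𝓘(ℝ, EM) x →L[ℝ] E x) x (α x)))
    (hcov : CovariantDerivative.ContMDiffCovariantDerivative cov ∞) (hP : P.IsPreservedBy cov)
    (hdim : ∀ p p' : AssocBundle P S, finrank ℂ (alphaInv α p) = finrank ℂ (alphaInv α p'))
    (z₀ : AssocBundle P S) {c : ℂ ⊗[ℝ] TangentSpace 𝓘(ℝ, EM) z₀.proj} (hc : c ∈ alphaInv α z₀) :
    ∃ (N : Set (AssocBundle P S))
      (X₁ X₂ : ∀ z : AssocBundle P S, TangentSpace (assocModel EM EF) z),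
      IsOpen N ∧ z₀ ∈ N ∧ IsSmoothVectorFieldOn (assocModel EM EF) X₁ N ∧
      IsSmoothVectorFieldOn (assocModel EM EF) X₂ N ∧
      (∀ z ∈ N, cplx (X₁ z) (X₂ z) ∈ twistorDistribution α cov z) ∧
      cplx (tproj z₀ (X₁ z₀)) (tproj z₀ (X₂ z₀)) = c := by
  obtain ⟨O, u, h⟩ := exists_isAdapted z₀
  have hz₀ : z₀ ∈ (chartAt (ModelProd EM EF) z₀).source := mem_chart_source _ z₀
  have hy₀ := mem_extChartAt_target (I := assocModel EM EF) z₀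
  let y₀ := extChartAt (assocModel EM EF) z₀ z₀
  let v₀ := (cplxChart (mem_chart_source EM z₀.proj)).symm c
  have hv₀ : alphaInvMap α z₀ u y₀ v₀ = 0 := by
    have h1 : v₀ ∈ (alphaInvMap α z₀ u y₀).ker := by
      rw [h.ker_alphaInvMap hz₀]
      change cplxChart (mem_chart_source EM z₀.proj) v₀ ∈ alphaInv α z₀
      rwa [LinearEquiv.apply_symm_apply]
    exact h1
  have hrank : ∀ y ∈ (extChartAt (assocModel EM EF) z₀).target,
      finrank ℝ (alphaInvMap α z₀ u y).ker = finrank ℝ (alphaInvMap α z₀ u y₀).ker := by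
    intro y hy
    obtain ⟨z, hz, rfl⟩ := exists_eq_extChartAt hy
    rw [h.finrank_ker_alphaInvMap hz, h.finrank_ker_alphaInvMap hz₀, hdim z z₀]
  -- By constancy of the dimension, `c` extends to a smooth family `v` of vectors of the spaces
  -- `α⁻¹(p)`. Its real and imaginary parts are then lifted separately, and both lifts have zero
  -- vertical part.
  obtain ⟨U, hUt, hU, hyU, v, hv, hvy, hvL⟩ := exists_contDiffOn_mem_ker
    (isOpen_extChartAt_target z₀) (h.contDiffOn_alphaInvMap hα) hy₀ hrank hv₀
  obtain ⟨U₁, hU₁U, hU₁, hyU₁, ζ₁, hζ₁, hζ₁'⟩ := h.exists_contDiffOn_horizontal_lift hcov hP hU hUt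
    hyU (contDiff_fst.comp_contDiffOn hv)
  obtain ⟨U₂, hU₂U, hU₂, hyU₂, ζ₂, hζ₂, hζ₂'⟩ := h.exists_contDiffOn_horizontal_lift hcov hP hU hUt
    hyU (contDiff_snd.comp_contDiffOn hv)
  have hproj : ∀ (ζ : EM × EF → EM × EF),
      tproj z₀ (ofChartField (assocModel EM EF) z₀ ζ z₀) = (ζ y₀).1 := by
    intro ζ
    have h1 := h.fst_chartD hz₀ (ofChartField (assocModel EM EF) z₀ ζ z₀)
    rw [chartD_ofChartField hz₀, chartD_self] at h1
    exact h1.symm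
  refine ⟨(extChartAt (assocModel EM EF) z₀).source
      ∩ extChartAt (assocModel EM EF) z₀ ⁻¹' (U₁ ∩ U₂),
    ofChartField (assocModel EM EF) z₀ ζ₁, ofChartField (assocModel EM EF) z₀ ζ₂,
    isOpen_extChartAt_preimage' z₀ (hU₁.inter hU₂), ⟨mem_extChartAt_source z₀, hyU₁, hyU₂⟩,
    isSmoothVectorFieldOn_ofChartField (hU₁.inter hU₂) (hζ₁.mono inter_subset_left),
    isSmoothVectorFieldOn_ofChartField (hU₁.inter hU₂) (hζ₂.mono inter_subset_right), ?_, ?_⟩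
  · rintro z ⟨hz, hz₁, hz₂⟩
    rw [extChartAt_source] at hz
    rw [← h.flatMem_iff hP hz, chartD_ofChartField hz, chartD_ofChartField hz, FlatMem,
      (hζ₁' _ hz₁).2, (hζ₂' _ hz₂).2, fstPullback_apply, fstPullback_apply, (hζ₁' _ hz₁).1,
      (hζ₂' _ hz₂).1, smul_zero, add_zero]
    refine ⟨(sub_eq_zero.1 ?_).symm, rfl⟩
    exact hvL _ (hU₁U hz₁)
  · rw [hproj, hproj, (hζ₁' _ hyU₁).1, (hζ₂' _ hyU₂).1]
    have h1 := (cplxChart (mem_chart_source EM z₀.proj)).apply_symm_apply c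
    rw [← h1]
    change cplx (v y₀).1 (v y₀).2 = cplx (chartDInv 𝓘(ℝ, EM) z₀.proj z₀.proj v₀.1)
      (chartDInv 𝓘(ℝ, EM) z₀.proj z₀.proj v₀.2)
    rw [chartDInv_self, chartDInv_self]
    exact congrArg (fun v : EM × EM => cplx v.1 v.2) hvy

/-- The criterion for the integrability of the distribution, for fibres which are given as real
manifolds. -/
theorem isIntegrable_twistorDistribution_iff [T2Space M]
    (hα : ContMDiff 𝓘(ℝ, EM) (𝓘(ℝ, EM).prod 𝓘(ℝ, EM →L[ℝ] (Fin n → ℝ))) ∞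
      (fun x => TotalSpace.mk' (EM →L[ℝ] (Fin n → ℝ))
        (E := fun x => TangentSpace 𝓘(ℝ, EM) x →L[ℝ] E x) x (α x)))
    (hcov : CovariantDerivative.ContMDiffCovariantDerivative cov ∞) (hP : P.IsPreservedBy cov)
    (hdim : ∀ p p' : AssocBundle P S, finrank ℂ (alphaInv α p) = finrank ℂ (alphaInv α p')) :
    IsIntegrable (assocModel EM EF) (fun p : AssocBundle P S => twistorDistribution α cov p) ↔
      ∀ p : AssocBundle P S, ∀ X ∈ alphaInv α p, ∀ Y ∈ alphaInv α p,
        torsionC α cov p.proj X Y ∈ p.sub ∧ ∀ e ∈ p.sub, curvatureC cov p.proj X Y e ∈ p.sub := by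
  constructor
  · intro h z X hX Y hY
    -- Both vectors are realized as projections of values of sections; integrability is then tested
    -- on their bracket at the single point `z`.
    obtain ⟨N, X₁, X₂, hN, hzN, hX₁, hX₂, hXD, rfl⟩ :=
      exists_section_twistorDistribution hα hcov hP hdim z hX
    obtain ⟨N', Y₁, Y₂, hN', hzN', hY₁, hY₂, hYD, rfl⟩ :=
      exists_section_twistorDistribution hα hcov hP hdim z hY
    have hX₁' : IsSmoothVectorFieldOn (assocModel EM EF) X₁ (N ∩ N') := fun z hz => hX₁ z hz.1
    have hX₂' : IsSmoothVectorFieldOn (assocModel EM EF) X₂ (N ∩ N') := fun z hz => hX₂ z hz.1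
    have hY₁' : IsSmoothVectorFieldOn (assocModel EM EF) Y₁ (N ∩ N') := fun z hz => hY₁ z hz.2
    have hY₂' : IsSmoothVectorFieldOn (assocModel EM EF) Y₂ (N ∩ N') := fun z hz => hY₂ z hz.2
    have hXD' := fun z (hz : z ∈ N ∩ N') => hXD z hz.1
    have hYD' := fun z (hz : z ∈ N ∩ N') => hYD z hz.2
    exact (mlieBracket_mem_twistorDistribution_iff hα hcov hP (hN.inter hN') hX₁' hX₂' hY₁' hY₂'
      hXD' hYD' ⟨hzN, hzN'⟩).1 (h (N ∩ N') X₁ X₂ Y₁ Y₂ (hN.inter hN') hX₁' hX₂' hY₁' hY₂'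
        hXD' hYD' z ⟨hzN, hzN'⟩)
  · intro h N X₁ X₂ Y₁ Y₂ hN hX₁ hX₂ hY₁ hY₂ hXD hYD z hz
    obtain ⟨O, u, hzO, hu⟩ := P.exists_section z.proj
    -- Vectors of the distribution project into `α⁻¹(p)`, so the hypothesis applies to the values of
    -- any two sections.
    have hproj := fun w₁ w₂ (hw : cplx w₁ w₂ ∈ twistorDistribution α cov z) =>
      ((mem_twistorDistribution_iff α hP hu hzO w₁ w₂).1 hw).1
    exact (mlieBracket_mem_twistorDistribution_iff hα hcov hP hN hX₁ hX₂ hY₁ hY₂ hXD hYD hz).2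
      (h z _ (hproj _ _ (hXD z hz)) _ (hproj _ _ (hYD z hz)))

end Sections

end IntRes
end

theorem theoremC3
    {n q : ℕ}
    {EM : Type*} [NormedAddCommGroup EM] [NormedSpace ℝ EM] [FiniteDimensional ℝ EM]
    {M : Type*} [TopologicalSpace M] [T2Space M] [ChartedSpace EM M] [IsManifold 𝓘(ℝ, EM) ∞ M]
    {E : M → Type*} [∀ x, AddCommGroup (E x)] [∀ x, Module ℝ (E x)]
    [∀ x, TopologicalSpace (E x)] [∀ x, IsTopologicalAddGroup (E x)]
    [∀ x, ContinuousSMul ℝ (E x)] [TopologicalSpace (TotalSpace (Fin n → ℝ) E)]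
    [FiberBundle (Fin n → ℝ) E] [VectorBundle ℝ (Fin n → ℝ) E]
    [ContMDiffVectorBundle ∞ (Fin n → ℝ) E 𝓘(ℝ, EM)]
    (α : ∀ x, TangentSpace 𝓘(ℝ, EM) x →L[ℝ] E x)
    (hα : ContMDiff 𝓘(ℝ, EM) (𝓘(ℝ, EM).prod 𝓘(ℝ, EM →L[ℝ] (Fin n → ℝ))) ∞
      (fun x => TotalSpace.mk' (EM →L[ℝ] (Fin n → ℝ))
        (E := fun x => TangentSpace 𝓘(ℝ, EM) x →L[ℝ] E x) x (α x)))
    (cov : CovariantDerivative 𝓘(ℝ, EM) (Fin n → ℝ) E)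
    (hcov : CovariantDerivative.ContMDiffCovariantDerivative cov ∞)
    (G : Subgroup (GL (Fin n) ℝ))
    (P : IntRes.FrameReduction (EM := EM) E G)
    (hP : P.IsPreservedBy cov)
    {EF : Type*} [NormedAddCommGroup EF] [NormedSpace ℂ EF] [FiniteDimensional ℂ EF]
    {F : Type*} [TopologicalSpace F] [ChartedSpace EF F] [IsManifold 𝓘(ℂ, EF) ω F]
    (S : IntRes.HomogeneousSubmanifold (EF := EF) F G q)
    (hdim : ∀ p p' : IntRes.AssocBundle P S,
      Module.finrank ℂ (IntRes.alphaInv α p) = Module.finrank ℂ (IntRes.alphaInv α p')) :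
    IntRes.IsIntegrable (IntRes.assocModel EM EF)
        (fun p : IntRes.AssocBundle P S => IntRes.twistorDistribution α cov p) ↔
      ∀ p : IntRes.AssocBundle P S, ∀ X ∈ IntRes.alphaInv α p, ∀ Y ∈ IntRes.alphaInv α p,
        IntRes.torsionC α cov p.proj X Y ∈ p.sub ∧
        ∀ e ∈ p.sub, IntRes.curvatureC cov p.proj X Y e ∈ p.sub := by
  -- The total space is treated as a real manifold, so the fibre enters with the smooth structure
  -- that underlies its holomorphic one.
  have := IntRes.isManifold_restrictScalars EF F
  exact IntRes.isIntegrable_twistorDistribution_iff hα hcov hP hdim
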